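/- **Setting.** Let $G$ be a compact Hausdorff group with normalized Haar measure $dU$, let $g\mapsto U_g$ be a continuous unitary representation of $G$ on $\mathbb C^d$, $d\ge 1$ (we write $U$ for $U_g$), and let $N\ge 0$, $M\ge 1$. Write $|A\rangle\!\rangle=\sum_{m,n}\langle m|A|n\rangle\,|m\rangle|n\rangle$. Denote by $\mathcal H_i\simeq\mathcal H_o\simeq(\mathbb C^d)^{\otimes N}$ the spaces of the inputs and of the outputs of the $N$ examples. *Learning strategies.* A storing comb with no slot is the scalar $1$; a storing comb with $n+1$ slots is an operator $I\otimes A$, with $I$ the identity on the last example output, $A\ge 0$, and the partial trace of $A$ over the last example input a storing comb with $n$ slots. A learning comb is an operator $L\ge 0$ on (final output $(\mathbb C^d)^{\otimes M}$) $\otimes$ (final input $(\mathbb C^d)^{\otimes M}$) $\otimes\,\mathcal H_o\otimes\mathcal H_i$ with $\mathrm{Tr}_{\rm final\ output}L=I_{\rm final\ input}\otimes S$, where $S$ is a storing comb with $N$ slots. The channel obtained by the user has Choi operator $C_U=\mathrm{Tr}_{o,i}[L\,(I\otimes(|U^{\otimes N}\rangle\!\rangle\langle\!\langle U^{\otimes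 N}|)^T)]$. If a storing board has as Choi operator a positive operator on memory $\otimes\,\mathcal H_o\otimes\mathcal H_i$ whose partial trace over the memory is a storing comb, and $R$ is the Choi operator of a retrieving channel from (final input) $\otimes$ memory to the final output, their composition (link product) is a learning comb. *Figures of merit.* The global fidelity of $L$ is $F_M(L)=\int dU\,\langle\!\langle U^{\otimes M}|C_U|U^{\otimes M}\rangle\!\rangle/d^{2M}$. For $1\le i\le M$ and a state $\Sigma$ on $M-1$ systems, let $\mathcal C^{(i)}_{U,\Sigma}(\rho)=\mathrm{Tr}_{\bar\imath}[\mathcal C_U(\rho\otimes\Sigma)]$ be the $i$-th local channel ($\rho$ on the $i$-th input, $\Sigma$ on the others, all outputs but the $i$-th discarded), with Choi operator $C^{(i)}_{U,\Sigma}$; the single-copy fidelity is $F^{(i)}_\Sigma(L)=\int dU\,\langle\!\langle U|C^{(i)}_{U,\Sigma}|U\rangle\!\rangle/d^2$. *Measure-and-rotate.* Choose one unitary irreducible representation $U_j$, on $\mathcal H_j$ of dimension $d_j$, from each equivalence class of irreducible representations contained in $U^{\otimes N}$, and isometries $W_j:\mathcal H_j\to(\mathbb C^d)^{\otimes N}$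 intertwining $U_j$ and $U^{\otimes N}$; embed $\widetilde{\mathcal H}=\bigoplus_j\mathcal H_j\otimes\mathcal H_j$ in $\mathcal H_o\otimes\mathcal H_i$ by $\bigoplus_j W_j\otimes\overline{W_j}$. For probabilities $p=(p_j)$ let $|\varphi\rangle=\bigoplus_j\sqrt{p_j/d_j}\,|I_j\rangle\!\rangle$ and $|\varphi_U\rangle=(U^{\otimes N}\otimes I)|\varphi\rangle$. Let $|\eta_{\hat U}\rangle=\bigoplus_j\sqrt{d_j}\,|\hat U_j\rangle\!\rangle$ and $P_{\hat U}=|\eta_{\hat U}\rangle\langle\eta_{\hat U}|$. The strategy $L_{p,M}$ applies the examples in parallel on $|\varphi\rangle$, measures $P_{\hat U}\,d\hat U$ (a POVM on $\widetilde{\mathcal H}$, completed by the constant density $I-\Pi_{\widetilde{\mathcal H}}$ to a POVM on $\mathcal H_o\otimes\mathcal H_i$, $\Pi_{\widetilde{\mathcal H}}$ being the projector on $\widetilde{\mathcal H}$), and on outcome $\hat U$ applies $\hat U^{\otimes M}$ to the input. Let $f_M(U,\hat U)=(|\mathrm{Tr}\,U^\dagger\hat U|/d)^{2M}$ and $$\langle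 f_M\rangle(p)=\int dU\int d\hat U\; f_M(U,\hat U)\,\langle\varphi_U|P_{\hat U}|\varphi_U\rangle .$$ **Theorem.** Such choices of $(U_j,W_j)_j$ exist. For every such choice, the completed $P_{\hat U}\,d\hat U$ is a POVM, parallel storage on $|\varphi\rangle$ is a storing board, measure-and-rotate is a retrieving channel, $L_{p,M}$ is a learning comb, and: 1. (Global fidelity.) For every $M\ge1$: (a) for every $p$, $F_M(L_{p,M})=\langle f_M\rangle(p)$, which is also the mean of $f_M$ when the completed POVM is measured after parallel storage, and no retrieving channel applied after parallel storage on $|\varphi\rangle$ has larger global fidelity; (b) there is a $p$ that maximizes $\langle f_M\rangle$ over the probability distributions; (c) for every maximizing $p$, $F_M(L)\le\langle f_M\rangle(p)$ for every learning comb $L$. Moreover $\langle f_M\rangle(p)$ is the maximal mean of $f_M$ over all estimation strategies (any storing board, with any finite-dimensional memory, followed by any POVM on the memory with outcomes in $G$, given as a density with respect to any finite measure). Hence optimal learning is optimal estimation for the goal function $f_M$, implemented by measuring $P_{\hat U}$ and applying $\hat U^{\otimes M}$. 2. (Single-copy fidelity.) For every $p$, every $M\ge 1$, $1\le i\le M$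 and state $\Sigma$ on $M-1$ systems: (a) $F^{(i)}_\Sigma(L_{p,M})=\langle f_1\rangle(p)$, independently of $M$, $i$, $\Sigma$; (b) no retrieving channel applied after parallel storage on $|\varphi\rangle$ has larger single-copy fidelity; (c) if $p$ maximizes $\langle f_1\rangle$, then $F^{(i)}_\Sigma(L)\le\langle f_1\rangle(p)$ for every learning comb $L$ with $M$ output copies. Hence the optimal single-copy fidelity is the optimal fidelity for $M=1$ and does not decrease with $M$. -/

import Mathlib

open scoped ComplexOrder Kronecker
open MeasureTheory

namespace QLearn

noncomputable section

/-! ### Tensor powers and double kets -/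

/-- The computational basis of `(ℂ^d)^{⊗ n}`. -/
abbrev Pow (d n : ℕ) : Type := Fin n → Fin d

/-- The tensor power `A^{⊗ n}` of a square matrix, as a monoid homomorphism in `A`. -/
def tpow (d n : ℕ) :
    Matrix (Fin d) (Fin d) ℂ →* Matrix (Pow d n) (Pow d n) ℂ where
  toFun A := Matrix.of fun x y => ∏ k, A (x k) (y k)
  map_one' := by
    ext x y
    by_cases h : x = y
    · subst h; simp
    · obtain ⟨k, hk⟩ := Function.ne_iff.mp h
      rw [Matrix.one_apply_ne h, Matrix.of_apply]
      exact Finset.prod_eq_zero (Finset.mem_univ k) (Matrix.one_apply_ne hk)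
  map_mul' A B := by
    ext x y
    simp only [Matrix.of_apply, Matrix.mul_apply, Finset.prod_univ_sum, Fintype.piFinset_univ,
      Finset.prod_mul_distrib]

/-- The bipartite vector `|A⟩⟩ = ∑ ⟨m|A|n⟩ |m⟩|n⟩`. -/
def dket {m n : Type*} (A : Matrix m n ℂ) : m × n → ℂ := fun x => A x.1 x.2

/-! ### Choi operators, quantum combs

The Choi operator of a map from a system `H` to a system `K` is indexed by `K × H`
(output, input). -/

/-- A density matrix. -/
def IsState {m : Type*} [Fintype m] (ρ : Matrix m m ℂ) : Prop :=
  ρ.PosSemidef ∧ ρ.trace = 1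

/-- Normalization of the comb of a storing board with `n` slots, after the memory has been traced
out. An index is a pair `(o, i)`: `o` is the string of the `n` example outputs, `i` the string of
the `n` example inputs, in causal order `i 0, o 0, i 1, o 1, …`. With `n + 1` slots, the comb is
the identity on the last example output tensor a positive `A`, and tracing the last example input
out of `A` leaves a comb with `n` slots. With no slot it is the scalar `1`. -/
def IsStoringComb (d : ℕ) :
    (n : ℕ) → Matrix (Pow d n × Pow d n) (Pow d n × Pow d n) ℂ → Prop
  | 0, S => S = 1
  | n + 1, S =>
      ∃ A : Matrix (Pow d n × Pow d (n + 1)) (Pow d n × Pow d (n + 1)) ℂ,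
        A.PosSemidef ∧
        (∀ o i o' i', S (o, i) (o', i') =
          if o (Fin.last n) = o' (Fin.last n) then
            A (fun k => o k.castSucc, i) (fun k => o' k.castSucc, i') else 0) ∧
        IsStoringComb d n (Matrix.of fun w w' =>
          ∑ a : Fin d, A (w.1, Fin.snoc (α := fun _ => Fin d) w.2 a)
            (w'.1, Fin.snoc (α := fun _ => Fin d) w'.2 a))

/-- The index type of a learning comb: `((final output, final input), (o, i))`, where the final
output and the final input consist of `M` systems and `o`, `i` are the outputs and the inputs of
the `N` examples. -/
abbrev CombIdx (d N M : ℕ) : Type := (Pow d M × Pow d M) × (Pow d N × Pow d N)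

/-- The comb of a learning process with `N` examples and `M` output copies: a positive operator
whose partial trace over the final output is the identity on the final input tensor the comb of
a storing board. -/
def IsLearningComb {d N M : ℕ} (L : Matrix (CombIdx d N M) (CombIdx d N M) ℂ) : Prop :=
  L.PosSemidef ∧
    ∃ S : Matrix (Pow d N × Pow d N) (Pow d N × Pow d N) ℂ, IsStoringComb d N S ∧
      ∀ y w y' w', ∑ x, L ((x, y), w) ((x, y'), w') = if y = y' then S w w' else 0

/-- A storing board with `N` slots and quantum memory `m`, given by its Choi operator. -/
def IsStoringBoard {d N : ℕ} {m : Type*} [Fintype m]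
    (S : Matrix (m × (Pow d N × Pow d N)) (m × (Pow d N × Pow d N)) ℂ) : Prop :=
  S.PosSemidef ∧ IsStoringComb d N (Matrix.of fun w w' => ∑ a, S (a, w) (a, w'))

/-- The Choi operator of a retrieving channel from `M` input systems and the memory `m` to `M`
output systems; an index is `((output, input), memory)`. -/
def IsRetrieving {d M : ℕ} {m : Type*} [Fintype m] [DecidableEq m]
    (R : Matrix ((Pow d M × Pow d M) × m) ((Pow d M × Pow d M) × m) ℂ) : Prop :=
  R.PosSemidef ∧ ∀ y a y' a', ∑ x, R ((x, y), a) ((x, y'), a') =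
    if y = y' ∧ a = a' then 1 else 0

/-- The link product `R * S` over the memory: the comb of the learning process that stores with
the board `S` and retrieves with the channel `R`. -/
def link {x w m : Type*} [Fintype m] (R : Matrix (x × m) (x × m) ℂ) (S : Matrix (m × w) (m × w) ℂ) :
    Matrix (x × w) (x × w) ℂ :=
  Matrix.of fun u u' => ∑ a, ∑ a', R (u.1, a) (u'.1, a') * S (a, u.2) (a', u'.2)

/-- The link product `L * |V⟩⟩⟨⟨V| = Tr_{o,i}[L (I ⊗ (|V⟩⟩⟨⟨V|)ᵀ)]`, that is, the examples `V`
are inserted in the slots of `L`. -/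
def plug {x o i : Type*} [Fintype o] [Fintype i]
    (L : Matrix (x × (o × i)) (x × (o × i)) ℂ) (V : Matrix o i ℂ) : Matrix x x ℂ :=
  Matrix.of fun u u' => ∑ w, ∑ w', L (u, w) (u', w') * (dket V w * star (dket V w'))

/-- The channel fidelity `⟨⟨V| C |V⟩⟩ / (dim)²` between the channel with Choi operator `C` and
the unitary `V`. -/
def chFid {n : Type*} [Fintype n] (C : Matrix (n × n) (n × n) ℂ) (V : Matrix n n ℂ) : ℝ :=
  (star (dket V) ⬝ᵥ C.mulVec (dket V)).re / (Fintype.card n : ℝ) ^ 2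

/-- The Choi operator of the local channel `ρ ↦ Tr_{all but i}[C (ρ ⊗ Σ)]`, in which the `i`-th
input is `ρ` and the remaining `m` inputs are in the state `Σ` (here `T`). -/
def localChoi {d m : ℕ} (C : Matrix (Pow d (m + 1) × Pow d (m + 1))
    (Pow d (m + 1) × Pow d (m + 1)) ℂ) (i : Fin (m + 1)) (T : Matrix (Pow d m) (Pow d m) ℂ) :
    Matrix (Fin d × Fin d) (Fin d × Fin d) ℂ :=
  Matrix.of fun u u' => ∑ y : Pow d m, ∑ s : Pow d m, ∑ s' : Pow d m,
    C (i.insertNth (α := fun _ => Fin d) u.1 y, i.insertNth (α := fun _ => Fin d) u.2 s)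
      (i.insertNth (α := fun _ => Fin d) u'.1 y, i.insertNth (α := fun _ => Fin d) u'.2 s') * T s s'

/-! ### Figures of merit -/

section FiguresOfMerit

/-- The unitary matrix `U_g`. -/
abbrev mat {G n : Type*} [Group G] [Fintype n] [DecidableEq n]
    (U : G →* Matrix.unitaryGroup n ℂ) (g : G) : Matrix n n ℂ := (U g : Matrix n n ℂ)

/-- The channel `C_U` (its Choi operator) obtained when the `N` examples of `U_g` are inserted
in `L`. -/
def outChoi {G : Type*} [Group G] {d N M : ℕ} (U : G →* Matrix.unitaryGroup (Fin d) ℂ)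
    (L : Matrix (CombIdx d N M) (CombIdx d N M) ℂ) (g : G) :
    Matrix (Pow d M × Pow d M) (Pow d M × Pow d M) ℂ :=
  plug L (tpow d N (mat U g))

/-- Global fidelity: the fidelity of `C_U` with `U^{⊗ M}`, averaged over the group. -/
def globalFid {G : Type*} [Group G] [MeasurableSpace G] (ν : Measure G) {d N M : ℕ}
    (U : G →* Matrix.unitaryGroup (Fin d) ℂ)
    (L : Matrix (CombIdx d N M) (CombIdx d N M) ℂ) : ℝ :=
  ∫ g, chFid (outChoi U L g) (tpow d M (mat U g)) ∂ν

/-- Single-copy fidelity: the fidelity of the `i`-th local channel of `C_U` with `U`, averaged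
over the group, when the other inputs are in the state `T`. -/
def singleFid {G : Type*} [Group G] [MeasurableSpace G] (ν : Measure G) {d N m : ℕ}
    (U : G →* Matrix.unitaryGroup (Fin d) ℂ) (i : Fin (m + 1)) (T : Matrix (Pow d m) (Pow d m) ℂ)
    (L : Matrix (CombIdx d N (m + 1)) (CombIdx d N (m + 1)) ℂ) : ℝ :=
  ∫ g, chFid (localChoi (outChoi U L g) i T) (mat U g) ∂ν

/-- The goal function `f_M(U, Û) = (|Tr[U† Û]| / d)^{2M}`. -/
def goal {G : Type*} [Group G] {d : ℕ} (U : G →* Matrix.unitaryGroup (Fin d) ℂ) (M : ℕ)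
    (g h : G) : ℝ :=
  (‖((mat U g).conjTranspose * mat U h).trace‖ / (d : ℝ)) ^ (2 * M)

/-- A POVM on the system `m` with outcomes in `G`, written as a density with respect to `μ`. -/
def IsPOVM {G m : Type*} [MeasurableSpace G] [Fintype m] [DecidableEq m] (μ : Measure G)
    (P : G → Matrix m m ℂ) : Prop :=
  (∀ h, (P h).PosSemidef) ∧ (∀ a b, Integrable (fun h => P h a b) μ) ∧
    ∀ a b, ∫ h, P h a b ∂μ = (1 : Matrix m m ℂ) a b

/-- The expectation of the goal function when the unknown unitary is stored with the board `S`
and the POVM `P dμ` is measured on the memory. -/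
def estValue {G : Type*} [Group G] [MeasurableSpace G] (ν : Measure G) {d N : ℕ} {m : Type*}
    [Fintype m] (U : G →* Matrix.unitaryGroup (Fin d) ℂ) (M : ℕ)
    (S : Matrix (m × (Pow d N × Pow d N)) (m × (Pow d N × Pow d N)) ℂ)
    (μ : Measure G) (P : G → Matrix m m ℂ) : ℝ :=
  ∫ g, ∫ h, goal U M g h * (P h * plug S (tpow d N (mat U g))).trace.re ∂μ ∂ν

/-- The measure-and-rotate retrieving channel (its Choi operator): measure the POVM `P dμ` on the
memory and, on outcome `h`, apply `U_h^{⊗ M}` to the input, i.e. `∫ |V_h⟩⟩⟨⟨V_h| ⊗ P_hᵀ dμ(h)`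
with `V_h = U_h^{⊗ M}`. -/
def measureRotate {G : Type*} [Group G] [MeasurableSpace G] {d : ℕ} {m : Type*}
    (U : G →* Matrix.unitaryGroup (Fin d) ℂ) (M : ℕ) (μ : Measure G) (P : G → Matrix m m ℂ) :
    Matrix ((Pow d M × Pow d M) × m) ((Pow d M × Pow d M) × m) ℂ :=
  Matrix.of fun u u' => ∫ h, dket (tpow d M (mat U h)) u.1 *
    star (dket (tpow d M (mat U h)) u'.1) * P h u'.2 u.2 ∂μ

end FiguresOfMerit

/-! ### Parallel storage -/

/-- The state `(V ⊗ I)|φ⟩` of a bipartite system. -/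
def applyFst {o i r : Type*} [Fintype i] (V : Matrix o i ℂ) (φ : i × r → ℂ) : o × r → ℂ :=
  fun w => ∑ k, V w.1 k * φ (k, w.2)

/-- Parallel storage with input state `φ`: prepare `φ`, send its first `N` systems through the `N`
examples in parallel, and keep the outputs and the reference `r` in the memory `Pow d N × r`. -/
def parallelBoard {d N : ℕ} {r : Type*} (φ : Pow d N × r → ℂ) :
    Matrix ((Pow d N × r) × (Pow d N × Pow d N)) ((Pow d N × r) × (Pow d N × Pow d N)) ℂ :=
  Matrix.of fun u u' =>
    (if u.1.1 = u.2.1 then φ (u.2.2, u.1.2) else 0) *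
      star (if u'.1.1 = u'.2.1 then φ (u'.2.2, u'.1.2) else 0)

/-- Parallel storage leaves the memory in the pure state `φ_V = (V ⊗ I)|φ⟩`. -/
theorem plug_parallelBoard {d N : ℕ} {r : Type*} (φ : Pow d N × r → ℂ)
    (V : Matrix (Pow d N) (Pow d N) ℂ) :
    plug (parallelBoard φ) V = Matrix.vecMulVec (applyFst V φ) (star (applyFst V φ)) := by
  have key : ∀ u : Pow d N × r, ∑ w : Pow d N × Pow d N,
      (if u.1 = w.1 then φ (w.2, u.2) else 0) * dket V w = applyFst V φ u := by
    intro u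
    rw [Fintype.sum_prod_type]
    simp [dket, applyFst, mul_comm]
  ext u u'
  simp only [plug, parallelBoard, Matrix.of_apply, Matrix.vecMulVec_apply, Pi.star_apply]
  rw [← key u, ← key u', star_sum, Finset.sum_mul_sum]
  refine Finset.sum_congr rfl fun w _ => Finset.sum_congr rfl fun w' _ => ?_
  rw [star_mul']
  ring

/-! ### The irreducible representations in `U^{⊗ N}` -/

/-- A matrix representation as a linear representation. -/
def rep {G n : Type*} [Group G] [Fintype n] [DecidableEq n]
    (σ : G →* Matrix.unitaryGroup n ℂ) : Representation ℂ G (n → ℂ) :=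
  (Matrix.toLinAlgEquiv' (R := ℂ) (n := n) : Matrix n n ℂ →* ((n → ℂ) →ₗ[ℂ] (n → ℂ))).comp
    ((Matrix.unitaryGroup n ℂ).subtype.comp σ)

/-- A choice of `Irr(U^{⊗ N})`: unitary irreducible representations `U_j`, one from each
equivalence class of irreducible representations contained in `U^{⊗ N}`, together with, for each
`j`, an isometry `W_j` that identifies `ℂ^{d_j}` with a subrepresentation of `U^{⊗ N}`. -/
structure Irr {G : Type*} [Group G] {d : ℕ} (U : G →* Matrix.unitaryGroup (Fin d) ℂ)
    (N : ℕ) where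
  num : ℕ
  dim : Fin num → ℕ
  irr : ∀ j, G →* Matrix.unitaryGroup (Fin (dim j)) ℂ
  emb : ∀ j, Matrix (Pow d N) (Fin (dim j)) ℂ
  irreducible : ∀ j, (rep (irr j)).IsIrreducible
  inequivalent : ∀ j k, Nonempty ((rep (irr j)).Equiv (rep (irr k))) → j = k
  isometry : ∀ j, (emb j).conjTranspose * emb j = 1
  intertwines : ∀ j g, tpow d N (mat U g) * emb j = emb j * mat (irr j) g
  complete : ∀ (n : ℕ) (τ : G →* Matrix.unitaryGroup (Fin n) ℂ), (rep τ).IsIrreducible →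
    ∀ W : Matrix (Pow d N) (Fin n) ℂ, W ≠ 0 →
      (∀ g, tpow d N (mat U g) * W = W * mat τ g) → ∃ j, Nonempty ((rep τ).Equiv (rep (irr j)))

namespace Irr

/-- The space `⨁_j H_j ⊗ H_j` is embedded in `H_o ⊗ H_i` by `⨁_j W_j ⊗ conj W_j`; the image of
`|A⟩⟩ ∈ H_j ⊗ H_j` is `|W_j A W_j†⟩⟩`. -/
def lift {G : Type*} [Group G] {d N : ℕ} {U : G →* Matrix.unitaryGroup (Fin d) ℂ} (D : Irr U N)
    (j : Fin D.num) (A : Matrix (Fin (D.dim j)) (Fin (D.dim j)) ℂ) : Pow d N × Pow d N → ℂ :=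
  dket (D.emb j * A * (D.emb j).conjTranspose)

/-- The input state `|φ⟩ = ⨁_j √(p_j / d_j) |I_j⟩⟩`. -/
def inputState {G : Type*} [Group G] {d N : ℕ} {U : G →* Matrix.unitaryGroup (Fin d) ℂ}
    (D : Irr U N) (p : Fin D.num → ℝ) : Pow d N × Pow d N → ℂ :=
  ∑ j, (Real.sqrt (p j / D.dim j) : ℂ) • D.lift j 1

/-- The stored state `|φ_U⟩ = (U^{⊗ N} ⊗ I)|φ⟩`. -/
def stored {G : Type*} [Group G] {d N : ℕ} {U : G →* Matrix.unitaryGroup (Fin d) ℂ}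
    (D : Irr U N) (p : Fin D.num → ℝ) (g : G) : Pow d N × Pow d N → ℂ :=
  applyFst (tpow d N (mat U g)) (D.inputState p)

/-- The vector `|η_Û⟩ = ⨁_j √d_j |Û_j⟩⟩`. -/
def eta {G : Type*} [Group G] {d N : ℕ} {U : G →* Matrix.unitaryGroup (Fin d) ℂ}
    (D : Irr U N) (h : G) : Pow d N × Pow d N → ℂ :=
  ∑ j, (Real.sqrt (D.dim j) : ℂ) • D.lift j (mat (D.irr j) h)

/-- The operator `P_Û = |η_Û⟩⟨η_Û|`. -/
def etaOp {G : Type*} [Group G] {d N : ℕ} {U : G →* Matrix.unitaryGroup (Fin d) ℂ}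
    (D : Irr U N) (h : G) : Matrix (Pow d N × Pow d N) (Pow d N × Pow d N) ℂ :=
  Matrix.vecMulVec (D.eta h) (star (D.eta h))

/-- The orthogonal projector of `H_o ⊗ H_i` onto the (image of the) space `⨁_j H_j ⊗ H_j`. -/
def proj {G : Type*} [Group G] {d N : ℕ} {U : G →* Matrix.unitaryGroup (Fin d) ℂ}
    (D : Irr U N) : Matrix (Pow d N × Pow d N) (Pow d N × Pow d N) ℂ :=
  ∑ j, (D.emb j * (D.emb j).conjTranspose) ⊗ₖ (D.emb j * (D.emb j).conjTranspose).transpose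

/-- The POVM `P_Û` on `⨁_j H_j ⊗ H_j`, completed to a POVM on `H_o ⊗ H_i` by a term that vanishes
on `⨁_j H_j ⊗ H_j`, hence on all the stored states. -/
def povm {G : Type*} [Group G] {d N : ℕ} {U : G →* Matrix.unitaryGroup (Fin d) ℂ}
    (D : Irr U N) (h : G) : Matrix (Pow d N × Pow d N) (Pow d N × Pow d N) ℂ :=
  D.etaOp h + (1 - D.proj)

/-- `⟨f_M⟩ = ∫ dU ∫ dÛ f_M(U, Û) ⟨φ_U| P_Û |φ_U⟩`. -/
def meanGoal {G : Type*} [Group G] [MeasurableSpace G] (ν : Measure G) {d N : ℕ}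
    {U : G →* Matrix.unitaryGroup (Fin d) ℂ} (D : Irr U N) (M : ℕ) (p : Fin D.num → ℝ) : ℝ :=
  ∫ g, ∫ h, goal U M g h *
    (star (D.stored p g) ⬝ᵥ (D.etaOp h).mulVec (D.stored p g)).re ∂ν ∂ν

/-- The comb of the learning strategy: parallel storage on `⨁_j √(p_j / d_j) |I_j⟩⟩`, measurement
of `P_Û`, and application of `Û^{⊗ M}`. -/
def strategy {G : Type*} [Group G] [MeasurableSpace G] (ν : Measure G) {d N : ℕ}
    {U : G →* Matrix.unitaryGroup (Fin d) ℂ} (D : Irr U N) (M : ℕ) (p : Fin D.num → ℝ) :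
    Matrix (CombIdx d N M) (CombIdx d N M) ℂ :=
  link (measureRotate U M ν D.povm) (parallelBoard (D.inputState p))

end Irr

end

end QLearn

namespace QLearn

noncomputable section

/-! ### Schur's lemma and complete reducibility for matrix representations -/

section RepresentationTheory

variable {G : Type*} [Group G]

/-! All the upper bounds come from a single inequality, `Irr.integral_chFid_le`. Take a learning
comb `L` with storing comb `S` and any continuous unitary representation `W` on the final systems.
The averaged fidelity with `W` is the integral of the positive form of `L` at the vector ξ_g =
|W_g⟩⟩ ⊗ conj |U_g^{⊗N}⟩⟩. Expanding the matrix elements of U^{⊗N} in those of the irreducibles U_j,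
and each W ⊗ conj U_j into irreducible pieces σ_{jμ}, writes ξ_g as a sum of vectors whose entries
are coefficient functions of the σ_{jμ}.

Schur orthogonality kills the cross terms between inequivalent pieces. Cross terms between
equivalent pieces are controlled by Cauchy–Schwarz, so only the diagonal terms need an estimate.
Each diagonal term is at most a weight w_j that depends on `S` and j alone
(`integral_component_le`): positivity lets one piece be replaced by the whole of W ⊗ conj U_j, the
normalization of `L` removes the final systems, and irreducibility of U_j makes the remaining
partial trace a multiple of the identity. The resulting bound, a sum of √w_j √w_k over pairs of
equivalent pieces, is by orthogonality of characters the integral of |χ_W|² |∑_j √w_j χ_j|².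

By invariance of the Haar measure, the mean goal function is exactly such an integral: ⟨f_M⟩(p) = ∫
(|χ_U|/d)^{2M} |∑_j √p_j χ_j|² (`Irr.meanGoal_eq`). The choice W = U^{⊗M} therefore gives the global
bound ⟨f_M⟩(w). Tracing the comb down to one copy and choosing W = U gives the single-copy bound
⟨f_1⟩(w). The weights form a probability distribution (`Irr.weight_mem_stdSimplex`), so a maximizing
p beats every comb. For parallel storage on φ they equal p (`Irr.weight_parallelBoard`), so for that
input state the bound holds at p itself.

The bounds are attained because measure-and-rotate has as fidelity the value of its estimation
strategy (`globalFid_measureRotate`), and its local channels are measure-and-rotate channels for a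
single copy (`localComb_measureRotate`). The first fact also embeds every estimation strategy among
the learning combs. -/

lemma rep_apply {n : Type*} [Fintype n] [DecidableEq n] (σ : G →* Matrix.unitaryGroup n ℂ) (g : G)
    (v : n → ℂ) : rep σ g v = (mat σ g).mulVec v := rfl

lemma mat_mul {n : Type*} [Fintype n] [DecidableEq n] (σ : G →* Matrix.unitaryGroup n ℂ) (g h : G) :
    mat σ (g * h) = mat σ g * mat σ h := by simp [mat]

lemma mat_one {n : Type*} [Fintype n] [DecidableEq n] (σ : G →* Matrix.unitaryGroup n ℂ) :
    mat σ 1 = 1 := by simp [mat]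

lemma mat_inv {n : Type*} [Fintype n] [DecidableEq n] (σ : G →* Matrix.unitaryGroup n ℂ) (g : G) :
    mat σ g⁻¹ = (mat σ g).conjTranspose := by
  simp [mat, Matrix.star_eq_conjTranspose]

lemma conjTranspose_mat_mul {n : Type*} [Fintype n] [DecidableEq n]
    (σ : G →* Matrix.unitaryGroup n ℂ) (g : G) : (mat σ g).conjTranspose * mat σ g = 1 := by
  rw [← mat_inv, ← mat_mul, inv_mul_cancel, mat_one]

lemma mat_mul_conjTranspose {n : Type*} [Fintype n] [DecidableEq n]
    (σ : G →* Matrix.unitaryGroup n ℂ) (g : G) : mat σ g * (mat σ g).conjTranspose = 1 := by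
  rw [← mat_inv, ← mat_mul, mul_inv_cancel, mat_one]

/-- A matrix that intertwines two matrix representations, as an intertwining map. -/
def toIntertwiningMap {n m : Type*} [Fintype n] [DecidableEq n] [Fintype m] [DecidableEq m]
    (σ : G →* Matrix.unitaryGroup n ℂ) (τ : G →* Matrix.unitaryGroup m ℂ) (T : Matrix m n ℂ)
    (hT : ∀ g, mat τ g * T = T * mat σ g) :
    Representation.IntertwiningMap (rep σ) (rep τ) where
  toLinearMap := Matrix.toLin' T
  isIntertwining' g := by
    refine LinearMap.ext fun v => ?_
    simp [rep_apply, Matrix.mulVec_mulVec, hT]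

/-- Schur's lemma in matrix form: an intertwiner between irreducibles is zero or bijective. -/
lemma equiv_of_intertwines {n m : Type*} [Fintype n] [DecidableEq n] [Fintype m] [DecidableEq m]
    {σ : G →* Matrix.unitaryGroup n ℂ} {τ : G →* Matrix.unitaryGroup m ℂ}
    (hσ : (rep σ).IsIrreducible) (hτ : (rep τ).IsIrreducible) {T : Matrix m n ℂ} (h0 : T ≠ 0)
    (hT : ∀ g, mat τ g * T = T * mat σ g) : Nonempty ((rep σ).Equiv (rep τ)) := by
  have := hσ
  have := hτ
  rcases Representation.IsIrreducible.bijective_or_eq_zero (toIntertwiningMap σ τ T hT) with h | h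
  · exact ⟨Representation.IntertwiningMap.ofBijective _ h⟩
  · refine absurd ?_ h0
    have := congrArg Representation.IntertwiningMap.toLinearMap h
    simpa [toIntertwiningMap] using this

lemma eq_smul_one_of_commutes {n : Type*} [Fintype n] [DecidableEq n]
    {σ : G →* Matrix.unitaryGroup n ℂ} (hσ : (rep σ).IsIrreducible) {T : Matrix n n ℂ}
    (hT : ∀ g, mat σ g * T = T * mat σ g) : ∃ c : ℂ, T = c • 1 := by
  have := hσ
  obtain ⟨c, hc⟩ := (Representation.IsIrreducible.algebraMap_intertwiningMap_bijective_of_isAlgClosed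
    (ρ := rep σ)).2 (toIntertwiningMap σ σ T hT)
  refine ⟨c, ?_⟩
  have h : Matrix.toLin' T = Matrix.toLin' (c • (1 : Matrix n n ℂ)) := by
    have := congrArg Representation.IntertwiningMap.toLinearMap hc
    change _ = Matrix.toLin' T at this
    rw [← this, map_smul, Matrix.toLin'_one]
    rfl
  exact Matrix.toLin'.injective h

lemma nonempty_of_irreducible {n : Type*} [Fintype n] [DecidableEq n]
    {σ : G →* Matrix.unitaryGroup n ℂ} (hσ : (rep σ).IsIrreducible) : Nonempty n := by
  have := hσ
  by_contra hn
  rw [not_nonempty_iff] at hn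
  refine bot_ne_top (α := Subrepresentation (rep σ)) ?_
  apply Subrepresentation.toSubmodule_injective
  exact Subsingleton.elim _ _

/-- The equivalence is not assumed unitary, so a pair of mutually inverse matrices stands in for a
unitary. That is enough to compare traces and the spans of matrix elements. -/
lemma exists_mat_eq_mul_mul {n m : Type*} [Fintype n] [DecidableEq n] [Fintype m] [DecidableEq m]
    {σ : G →* Matrix.unitaryGroup n ℂ} {τ : G →* Matrix.unitaryGroup m ℂ}
    (h : Nonempty ((rep σ).Equiv (rep τ))) :
    ∃ (A : Matrix n m ℂ) (B : Matrix m n ℂ), B * A = 1 ∧ ∀ g, mat σ g = A * mat τ g * B := by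
  obtain ⟨e⟩ := h
  refine ⟨LinearMap.toMatrix' (e.symm.toLinearEquiv : (m → ℂ) →ₗ[ℂ] (n → ℂ)),
    LinearMap.toMatrix' (e.toLinearEquiv : (n → ℂ) →ₗ[ℂ] (m → ℂ)), ?_, fun g => ?_⟩
  · rw [← LinearMap.toMatrix'_comp, ← LinearMap.toMatrix'_id]
    congr 1
    exact LinearMap.ext fun v => e.apply_symm_apply v
  · apply Matrix.toLin'.injective
    rw [Matrix.toLin'_mul, Matrix.toLin'_mul, Matrix.toLin'_toMatrix', Matrix.toLin'_toMatrix']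
    refine LinearMap.ext fun v => ?_
    have h1 : e (rep σ g v) = rep τ g (e v) := e.toIntertwiningMap.isIntertwining _ _ g v
    have h2 := congrArg e.symm h1
    rw [e.symm_apply_apply] at h2
    exact h2

lemma trace_mat_eq_of_equiv {n m : Type*} [Fintype n] [DecidableEq n] [Fintype m] [DecidableEq m]
    {σ : G →* Matrix.unitaryGroup n ℂ} {τ : G →* Matrix.unitaryGroup m ℂ}
    (h : Nonempty ((rep σ).Equiv (rep τ))) (g : G) : (mat σ g).trace = (mat τ g).trace := by
  obtain ⟨A, B, h1, h2⟩ := exists_mat_eq_mul_mul h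
  rw [h2, Matrix.trace_mul_comm, ← Matrix.mul_assoc, h1, Matrix.one_mul]

/-- An irreducible representation together with an isometry onto a subrepresentation of `A`. -/
structure IrredPiece {n : Type*} [Fintype n] [DecidableEq n]
    (A : G →* Matrix.unitaryGroup n ℂ) where
  dim : ℕ
  irr : G →* Matrix.unitaryGroup (Fin dim) ℂ
  emb : Matrix n (Fin dim) ℂ
  irreducible : (rep irr).IsIrreducible
  isometry : emb.conjTranspose * emb = 1
  intertwines : ∀ g, mat A g * emb = emb * mat irr g

/-- Transport of a piece along an isometric intertwiner. -/
def IrredPiece.map {n m : Type*} [Fintype n] [DecidableEq n] [Fintype m] [DecidableEq m]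
    {A : G →* Matrix.unitaryGroup n ℂ} {B : G →* Matrix.unitaryGroup m ℂ} (f : IrredPiece B)
    (J : Matrix n m ℂ) (hJ : J.conjTranspose * J = 1) (hAB : ∀ g, mat A g * J = J * mat B g) :
    IrredPiece A where
  dim := f.dim
  irr := f.irr
  emb := J * f.emb
  irreducible := f.irreducible
  isometry := by
    rw [Matrix.conjTranspose_mul, Matrix.mul_assoc, ← Matrix.mul_assoc _ J, hJ, Matrix.one_mul,
      f.isometry]
  intertwines g := by
    rw [← Matrix.mul_assoc, hAB, Matrix.mul_assoc, f.intertwines, Matrix.mul_assoc]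

lemma IrredPiece.sum_map_emb {n m ι : Type*} [Fintype n] [DecidableEq n] [Fintype m]
    [DecidableEq m] [Fintype ι] {A : G →* Matrix.unitaryGroup n ℂ}
    {B : G →* Matrix.unitaryGroup m ℂ} {f : ι → IrredPiece B}
    (hf : ∑ i, (f i).emb * (f i).emb.conjTranspose = 1)
    (J : Matrix n m ℂ) (hJ : J.conjTranspose * J = 1) (hAB : ∀ g, mat A g * J = J * mat B g) :
    ∑ i, ((f i).map J hJ hAB).emb * ((f i).map J hJ hAB).emb.conjTranspose =
      J * J.conjTranspose := by
  calc _ = J * (∑ i, (f i).emb * (f i).emb.conjTranspose) * J.conjTranspose := by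
        rw [Matrix.mul_sum, Matrix.sum_mul]
        refine Finset.sum_congr rfl fun i _ => ?_
        rw [IrredPiece.map]
        dsimp only
        rw [Matrix.conjTranspose_mul, Matrix.mul_assoc, Matrix.mul_assoc, Matrix.mul_assoc]
    _ = _ := by rw [hf, Matrix.mul_one]

/-- The hypothesis says that the range of `J` is invariant. The projector J J† may then be dropped
between two factors, so the compression J† A(g) J is multiplicative; its adjoint is the compression
at g⁻¹, hence it is unitary. -/
lemma exists_restrict {n m : Type*} [Fintype n] [DecidableEq n] [Fintype m] [DecidableEq m]
    (A : G →* Matrix.unitaryGroup n ℂ) (J : Matrix n m ℂ) (hJ : J.conjTranspose * J = 1)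
    (hA : ∀ g, J * J.conjTranspose * (mat A g * J) = mat A g * J) :
    ∃ σ : G →* Matrix.unitaryGroup m ℂ, ∀ g, mat A g * J = J * mat σ g := by
  have key : ∀ g h, (J.conjTranspose * mat A g * J) * (J.conjTranspose * mat A h * J) =
      J.conjTranspose * mat A (g * h) * J := by
    intro g h
    calc _ = J.conjTranspose * mat A g * (J * J.conjTranspose * (mat A h * J)) := by
          simp only [Matrix.mul_assoc]
      _ = _ := by rw [hA, mat_mul]; simp only [Matrix.mul_assoc]
  have h1 : J.conjTranspose * mat A 1 * J = 1 := by rw [mat_one, Matrix.mul_one, hJ]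
  refine ⟨MonoidHom.mk' (fun g => ⟨J.conjTranspose * mat A g * J, ?_⟩) ?_, fun g => ?_⟩
  · rw [Matrix.mem_unitaryGroup_iff, Matrix.star_eq_conjTranspose]
    have : (J.conjTranspose * mat A g * J).conjTranspose = J.conjTranspose * mat A g⁻¹ * J := by
      simp [mat_inv, Matrix.mul_assoc]
    rw [this, key, mul_inv_cancel, h1]
  · intro g h
    exact Subtype.ext (key g h).symm
  · change _ = J * (J.conjTranspose * mat A g * J)
    rw [← hA g]
    simp only [Matrix.mul_assoc]

/-- The columns of `B` are an orthonormal basis of the subspace for the standard inner product, so B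
B† is the orthogonal projector onto it. -/
lemma exists_isometry_of_submodule {n : Type*} [Fintype n] [DecidableEq n]
    (q : Submodule ℂ (n → ℂ)) :
    ∃ B : Matrix n (Fin (Module.finrank ℂ q)) ℂ, B.conjTranspose * B = 1 ∧
      ∀ v, v ∈ q ↔ (B * B.conjTranspose).mulVec v = v := by
  let e := (WithLp.linearEquiv 2 ℂ (n → ℂ)).symm
  let q' : Submodule ℂ (EuclideanSpace ℂ n) := q.map (e : (n → ℂ) →ₗ[ℂ] EuclideanSpace ℂ n)
  have hfin : Module.finrank ℂ q' = Module.finrank ℂ q := LinearEquiv.finrank_map_eq e q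
  let b : OrthonormalBasis (Fin (Module.finrank ℂ q)) ℂ q' :=
    (stdOrthonormalBasis ℂ q').reindex (finCongr hfin)
  let B : Matrix n (Fin (Module.finrank ℂ q)) ℂ := fun x k => (b k : EuclideanSpace ℂ n) x
  have hB : B.conjTranspose * B = 1 := by
    ext i j
    have := orthonormal_iff_ite.mp b.orthonormal i j
    rw [Submodule.coe_inner, PiLp.inner_apply] at this
    simp only [RCLike.inner_apply] at this
    rw [Matrix.mul_apply, Matrix.one_apply, ← this]
    exact Finset.sum_congr rfl fun x _ => mul_comm _ _
  refine ⟨B, hB, fun v => ⟨fun hv => ?_, fun hv => ?_⟩⟩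
  · have hv' : e v ∈ q' := Submodule.mem_map_of_mem hv
    have h1 := congrArg Subtype.val (b.sum_repr ⟨e v, hv'⟩)
    have h2 : v = B.mulVec (b.repr ⟨e v, hv'⟩) := by
      ext x
      have := congrArg (fun w : EuclideanSpace ℂ n => w x) h1
      simp only [Submodule.coe_sum, Submodule.coe_smul] at this
      rw [Matrix.mulVec, dotProduct]
      refine Eq.trans this.symm ?_
      simp only [WithLp.ofLp_sum, Finset.sum_apply, PiLp.smul_apply, smul_eq_mul]
      exact Finset.sum_congr rfl fun _ _ => mul_comm _ _
    rw [h2, Matrix.mulVec_mulVec, Matrix.mul_assoc, hB, Matrix.mul_one]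
  · have hcol : ∀ k, B.col k ∈ q := by
      intro k
      obtain ⟨w, hw, hw'⟩ := (Submodule.mem_map).mp (b k).2
      have : B.col k = w := by
        ext x
        change (b k : EuclideanSpace ℂ n) x = w x
        rw [← hw']; rfl
      rwa [this]
    rw [← hv, ← Matrix.mulVec_mulVec, Matrix.mulVec_eq_sum]
    refine Submodule.sum_mem _ fun k _ => ?_
    rw [op_smul_eq_smul]
    exact Submodule.smul_mem _ _ (hcol k)

/-- Complete reducibility. -/
lemma exists_irredPieces_fin : ∀ (m : ℕ) (A : G →* Matrix.unitaryGroup (Fin m) ℂ),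
    ∃ (ι : Type) (_ : Fintype ι) (f : ι → IrredPiece A),
      ∑ i, (f i).emb * (f i).emb.conjTranspose = 1 := by
  intro m
  induction m using Nat.strong_induction_on with
  | _ m ih =>
  intro A
  -- The zero representation is not irreducible; in dimension zero the empty family of pieces
  -- already resolves the identity.
  rcases Nat.eq_zero_or_pos m with rfl | hm
  · exact ⟨Empty, inferInstance, fun i => i.elim, Subsingleton.elim _ _⟩
  by_cases hA : (rep A).IsIrreducible
  · refine ⟨Unit, inferInstance, fun _ => ⟨m, A, 1, hA, by simp, fun g => by simp⟩, by simp⟩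
  have hex : ∃ p : Subrepresentation (rep A), p ≠ ⊥ ∧ p ≠ ⊤ := by
    by_contra! hcon
    refine hA { exists_pair_ne := ⟨⊥, ⊤, fun h => ?_⟩
                eq_bot_or_eq_top := fun p => or_iff_not_imp_left.mpr (hcon p) }
    have h1 := congrArg Subrepresentation.toSubmodule h
    have h2 : (⊥ : Submodule ℂ (Fin m → ℂ)) = ⊤ := h1
    have : Nontrivial (Fin m → ℂ) := by
      have : Nonempty (Fin m) := ⟨⟨0, hm⟩⟩
      infer_instance
    exact bot_ne_top h2
  obtain ⟨p, hp0, hp1⟩ := hex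
  obtain ⟨B, hB, hBp⟩ := exists_isometry_of_submodule p.toSubmodule
  set P := B * B.conjTranspose with hP
  have hPP : P * P = P := by
    rw [hP, Matrix.mul_assoc, ← Matrix.mul_assoc _ B, hB, Matrix.one_mul]
  have hPh : P.conjTranspose = P := by simp [hP]
  have hPA : ∀ g, P * (mat A g * P) = mat A g * P := by
    intro g
    refine Matrix.ext_of_mulVec_single fun i => ?_
    have h1 : P.mulVec (Pi.single i 1) ∈ p.toSubmodule := by
      rw [hBp, Matrix.mulVec_mulVec, hPP]
    have h2 := (hBp _).mp (p.apply_mem_toSubmodule g h1)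
    rw [rep_apply] at h2
    simpa only [Matrix.mulVec_mulVec, Matrix.mul_assoc] using h2
  -- Taking adjoints at g⁻¹ turns invariance of the range of P into commutation with P. This is
  -- where unitarity enters: it makes the orthogonal complement invariant as well.
  have hcomm : ∀ g, P * mat A g = mat A g * P := by
    intro g
    have h1 := congrArg Matrix.conjTranspose (hPA g⁻¹)
    simp only [Matrix.conjTranspose_mul, hPh, mat_inv, Matrix.conjTranspose_conjTranspose] at h1
    rw [← h1, Matrix.mul_assoc, hPA]
  -- The orthogonal complement of the invariant subspace, obtained as the kernel of its projector.
  -- Both subspaces have dimension below `m`, so the induction hypothesis applies to each.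
  let r : Submodule ℂ (Fin m → ℂ) := LinearMap.ker (Matrix.toLin' P)
  obtain ⟨C, hC, hCr⟩ := exists_isometry_of_submodule r
  set Q := C * C.conjTranspose with hQ
  have hQQ : Q * Q = Q := by
    rw [hQ, Matrix.mul_assoc, ← Matrix.mul_assoc _ C, hC, Matrix.one_mul]
  have hQh : Q.conjTranspose = Q := by simp [hQ]
  have hPQ : P * Q = 0 := by
    refine Matrix.ext_of_mulVec_single fun i => ?_
    have h1 : Q.mulVec (Pi.single i 1) ∈ r := by
      rw [hCr, Matrix.mulVec_mulVec, hQQ]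
    have h2 : P.mulVec (Q.mulVec (Pi.single i 1)) = 0 := h1
    rw [← Matrix.mulVec_mulVec, h2, Matrix.zero_mulVec]
  have hQP : Q * P = 0 := by
    have := congrArg Matrix.conjTranspose hPQ
    simpa [Matrix.conjTranspose_mul, hPh, hQh] using this
  have hsum : P + Q = 1 := by
    have h1 : Q * (1 - P) = 1 - P := by
      refine Matrix.ext_of_mulVec_single fun i => ?_
      have : (1 - P).mulVec (Pi.single i 1) ∈ r := by
        change P.mulVec _ = 0
        rw [Matrix.mulVec_mulVec, mul_sub, hPP, mul_one, sub_self, Matrix.zero_mulVec]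
      rw [hCr, Matrix.mulVec_mulVec] at this
      exact this
    rw [mul_sub, hQP, mul_one, sub_zero] at h1
    rw [h1]; abel
  have hPB : P * B = B := by rw [hP, Matrix.mul_assoc, hB, Matrix.mul_one]
  have hQC : Q * C = C := by rw [hQ, Matrix.mul_assoc, hC, Matrix.mul_one]
  have hlt1 : Module.finrank ℂ p.toSubmodule < m := by
    have : p.toSubmodule ≠ ⊤ := fun h => hp1 (Subrepresentation.toSubmodule_injective h)
    simpa using Submodule.finrank_lt (lt_top_iff_ne_top.mpr this).ne
  have hlt2 : Module.finrank ℂ r < m := by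
    have : r ≠ ⊤ := by
      intro h
      refine hp0 (Subrepresentation.toSubmodule_injective ?_)
      change p.toSubmodule = ⊥
      rw [Submodule.eq_bot_iff]
      intro v hv
      have h1 : v ∈ r := by rw [h]; trivial
      have h2 : P.mulVec v = 0 := h1
      rw [← (hBp v).mp hv, h2]
    simpa using Submodule.finrank_lt (lt_top_iff_ne_top.mpr this).ne
  obtain ⟨σ, hσ⟩ := exists_restrict A B hB (fun g => by
    rw [← hP, ← Matrix.mul_assoc, hcomm, Matrix.mul_assoc, hPB])
  obtain ⟨τ, hτ⟩ := exists_restrict A C hC (fun g => by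
    have hQ1 : Q = 1 - P := by rw [← hsum]; abel
    have hcomm' : Q * mat A g = mat A g * Q := by
      rw [hQ1, sub_mul, mul_sub, hcomm, one_mul, mul_one]
    rw [← hQ, ← Matrix.mul_assoc, hcomm', Matrix.mul_assoc, hQC])
  obtain ⟨ι₁, _, f₁, hf₁⟩ := ih _ hlt1 σ
  obtain ⟨ι₂, _, f₂, hf₂⟩ := ih _ hlt2 τ
  refine ⟨ι₁ ⊕ ι₂, inferInstance,
    Sum.elim (fun i => (f₁ i).map B hB hσ) (fun i => (f₂ i).map C hC hτ), ?_⟩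
  rw [Fintype.sum_sum_type, ← hsum]
  exact congrArg₂ (· + ·) (IrredPiece.sum_map_emb hf₁ B hB hσ) (IrredPiece.sum_map_emb hf₂ C hC hτ)

lemma exists_irredPieces {n : Type*} [Fintype n] [DecidableEq n]
    (A : G →* Matrix.unitaryGroup n ℂ) :
    ∃ (ι : Type) (_ : Fintype ι) (f : ι → IrredPiece A),
      ∑ i, (f i).emb * (f i).emb.conjTranspose = 1 := by
  let e := Fintype.equivFin n
  let B : Matrix n (Fin (Fintype.card n)) ℂ := (1 : Matrix n n ℂ).submatrix id e.symm
  have h1 : B.conjTranspose * B = 1 := by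
    ext i j; simp [B, Matrix.mul_apply, Matrix.one_apply]
  have h2 : B * B.conjTranspose = 1 := (Matrix.mul_eq_one_comm_of_equiv e).mpr h1
  obtain ⟨σ, hσ⟩ := exists_restrict A B h1 (fun g => by rw [h2, Matrix.one_mul])
  obtain ⟨ι, _, f, hf⟩ := exists_irredPieces_fin _ σ
  exact ⟨ι, inferInstance, fun i => (f i).map B h1 hσ, (IrredPiece.sum_map_emb hf B h1 hσ).trans h2⟩

lemma mat_eq_sum_pieces {n ι : Type*} [Fintype n] [DecidableEq n] [Fintype ι]
    {A : G →* Matrix.unitaryGroup n ℂ} {f : ι → IrredPiece A}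
    (hf : ∑ i, (f i).emb * (f i).emb.conjTranspose = 1) (g : G) :
    mat A g = ∑ i, (f i).emb * mat (f i).irr g * (f i).emb.conjTranspose := by
  calc mat A g = mat A g * ∑ i, (f i).emb * (f i).emb.conjTranspose := by rw [hf, Matrix.mul_one]
    _ = _ := by
      rw [Matrix.mul_sum]
      refine Finset.sum_congr rfl fun i _ => ?_
      rw [← Matrix.mul_assoc, (f i).intertwines]

lemma IrredPiece.mat_irr {n : Type*} [Fintype n] [DecidableEq n]
    {A : G →* Matrix.unitaryGroup n ℂ} (f : IrredPiece A) (g : G) :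
    mat f.irr g = f.emb.conjTranspose * mat A g * f.emb := by
  rw [Matrix.mul_assoc, f.intertwines, ← Matrix.mul_assoc, f.isometry, Matrix.one_mul]

/-- The tensor power of a representation. -/
def tpowRep {d : ℕ} (U : G →* Matrix.unitaryGroup (Fin d) ℂ) (N : ℕ) :
    G →* Matrix.unitaryGroup (Pow d N) ℂ :=
  MonoidHom.mk' (fun g => ⟨tpow d N (mat U g), by
    rw [Matrix.mem_unitaryGroup_iff]
    have : star (tpow d N (mat U g)) = tpow d N (mat U g).conjTranspose := by
      ext x y; simp [tpow, Matrix.star_apply]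
    rw [this, ← map_mul, mat_mul_conjTranspose, map_one]⟩) fun g h => by
      refine Subtype.ext ?_
      change tpow d N (mat U (g * h)) = tpow d N (mat U g) * tpow d N (mat U h)
      rw [mat_mul, map_mul]

@[simp] lemma mat_tpowRep {d : ℕ} (U : G →* Matrix.unitaryGroup (Fin d) ℂ) (N : ℕ) (g : G) :
    mat (tpowRep U N) g = tpow d N (mat U g) := rfl

/-- Decompose U^{⊗N} into irreducible pieces and keep one piece from each equivalence class.
Completeness is Schur's lemma again: a nonzero intertwiner into U^{⊗N} has nonzero overlap with some
piece, since the projectors on the pieces add up to the identity. -/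
theorem nonempty_irr {d : ℕ} (U : G →* Matrix.unitaryGroup (Fin d) ℂ) (N : ℕ) :
    Nonempty (Irr U N) := by
  obtain ⟨ι, _, f, hf⟩ := exists_irredPieces (tpowRep U N)
  let s : Setoid ι :=
    { r := fun a b => Nonempty ((rep (f a).irr).Equiv (rep (f b).irr))
      iseqv := ⟨fun a => ⟨.refl _⟩, fun ⟨e⟩ => ⟨e.symm⟩, fun ⟨e⟩ ⟨e'⟩ => ⟨e.trans e'⟩⟩ }
  classical
  let e := Fintype.equivFin (Quotient s)
  let c : Fin (Fintype.card (Quotient s)) → ι := fun j => (e.symm j).out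
  refine ⟨⟨Fintype.card (Quotient s), fun j => (f (c j)).dim, fun j => (f (c j)).irr,
    fun j => (f (c j)).emb, fun j => (f (c j)).irreducible, fun j k h => ?_,
    fun j => (f (c j)).isometry, fun j g => (f (c j)).intertwines g, ?_⟩⟩
  · have : (e.symm j) = (e.symm k) := by
      rw [← Quotient.out_equiv_out]; exact h
    exact e.symm.injective this
  · intro n τ hτ W hW hWτ
    have : ∃ i, (f i).emb.conjTranspose * W ≠ 0 := by
      by_contra! hcon
      apply hW
      calc W = (∑ i, (f i).emb * (f i).emb.conjTranspose) * W := by rw [hf, Matrix.one_mul]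
        _ = 0 := by
          rw [Matrix.sum_mul]
          refine Finset.sum_eq_zero fun i _ => ?_
          rw [Matrix.mul_assoc, hcon, Matrix.mul_zero]
    obtain ⟨i, hi⟩ := this
    have hint : ∀ g, mat (f i).irr g * ((f i).emb.conjTranspose * W) =
        (f i).emb.conjTranspose * W * mat τ g := by
      intro g
      -- The adjoint of an intertwiner of unitary representations intertwines in the opposite
      -- direction.
      have h1 := congrArg Matrix.conjTranspose ((f i).intertwines g⁻¹)
      simp only [Matrix.conjTranspose_mul, mat_inv, Matrix.conjTranspose_conjTranspose] at h1
      rw [← Matrix.mul_assoc, ← h1, Matrix.mul_assoc, mat_tpowRep, hWτ, Matrix.mul_assoc]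
    obtain ⟨e1⟩ := equiv_of_intertwines hτ (f i).irreducible hi hint
    refine ⟨e ⟦i⟧, ?_⟩
    have h3 : s.r i (c (e ⟦i⟧)) := by
      have : Quotient.mk s (c (e ⟦i⟧)) = ⟦i⟧ := by simp [c]
      exact Setoid.symm (Quotient.exact this)
    obtain ⟨e2⟩ := h3
    exact ⟨e1.trans e2⟩

end RepresentationTheory

/-! ### Schur orthogonality -/

section Orthogonality

variable {G : Type*} [Group G] [TopologicalSpace G] [IsTopologicalGroup G]
    [CompactSpace G] [MeasurableSpace G] [BorelSpace G]

/-- The matrix elements of a representation are continuous. -/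
def ContMat {G : Type*} [Group G] [TopologicalSpace G] {n : Type*} [Fintype n] [DecidableEq n]
    (σ : G →* Matrix.unitaryGroup n ℂ) : Prop :=
  ∀ i j, Continuous fun g => mat σ g i j

lemma contMat_of_continuous {G : Type*} [Group G] [TopologicalSpace G] {n : Type*} [Fintype n]
    [DecidableEq n] {σ : G →* Matrix.unitaryGroup n ℂ} (hσ : Continuous σ) : ContMat σ :=
  fun i j => (continuous_subtype_val.comp hσ).matrix_elem i j

lemma ContMat.continuous_mat {G : Type*} [Group G] [TopologicalSpace G] {n : Type*} [Fintype n]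
    [DecidableEq n] {σ : G →* Matrix.unitaryGroup n ℂ} (hσ : ContMat σ) :
    Continuous fun g => mat σ g :=
  continuous_matrix hσ

lemma ContMat.tpowRep {G : Type*} [Group G] [TopologicalSpace G] {d : ℕ}
    {U : G →* Matrix.unitaryGroup (Fin d) ℂ} (hU : ContMat U) (N : ℕ) :
    ContMat (QLearn.tpowRep U N) := by
  intro x y
  have : (fun g => mat (QLearn.tpowRep U N) g x y) = fun g => ∏ k, mat U g (x k) (y k) := rfl
  rw [this]
  exact continuous_finsetProd _ fun k _ => hU _ _

lemma IrredPiece.contMat {G : Type*} [Group G] [TopologicalSpace G] {n : Type*} [Fintype n]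
    [DecidableEq n] {A : G →* Matrix.unitaryGroup n ℂ} (hA : ContMat A) (f : IrredPiece A) :
    ContMat f.irr := by
  intro i j
  have : (fun g => mat f.irr g i j) =
      fun g => (f.emb.conjTranspose * mat A g * f.emb) i j := by
    funext g; rw [f.mat_irr]
  rw [this]
  have h := hA.continuous_mat
  exact Continuous.matrix_elem (by fun_prop) i j

lemma ContMat.mul_star {G : Type*} [Group G] [TopologicalSpace G] {n m : Type*} [Fintype n]
    [DecidableEq n] [Fintype m] [DecidableEq m] {σ : G →* Matrix.unitaryGroup n ℂ}
    {τ : G →* Matrix.unitaryGroup m ℂ} (hσ : ContMat σ) (hτ : ContMat τ) (r s : n) (r' s' : m) :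
    Continuous fun g => mat σ g r s * star (mat τ g r' s') :=
  (hσ r s).mul (hτ r' s').star

lemma integrable_of_continuous {G E : Type*} [TopologicalSpace G] [CompactSpace G]
    [MeasurableSpace G] [BorelSpace G] [NormedAddCommGroup E] [SecondCountableTopology E]
    (ν : Measure G) [IsFiniteMeasureOnCompacts ν] {f : G → E} (hf : Continuous f) :
    Integrable f ν :=
  hf.integrable_of_hasCompactSupport (HasCompactSupport.of_compactSpace f)

lemma integral_sum_of_continuous {G E ι : Type*} [TopologicalSpace G] [CompactSpace G]
    [MeasurableSpace G] [BorelSpace G] [NormedAddCommGroup E] [NormedSpace ℝ E]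
    [SecondCountableTopology E] [Fintype ι] (ν : Measure G) [IsFiniteMeasureOnCompacts ν]
    {f : ι → G → E} (hf : ∀ i, Continuous (f i)) :
    ∫ g, ∑ i, f i g ∂ν = ∑ i, ∫ g, f i g ∂ν :=
  integral_finsetSum _ fun i _ => integrable_of_continuous ν (hf i)

section

variable (ν : Measure G) [ν.IsHaarMeasure]

/-- For fixed columns s, s', the integral is the average of the operators σ(g) |s⟩⟨s'| τ(g)†. Left
invariance of the measure makes this average an intertwiner, ready for Schur's lemma. -/
lemma mat_mul_integral_mul {n m : Type*} [Fintype n] [DecidableEq n] [Fintype m] [DecidableEq m]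
    {σ : G →* Matrix.unitaryGroup n ℂ} {τ : G →* Matrix.unitaryGroup m ℂ} (hσ : ContMat σ)
    (hτ : ContMat τ) (s : n) (s' : m) (h : G) :
    mat σ h * (Matrix.of fun r r' => ∫ g, mat σ g r s * star (mat τ g r' s') ∂ν) =
      (Matrix.of fun r r' => ∫ g, mat σ g r s * star (mat τ g r' s') ∂ν) * mat τ h := by
  set T : Matrix n m ℂ := Matrix.of fun r r' => ∫ g, mat σ g r s * star (mat τ g r' s') ∂ν with hT
  have hint : ∀ r r', Integrable (fun g => mat σ g r s * star (mat τ g r' s')) ν := fun r r' =>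
    integrable_of_continuous ν (hσ.mul_star hτ r s r' s')
  have key : mat σ h * T * (mat τ h).conjTranspose = T := by
    ext a b
    have h1 : T a b = ∫ g, mat σ (h * g) a s * star (mat τ (h * g) b s') ∂ν :=
      (integral_mul_left_eq_self (fun g => mat σ g a s * star (mat τ g b s')) h).symm
    rw [h1]
    have h2 : ∀ g, mat σ (h * g) a s * star (mat τ (h * g) b s') =
        ∑ r', ∑ r, mat σ h a r * star (mat τ h b r') * (mat σ g r s * star (mat τ g r' s')) := by
      intro g
      rw [mat_mul, mat_mul, Matrix.mul_apply, Matrix.mul_apply, star_sum, Finset.sum_mul_sum,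
        Finset.sum_comm]
      refine Finset.sum_congr rfl fun r _ => Finset.sum_congr rfl fun r' _ => ?_
      rw [star_mul']; ring
    simp_rw [h2]
    rw [integral_finsetSum _ fun r' _ => integrable_finsetSum _ fun r _ => (hint r r').const_mul _]
    rw [Matrix.mul_apply]
    refine Finset.sum_congr rfl fun r' _ => ?_
    rw [integral_finsetSum _ fun r _ => (hint r r').const_mul _, Matrix.mul_apply, Finset.sum_mul]
    refine Finset.sum_congr rfl fun r _ => ?_
    rw [integral_const_mul, Matrix.conjTranspose_apply, hT, Matrix.of_apply]
    ring
  conv_rhs => rw [← key, Matrix.mul_assoc, conjTranspose_mat_mul, Matrix.mul_one]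

lemma integral_mat_mul_star_of_not_equiv {n m : Type*} [Fintype n] [DecidableEq n] [Fintype m]
    [DecidableEq m] {σ : G →* Matrix.unitaryGroup n ℂ} {τ : G →* Matrix.unitaryGroup m ℂ}
    (hσ : ContMat σ) (hτ : ContMat τ) (hσi : (rep σ).IsIrreducible) (hτi : (rep τ).IsIrreducible)
    (hne : ¬ Nonempty ((rep σ).Equiv (rep τ))) (r s : n) (r' s' : m) :
    ∫ g, mat σ g r s * star (mat τ g r' s') ∂ν = 0 := by
  by_contra h0
  refine hne ?_
  obtain ⟨e⟩ := equiv_of_intertwines hτi hσi (T := Matrix.of fun r r' =>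
    ∫ g, mat σ g r s * star (mat τ g r' s') ∂ν) (fun h => h0 (congrFun (congrFun h r) r'))
    (mat_mul_integral_mul ν hσ hτ s s')
  exact ⟨e.symm⟩

lemma integral_mat_mul_star_self [IsProbabilityMeasure ν] {n : Type*} [Fintype n] [DecidableEq n]
    {σ : G →* Matrix.unitaryGroup n ℂ} (hσ : ContMat σ) (hσi : (rep σ).IsIrreducible)
    (r s r' s' : n) :
    ∫ g, mat σ g r s * star (mat σ g r' s') ∂ν =
      if r = r' ∧ s = s' then (Fintype.card n : ℂ)⁻¹ else 0 := by
  obtain ⟨c, hc⟩ := eq_smul_one_of_commutes hσi (mat_mul_integral_mul ν hσ hσ s s')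
  have hne : (Fintype.card n : ℂ) ≠ 0 := by
    have := nonempty_of_irreducible hσi
    exact_mod_cast Fintype.card_ne_zero
  have htr := congrArg Matrix.trace hc
  rw [Matrix.trace_smul, Matrix.trace_one, Matrix.trace] at htr
  simp only [Matrix.diag_apply, Matrix.of_apply] at htr
  rw [← integral_sum_of_continuous ν fun r => hσ.mul_star hσ r s r s'] at htr
  -- The scalar in Schur's lemma is read off from the trace, which is constant in g because the
  -- columns of a unitary are orthonormal.
  have h1 : ∀ g, ∑ x, mat σ g x s * star (mat σ g x s') = (1 : Matrix n n ℂ) s' s := by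
    intro g
    rw [← conjTranspose_mat_mul σ g, Matrix.mul_apply]
    exact Finset.sum_congr rfl fun _ _ => by rw [Matrix.conjTranspose_apply, mul_comm]
  simp only [h1, integral_const, probReal_univ, one_smul, smul_eq_mul] at htr
  have hc' : c = (1 : Matrix n n ℂ) s' s * (Fintype.card n : ℂ)⁻¹ := by
    rw [htr]; field_simp
  have h2 := congrFun (congrFun hc r) r'
  simp only [Matrix.of_apply, Matrix.smul_apply, Matrix.one_apply, smul_eq_mul] at h2
  rw [h2, hc', Matrix.one_apply]
  by_cases h3 : r = r' <;> by_cases h4 : s = s' <;> simp [h3, h4, eq_comm]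

/-! ### Orthogonality of characters -/

lemma ContMat.trace {G : Type*} [Group G] [TopologicalSpace G] {n : Type*} [Fintype n]
    [DecidableEq n] {σ : G →* Matrix.unitaryGroup n ℂ} (hσ : ContMat σ) :
    Continuous fun g => (mat σ g).trace :=
  hσ.continuous_mat.matrix_trace

lemma integral_trace_mul_star_of_not_equiv {n m : Type*} [Fintype n] [DecidableEq n] [Fintype m]
    [DecidableEq m] {σ : G →* Matrix.unitaryGroup n ℂ} {τ : G →* Matrix.unitaryGroup m ℂ}
    (hσ : ContMat σ) (hτ : ContMat τ) (hσi : (rep σ).IsIrreducible) (hτi : (rep τ).IsIrreducible)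
    (hne : ¬ Nonempty ((rep σ).Equiv (rep τ))) :
    ∫ g, (mat σ g).trace * star (mat τ g).trace ∂ν = 0 := by
  simp only [Matrix.trace, Matrix.diag_apply, star_sum, Finset.sum_mul_sum]
  rw [integral_sum_of_continuous ν fun i => continuous_finsetSum _ fun j _ =>
    hσ.mul_star hτ i i j j]
  refine Finset.sum_eq_zero fun i _ => ?_
  rw [integral_sum_of_continuous ν fun j => hσ.mul_star hτ i i j j]
  exact Finset.sum_eq_zero fun j _ =>
    integral_mat_mul_star_of_not_equiv ν hσ hτ hσi hτi hne i i j j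

lemma integral_trace_mul_star_self [IsProbabilityMeasure ν] {n : Type*} [Fintype n] [DecidableEq n]
    {σ : G →* Matrix.unitaryGroup n ℂ} (hσ : ContMat σ) (hσi : (rep σ).IsIrreducible) :
    ∫ g, (mat σ g).trace * star (mat σ g).trace ∂ν = 1 := by
  simp only [Matrix.trace, Matrix.diag_apply, star_sum, Finset.sum_mul_sum]
  rw [integral_sum_of_continuous ν fun i => continuous_finsetSum _ fun j _ =>
    hσ.mul_star hσ i i j j]
  have h1 : ∀ i, ∫ g, ∑ j, mat σ g i i * star (mat σ g j j) ∂ν = (Fintype.card n : ℂ)⁻¹ := by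
    intro i
    rw [integral_sum_of_continuous ν fun j => hσ.mul_star hσ i i j j]
    simp only [integral_mat_mul_star_self ν hσ hσi, and_self, Finset.sum_ite_eq, Finset.mem_univ,
      if_true]
  simp only [h1, Finset.sum_const, Finset.card_univ, nsmul_eq_mul]
  have := nonempty_of_irreducible hσi
  exact mul_inv_cancel₀ (by exact_mod_cast Fintype.card_ne_zero)

end

/-! ### Positive forms integrated over the group -/

lemma continuous_form {X κ : Type*} [TopologicalSpace X] [Fintype κ] (L : Matrix κ κ ℂ)
    {a b : X → κ → ℂ} (ha : Continuous a) (hb : Continuous b) :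
    Continuous fun g => star (a g) ⬝ᵥ L.mulVec (b g) := by
  fun_prop

section

variable {X κ : Type*} [TopologicalSpace X] [CompactSpace X] [MeasurableSpace X] [BorelSpace X]
  [Fintype κ] (ν : Measure X) [IsFiniteMeasureOnCompacts ν]

lemma form_re_comm {κ : Type*} [Fintype κ] {L : Matrix κ κ ℂ} (hL : L.PosSemidef) (a b : κ → ℂ) :
    (star b ⬝ᵥ L.mulVec a).re = (star a ⬝ᵥ L.mulVec b).re := by
  have : star (star b ⬝ᵥ L.mulVec a) = star a ⬝ᵥ L.mulVec b := by
    rw [Matrix.star_dotProduct, Matrix.star_mulVec, ← Matrix.dotProduct_mulVec, hL.1.eq, star_star]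
  rw [← this]
  simp

/-- The Cauchy–Schwarz inequality for an integrated positive form. -/
lemma sq_integral_form_le {L : Matrix κ κ ℂ} (hL : L.PosSemidef) {a b : X → κ → ℂ}
    (ha : Continuous a) (hb : Continuous b) :
    (∫ g, (star (a g) ⬝ᵥ L.mulVec (b g)).re ∂ν) ^ 2 ≤
      (∫ g, (star (a g) ⬝ᵥ L.mulVec (a g)).re ∂ν) * ∫ g, (star (b g) ⬝ᵥ L.mulVec (b g)).re ∂ν := by
  have hc : ∀ {a b : X → κ → ℂ}, Continuous a → Continuous b →
      Integrable (fun g => (star (a g) ⬝ᵥ L.mulVec (b g)).re) ν := fun ha hb =>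
    integrable_of_continuous ν (Complex.continuous_re.comp (continuous_form L ha hb))
  set A := ∫ g, (star (a g) ⬝ᵥ L.mulVec (a g)).re ∂ν
  set B := ∫ g, (star (a g) ⬝ᵥ L.mulVec (b g)).re ∂ν
  set C := ∫ g, (star (b g) ⬝ᵥ L.mulVec (b g)).re ∂ν
  -- The integrated form at a + x b is a nonnegative real quadratic polynomial in x; nonpositivity
  -- of its discriminant is the inequality. With x real, only the real part of the cross term
  -- appears.
  have key : ∀ x : ℝ, 0 ≤ C * (x * x) + (2 * B) * x + A := by
    intro x
    have h1 : C * (x * x) + (2 * B) * x + A =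
        ∫ g, (star (a g + (x : ℂ) • b g) ⬝ᵥ L.mulVec (a g + (x : ℂ) • b g)).re ∂ν := by
      have h2 : ∀ g, (star (a g + (x : ℂ) • b g) ⬝ᵥ L.mulVec (a g + (x : ℂ) • b g)).re =
          (x * x) * (star (b g) ⬝ᵥ L.mulVec (b g)).re +
            (2 * x) * (star (a g) ⬝ᵥ L.mulVec (b g)).re + (star (a g) ⬝ᵥ L.mulVec (a g)).re := by
        intro g
        have h3 := form_re_comm hL (a g) (b g)
        simp only [star_add, star_smul, Matrix.mulVec_add, Matrix.mulVec_smul, dotProduct_add,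
          add_dotProduct, smul_dotProduct, dotProduct_smul, smul_eq_mul, Complex.add_re,
          RCLike.star_def, Complex.conj_ofReal, Complex.re_ofReal_mul, h3]
        ring
      simp_rw [h2]
      have h4 : Integrable (fun g => (x * x) * (star (b g) ⬝ᵥ L.mulVec (b g)).re +
          (2 * x) * (star (a g) ⬝ᵥ L.mulVec (b g)).re) ν :=
        ((hc hb hb).const_mul _).add ((hc ha hb).const_mul _)
      rw [integral_add h4 (hc ha ha), integral_add ((hc hb hb).const_mul _) ((hc ha hb).const_mul _), integral_const_mul,
        integral_const_mul]
      ring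
    rw [h1]
    exact integral_nonneg fun g => (Complex.nonneg_iff.mp (hL.dotProduct_mulVec_nonneg _)).1
  have := discrim_le_zero key
  rw [discrim] at this
  nlinarith

lemma integral_form_le {L : Matrix κ κ ℂ} (hL : L.PosSemidef) {a b : X → κ → ℂ}
    (ha : Continuous a) (hb : Continuous b) {p q : ℝ} (hp : 0 ≤ p) (hq : 0 ≤ q)
    (hpa : ∫ g, (star (a g) ⬝ᵥ L.mulVec (a g)).re ∂ν ≤ p ^ 2)
    (hqb : ∫ g, (star (b g) ⬝ᵥ L.mulVec (b g)).re ∂ν ≤ q ^ 2) :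
    ∫ g, (star (a g) ⬝ᵥ L.mulVec (b g)).re ∂ν ≤ p * q := by
  refine le_of_sq_le_sq ?_ (mul_nonneg hp hq)
  rw [mul_pow]
  refine (sq_integral_form_le ν hL ha hb).trans (mul_le_mul hpa hqb ?_ (sq_nonneg _))
  exact integral_nonneg fun g => (Complex.nonneg_iff.mp (hL.dotProduct_mulVec_nonneg _)).1

end

/-- A vector valued function all of whose components are combinations of the matrix elements of
`σ`. -/
def coeffVec {G κ n : Type*} [Group G] [Fintype n] [DecidableEq n]
    (σ : G →* Matrix.unitaryGroup n ℂ) (c : κ → n → n → ℂ) (g : G) : κ → ℂ :=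
  fun k => ∑ r, ∑ s, c k r s * mat σ g r s

lemma coeffVec_eq_sum {G κ n : Type*} [Group G] [Fintype n] [DecidableEq n]
    (σ : G →* Matrix.unitaryGroup n ℂ) (c : κ → n → n → ℂ) (g : G) :
    coeffVec σ c g = ∑ r, ∑ s, mat σ g r s • fun k => c k r s := by
  ext k
  simp only [coeffVec, Finset.sum_apply, Pi.smul_apply, smul_eq_mul]
  exact Finset.sum_congr rfl fun _ _ => Finset.sum_congr rfl fun _ _ => mul_comm _ _

lemma ContMat.coeffVec {G κ n : Type*} [Group G] [TopologicalSpace G] [Fintype n] [DecidableEq n]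
    {σ : G →* Matrix.unitaryGroup n ℂ} (hσ : ContMat σ) (c : κ → n → n → ℂ) :
    Continuous (coeffVec σ c) :=
  continuous_pi fun _ => continuous_finsetSum _ fun _ _ => continuous_finsetSum _ fun _ _ =>
    continuous_const.mul (hσ _ _)

section

variable (ν : Measure G) [ν.IsHaarMeasure]

/-- Integrating a form on coefficient functions of two representations. -/
lemma integral_coeffVec_form {κ n m : Type*} [Fintype κ] [Fintype n] [DecidableEq n] [Fintype m]
    [DecidableEq m] {σ : G →* Matrix.unitaryGroup n ℂ} {τ : G →* Matrix.unitaryGroup m ℂ}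
    (hσ : ContMat σ) (hτ : ContMat τ) (L : Matrix κ κ ℂ) (c : κ → n → n → ℂ) (e : κ → m → m → ℂ) :
    ∫ g, star (coeffVec σ c g) ⬝ᵥ L.mulVec (coeffVec τ e g) ∂ν =
      ∑ r', ∑ s', ∑ r, ∑ s, (star (fun k => c k r s) ⬝ᵥ L.mulVec fun k => e k r' s') *
        ∫ g, mat τ g r' s' * star (mat σ g r s) ∂ν := by
  have h1 : ∀ g, star (coeffVec σ c g) ⬝ᵥ L.mulVec (coeffVec τ e g) =
      ∑ r', ∑ s', ∑ r, ∑ s, (star (fun k => c k r s) ⬝ᵥ L.mulVec fun k => e k r' s') *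
        (mat τ g r' s' * star (mat σ g r s)) := by
    intro g
    rw [coeffVec_eq_sum, coeffVec_eq_sum]
    simp only [Matrix.mulVec_sum, dotProduct_sum, star_sum, sum_dotProduct, Matrix.mulVec_smul,
      star_smul, smul_dotProduct, dotProduct_smul, smul_eq_mul]
    refine Finset.sum_congr rfl fun _ _ => Finset.sum_congr rfl fun _ _ => ?_
    simp only [Finset.mul_sum]
    refine Finset.sum_congr rfl fun _ _ => Finset.sum_congr rfl fun _ _ => ?_
    ring
  simp_rw [h1]
  have hc : ∀ r' s' r s, Continuous fun g =>
      (star (fun k => c k r s) ⬝ᵥ L.mulVec fun k => e k r' s') *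
        (mat τ g r' s' * star (mat σ g r s)) := fun r' s' r s =>
    continuous_const.mul (hτ.mul_star hσ r' s' r s)
  rw [integral_sum_of_continuous ν fun r' => by fun_prop]
  refine Finset.sum_congr rfl fun r' _ => ?_
  rw [integral_sum_of_continuous ν fun s' => by fun_prop]
  refine Finset.sum_congr rfl fun s' _ => ?_
  rw [integral_sum_of_continuous ν fun r => by fun_prop]
  refine Finset.sum_congr rfl fun r _ => ?_
  rw [integral_sum_of_continuous ν fun s => hc r' s' r s]
  exact Finset.sum_congr rfl fun s _ => integral_const_mul _ _

lemma integral_coeffVec_form_self [IsProbabilityMeasure ν] {κ n : Type*} [Fintype κ] [Fintype n] [DecidableEq n]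
    {σ : G →* Matrix.unitaryGroup n ℂ} (hσ : ContMat σ) (hσi : (rep σ).IsIrreducible)
    (L : Matrix κ κ ℂ) (c e : κ → n → n → ℂ) :
    ∫ g, star (coeffVec σ c g) ⬝ᵥ L.mulVec (coeffVec σ e g) ∂ν =
      (Fintype.card n : ℂ)⁻¹ * ∑ r, ∑ s, (star (fun k => c k r s) ⬝ᵥ L.mulVec fun k => e k r s) := by
  rw [integral_coeffVec_form ν hσ hσ]
  simp only [integral_mat_mul_star_self ν hσ hσi, ite_and, mul_ite, mul_zero, Finset.sum_ite_eq,
    Finset.mem_univ, if_true, Finset.mul_sum, Finset.sum_ite_irrel, Finset.sum_const_zero]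
  exact Finset.sum_congr rfl fun _ _ => Finset.sum_congr rfl fun _ _ => mul_comm _ _

lemma integral_coeffVec_form_of_not_equiv {κ n m : Type*} [Fintype κ] [Fintype n] [DecidableEq n]
    [Fintype m] [DecidableEq m] {σ : G →* Matrix.unitaryGroup n ℂ}
    {τ : G →* Matrix.unitaryGroup m ℂ} (hσ : ContMat σ) (hτ : ContMat τ)
    (hσi : (rep σ).IsIrreducible) (hτi : (rep τ).IsIrreducible)
    (hne : ¬ Nonempty ((rep σ).Equiv (rep τ)))
    (L : Matrix κ κ ℂ) (c : κ → n → n → ℂ) (e : κ → m → m → ℂ) :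
    ∫ g, star (coeffVec σ c g) ⬝ᵥ L.mulVec (coeffVec τ e g) ∂ν = 0 := by
  have hne' : ¬ Nonempty ((rep τ).Equiv (rep σ)) := fun ⟨e⟩ => hne ⟨e.symm⟩
  rw [integral_coeffVec_form ν hσ hτ]
  simp only [integral_mat_mul_star_of_not_equiv ν hτ hσ hτi hσi hne', mul_zero,
    Finset.sum_const_zero]

/-- Both sides are double sums over pairs of components, compared pair by pair. Inequivalent
components contribute zero to both. For equivalent ones the character integral is 1, and
Cauchy–Schwarz bounds the form by q_i q_j. Equivalent representations need not be written in the
same basis, since only their characters are compared. -/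
lemma integral_sum_form_le [IsProbabilityMeasure ν] {κ I : Type*} [Fintype κ] [Fintype I] {n : I → Type*}
    [∀ i, Fintype (n i)] [∀ i, DecidableEq (n i)]
    {σ : ∀ i, G →* Matrix.unitaryGroup (n i) ℂ} (hσ : ∀ i, ContMat (σ i))
    (hσi : ∀ i, (rep (σ i)).IsIrreducible) {L : Matrix κ κ ℂ} (hL : L.PosSemidef)
    (c : ∀ i, κ → n i → n i → ℂ) (q : I → ℝ) (hq : ∀ i, 0 ≤ q i)
    (hdiag : ∀ i, ∫ g, (star (coeffVec (σ i) (c i) g) ⬝ᵥ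
      L.mulVec (coeffVec (σ i) (c i) g)).re ∂ν ≤ q i ^ 2) :
    ∫ g, (star (∑ i, coeffVec (σ i) (c i) g) ⬝ᵥ
        L.mulVec (∑ i, coeffVec (σ i) (c i) g)).re ∂ν ≤
      ∫ g, ‖∑ i, (q i : ℂ) * (mat (σ i) g).trace‖ ^ 2 ∂ν := by
  have hcc : ∀ i j, Continuous fun g =>
      (star (coeffVec (σ i) (c i) g) ⬝ᵥ L.mulVec (coeffVec (σ j) (c j) g)).re := fun i j =>
    Complex.continuous_re.comp (continuous_form L ((hσ i).coeffVec _) ((hσ j).coeffVec _))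
  have hct : ∀ i j, Continuous fun g =>
      (q i * q j) * ((mat (σ i) g).trace * star (mat (σ j) g).trace).re := fun i j =>
    continuous_const.mul (Complex.continuous_re.comp ((hσ i).trace.mul (hσ j).trace.star))
  have h1 : ∀ g, (star (∑ i, coeffVec (σ i) (c i) g) ⬝ᵥ
        L.mulVec (∑ i, coeffVec (σ i) (c i) g)).re =
      ∑ i, ∑ j, (star (coeffVec (σ i) (c i) g) ⬝ᵥ L.mulVec (coeffVec (σ j) (c j) g)).re := by
    intro g
    simp only [star_sum, sum_dotProduct, Matrix.mulVec_sum, dotProduct_sum, Complex.re_sum]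
    exact Finset.sum_comm
  have h2 : ∀ g, ‖∑ i, (q i : ℂ) * (mat (σ i) g).trace‖ ^ 2 =
      ∑ i, ∑ j, (q i * q j) * ((mat (σ i) g).trace * star (mat (σ j) g).trace).re := by
    intro g
    rw [← Complex.normSq_eq_norm_sq, ← Complex.ofReal_re (Complex.normSq _), ← Complex.mul_conj,
      map_sum, Finset.sum_mul_sum, Complex.re_sum]
    refine Finset.sum_congr rfl fun i _ => ?_
    rw [Complex.re_sum]
    refine Finset.sum_congr rfl fun j _ => ?_
    rw [map_mul, Complex.conj_ofReal, mul_mul_mul_comm, ← Complex.ofReal_mul,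
      Complex.re_ofReal_mul]
    rfl
  simp_rw [h1, h2]
  rw [integral_sum_of_continuous ν fun i => continuous_finsetSum _ fun j _ => hcc i j,
    integral_sum_of_continuous ν fun i => continuous_finsetSum _ fun j _ => hct i j]
  refine Finset.sum_le_sum fun i _ => ?_
  rw [integral_sum_of_continuous ν fun j => hcc i j,
    integral_sum_of_continuous ν fun j => hct i j]
  refine Finset.sum_le_sum fun j _ => ?_
  have hre : ∀ f : G → ℂ, Continuous f → ∫ g, (f g).re ∂ν = (∫ g, f g ∂ν).re := fun f hf =>
    integral_re (integrable_of_continuous ν hf)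
  have hch : ∫ g, ((mat (σ i) g).trace * star (mat (σ j) g).trace).re ∂ν =
      (∫ g, (mat (σ i) g).trace * star (mat (σ j) g).trace ∂ν).re :=
    hre _ ((hσ i).trace.mul (hσ j).trace.star)
  rw [integral_const_mul, hch]
  by_cases he : Nonempty ((rep (σ i)).Equiv (rep (σ j)))
  · have h3 : ∫ g, (mat (σ i) g).trace * star (mat (σ j) g).trace ∂ν = 1 := by
      simp_rw [← trace_mat_eq_of_equiv he]
      exact integral_trace_mul_star_self ν (hσ i) (hσi i)
    rw [h3, Complex.one_re, mul_one]
    exact integral_form_le ν hL ((hσ i).coeffVec _) ((hσ j).coeffVec _) (hq i) (hq j) (hdiag i)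
      (hdiag j)
  · rw [hre _ (continuous_form L ((hσ i).coeffVec _) ((hσ j).coeffVec _)),
      integral_coeffVec_form_of_not_equiv ν (hσ i) (hσ j) (hσi i) (hσi j) he,
      integral_trace_mul_star_of_not_equiv ν (hσ i) (hσ j) (hσi i) (hσi j) he]
    simp

end

end Orthogonality

/-! ### Matrix elements of the tensor power in terms of the irreducible representations -/

section Expansion

variable {G : Type*} [Group G] {d N : ℕ} {U : G →* Matrix.unitaryGroup (Fin d) ℂ} (D : Irr U N)

lemma Irr.contMat [TopologicalSpace G] (hU : ContMat U) (j : Fin D.num) : ContMat (D.irr j) :=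
  IrredPiece.contMat (hU.tpowRep N) ⟨D.dim j, D.irr j, D.emb j, D.irreducible j, D.isometry j,
    D.intertwines j⟩

lemma Irr.not_equiv {j k : Fin D.num} (h : j ≠ k) :
    ¬ Nonempty ((rep (D.irr j)).Equiv (rep (D.irr k))) := fun he => h (D.inequivalent j k he)

lemma Irr.dim_pos (j : Fin D.num) : 0 < D.dim j :=
  Fin.pos_iff_nonempty.mpr (nonempty_of_irreducible (D.irreducible j))

/-- Every irreducible piece of U^{⊗N} is equivalent to some U_j by completeness, so its matrix
elements lie in the span of those of U_j; multiplicities cost nothing at the level of functions on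
the group. -/
lemma Irr.exists_expansion (o i : Pow d N) :
    ∃ c : ∀ j : Fin D.num, Fin (D.dim j) → Fin (D.dim j) → ℂ, ∀ g : G,
      tpow d N (mat U g) o i = ∑ j, ∑ t, ∑ t', c j t t' * mat (D.irr j) g t t' := by
  let v : (Σ j : Fin D.num, Fin (D.dim j) × Fin (D.dim j)) → G → ℂ :=
    fun x g => mat (D.irr x.1) g x.2.1 x.2.2
  have hmem : (fun g => tpow d N (mat U g) o i) ∈ Submodule.span ℂ (Set.range v) := by
    obtain ⟨ι, _, f, hf⟩ := exists_irredPieces (tpowRep U N)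
    have h1 : (fun g => tpow d N (mat U g) o i) = ∑ k, ∑ s, ∑ r,
        ((f k).emb o r * star ((f k).emb i s)) • fun g => mat (f k).irr g r s := by
      funext g
      rw [← mat_tpowRep, mat_eq_sum_pieces hf, Matrix.sum_apply]
      simp only [Finset.sum_apply, Pi.smul_apply, smul_eq_mul]
      refine Finset.sum_congr rfl fun k _ => ?_
      rw [Matrix.mul_apply]
      refine Finset.sum_congr rfl fun s _ => ?_
      rw [Matrix.mul_apply, Finset.sum_mul]
      refine Finset.sum_congr rfl fun r _ => ?_
      rw [Matrix.conjTranspose_apply]; ring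
    rw [h1]
    refine Submodule.sum_mem _ fun k _ => Submodule.sum_mem _ fun s _ =>
      Submodule.sum_mem _ fun r _ => Submodule.smul_mem _ _ ?_
    have hk : (f k).emb ≠ 0 := by
      intro h0
      have h2 := (f k).isometry
      rw [h0, Matrix.mul_zero] at h2
      exact one_ne_zero (congrFun (congrFun h2.symm r) r |>.symm.trans (by simp)).symm
    obtain ⟨j, hj⟩ := D.complete _ (f k).irr (f k).irreducible (f k).emb hk (f k).intertwines
    obtain ⟨A, B, -, hAB⟩ := exists_mat_eq_mul_mul hj
    have h3 : (fun g => mat (f k).irr g r s) = ∑ t', ∑ t,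
        (A r t * B t' s) • fun g => mat (D.irr j) g t t' := by
      funext g
      rw [hAB, Matrix.mul_apply]
      simp only [Finset.sum_apply, Pi.smul_apply, smul_eq_mul]
      refine Finset.sum_congr rfl fun t' _ => ?_
      rw [Matrix.mul_apply, Finset.sum_mul]
      exact Finset.sum_congr rfl fun t _ => by ring
    rw [h3]
    exact Submodule.sum_mem _ fun t' _ => Submodule.sum_mem _ fun t _ =>
      Submodule.smul_mem _ _ (Submodule.subset_span ⟨⟨j, t, t'⟩, rfl⟩)
  obtain ⟨c, hc⟩ := (Submodule.mem_span_range_iff_exists_fun ℂ).mp hmem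
  refine ⟨fun j t t' => c ⟨j, t, t'⟩, fun g => ?_⟩
  have h4 := congrFun hc g
  rw [← h4, Finset.sum_apply, Fintype.sum_sigma]
  refine Finset.sum_congr rfl fun j _ => ?_
  rw [Fintype.sum_prod_type]
  rfl

/-- Without irreducibles the expansion would make every matrix element vanish, including a diagonal
one at the neutral element. -/
lemma Irr.num_pos (hd : 0 < d) : 0 < D.num := by
  have : Nonempty (Fin d) := ⟨⟨0, hd⟩⟩
  obtain ⟨o⟩ : Nonempty (Pow d N) := inferInstance
  obtain ⟨c, hc⟩ := D.exists_expansion o o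
  by_contra h0
  have : IsEmpty (Fin D.num) := by
    rw [Nat.eq_zero_of_not_pos h0]; infer_instance
  have h1 := hc 1
  rw [mat_one, map_one, Matrix.one_apply_eq] at h1
  simp at h1

/-- The coefficients of the matrix elements of `U^{⊗ N}` in terms of those of the `U_j`. -/
def Irr.coef [MeasurableSpace G] (ν : Measure G) (j : Fin D.num) (w : Pow d N × Pow d N)
    (t t' : Fin (D.dim j)) : ℂ :=
  D.dim j * ∫ g, tpow d N (mat U g) w.1 w.2 * star (mat (D.irr j) g t t') ∂ν

variable [TopologicalSpace G] [IsTopologicalGroup G] [CompactSpace G] [MeasurableSpace G]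
  [BorelSpace G] (ν : Measure G) [ν.IsHaarMeasure] [IsProbabilityMeasure ν]

/-- Orthogonality of the matrix elements of the `U_j`. -/
lemma Irr.integral_sum_mul_star (hU : ContMat U)
    (c : ∀ j : Fin D.num, Fin (D.dim j) → Fin (D.dim j) → ℂ) (j : Fin D.num)
    (t t' : Fin (D.dim j)) :
    ∫ g, (∑ k, ∑ s, ∑ s', c k s s' * mat (D.irr k) g s s') * star (mat (D.irr j) g t t') ∂ν =
      c j t t' * (D.dim j : ℂ)⁻¹ := by
  simp only [Finset.sum_mul, mul_assoc]
  have hc : ∀ k s s', Continuous fun g =>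
      c k s s' * (mat (D.irr k) g s s' * star (mat (D.irr j) g t t')) := fun k s s' =>
    continuous_const.mul ((D.contMat hU k).mul_star (D.contMat hU j) s s' t t')
  rw [integral_sum_of_continuous ν fun k => by fun_prop, Finset.sum_eq_single j]
  · rw [integral_sum_of_continuous ν fun s => by fun_prop, Finset.sum_eq_single t]
    · rw [integral_sum_of_continuous ν fun s' => hc j t s', Finset.sum_eq_single t']
      · rw [integral_const_mul, integral_mat_mul_star_self ν (D.contMat hU j) (D.irreducible j)]
        simp
      · intro s' _ hs
        rw [integral_const_mul, integral_mat_mul_star_self ν (D.contMat hU j) (D.irreducible j)]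
        simp [hs]
      · simp
    · intro s _ hs
      rw [integral_sum_of_continuous ν fun s' => hc j s s']
      refine Finset.sum_eq_zero fun s' _ => ?_
      rw [integral_const_mul, integral_mat_mul_star_self ν (D.contMat hU j) (D.irreducible j)]
      simp [hs]
    · simp
  · intro k _ hk
    rw [integral_sum_of_continuous ν fun s => by fun_prop]
    refine Finset.sum_eq_zero fun s _ => ?_
    rw [integral_sum_of_continuous ν fun s' => hc k s s']
    refine Finset.sum_eq_zero fun s' _ => ?_
    rw [integral_const_mul, integral_mat_mul_star_of_not_equiv ν (D.contMat hU k)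
      (D.contMat hU j) (D.irreducible k) (D.irreducible j) (D.not_equiv hk), mul_zero]
  · simp

/-- Orthogonality forces the coefficients of any expansion to be the explicit integrals `Irr.coef`.
-/
lemma Irr.tpow_eq_sum (hU : ContMat U) (w : Pow d N × Pow d N) (g : G) :
    tpow d N (mat U g) w.1 w.2 = ∑ j, ∑ t, ∑ t', D.coef ν j w t t' * mat (D.irr j) g t t' := by
  obtain ⟨c, hc⟩ := D.exists_expansion w.1 w.2
  have : ∀ j t t', D.coef ν j w t t' = c j t t' := by
    intro j t t'
    rw [Irr.coef]
    simp_rw [hc]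
    rw [D.integral_sum_mul_star ν hU]
    have : (D.dim j : ℂ) ≠ 0 := by exact_mod_cast (D.dim_pos j).ne'
    field_simp
  simp_rw [this]
  exact hc g

end Expansion

/-! ### The bound for one irreducible component -/

/-- The difference of the two sides is the trace of P Q P with P = 1 - J J†, which is nonnegative.
-/
lemma trace_conjTranspose_mul_mul_re_le {m n : Type*} [Fintype m] [DecidableEq m] [Fintype n]
    [DecidableEq n] {Q : Matrix m m ℂ} (hQ : Q.PosSemidef) {J : Matrix m n ℂ}
    (hJ : J.conjTranspose * J = 1) :
    (J.conjTranspose * Q * J).trace.re ≤ Q.trace.re := by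
  set P := 1 - J * J.conjTranspose with hP
  have hPh : P.conjTranspose = P := by simp [hP]
  have hPP : P * P = P := by
    have : J * J.conjTranspose * (J * J.conjTranspose) = J * J.conjTranspose := by
      rw [Matrix.mul_assoc, ← Matrix.mul_assoc _ J, hJ, Matrix.one_mul]
    rw [hP, sub_mul, one_mul, mul_sub, mul_one, this]; simp
  have h1 : (P.conjTranspose * Q * P).trace = Q.trace - (J.conjTranspose * Q * J).trace := by
    rw [hPh, Matrix.trace_mul_comm, ← Matrix.mul_assoc, hPP, hP, Matrix.sub_mul, Matrix.one_mul,
      Matrix.trace_sub, Matrix.trace_mul_comm (J.conjTranspose * Q), Matrix.mul_assoc]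
  have h2 := (hQ.conjTranspose_mul_mul_same P).trace_nonneg
  rw [h1] at h2
  have := (Complex.nonneg_iff.mp h2).1
  rw [Complex.sub_re] at this
  linarith

/-- `L'` has the normalization of the comb of a learning process: its partial trace over the
output is the identity on the input tensor `S`. -/
def TraceOut {x κ : Type*} [Fintype x] [DecidableEq x] (L : Matrix ((x × x) × κ) ((x × x) × κ) ℂ)
    (S : Matrix κ κ ℂ) : Prop :=
  ∀ y w y' w', ∑ x, L ((x, y), w) ((x, y'), w') = if y = y' then S w w' else 0

section Diagonal

variable {G : Type*} [Group G]

lemma mat_apply_mul_star {n : Type*} [Fintype n] [DecidableEq n]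
    (σ : G →* Matrix.unitaryGroup n ℂ) (g : G) (y y' : n) :
    ∑ x, mat σ g x y * star (mat σ g x y') = if y = y' then 1 else 0 := by
  have := congrFun (congrFun (conjTranspose_mat_mul σ g) y') y
  rw [Matrix.mul_apply, Matrix.one_apply] at this
  simp only [Matrix.conjTranspose_apply] at this
  simp only [mul_comm (mat σ g _ y), this, eq_comm]

lemma sum_sum_ite_fst {x t : Type*} [Fintype x] [DecidableEq x] [Fintype t]
    (F : x × t → x × t → ℂ) :
    ∑ b' : x × t, ∑ b : x × t, (if b.1 = b'.1 then 1 else 0) * F b b' =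
      ∑ u', ∑ u, ∑ z, F (z, u) (z, u') := by
  rw [Fintype.sum_prod_type, Finset.sum_comm]
  refine Finset.sum_congr rfl fun u' _ => ?_
  rw [Finset.sum_comm (s := Finset.univ (α := t))]
  refine Finset.sum_congr rfl fun z _ => ?_
  rw [Fintype.sum_prod_type, Finset.sum_comm]
  refine Finset.sum_congr rfl fun u _ => ?_
  simp

/-- The partial trace of an operator that commutes with `W ⊗ conj τ`, `τ` irreducible, is a
multiple of the identity. -/
lemma partialTrace_eq {x t : Type*} [Fintype x] [DecidableEq x] [Fintype t] [DecidableEq t]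
    (W : G →* Matrix.unitaryGroup x ℂ) {τ : G →* Matrix.unitaryGroup t ℂ}
    (hτ : (rep τ).IsIrreducible) {P : Matrix (x × t) (x × t) ℂ}
    (hP : ∀ g, (mat W g ⊗ₖ (mat τ g).map star) * P * (mat W g ⊗ₖ (mat τ g).map star).conjTranspose
      = P) (u u' : t) :
    ∑ y, P (y, u) (y, u') = if u = u' then P.trace / Fintype.card t else 0 := by
  -- The partial trace over `x` commutes with conj τ. Its entrywise conjugate commutes with τ
  -- itself, to which Schur's lemma applies.
  let R : Matrix t t ℂ := Matrix.of fun u u' => star (∑ y, P (y, u) (y, u'))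
  have hR : ∀ g, mat τ g * R * (mat τ g).conjTranspose = R := by
    intro g
    ext v v'
    simp only [R, Matrix.of_apply]
    have h1 : ∀ y, P (y, v) (y, v') = ∑ b' : x × t, ∑ b : x × t,
        (mat W g y b.1 * star (mat W g y b'.1)) *
          (star (mat τ g v b.2) * P b b' * mat τ g v' b'.2) := by
      intro y
      conv_lhs => rw [← hP g]
      rw [Matrix.mul_apply]
      refine Finset.sum_congr rfl fun b' _ => ?_
      rw [Matrix.mul_apply, Finset.sum_mul]
      refine Finset.sum_congr rfl fun b _ => ?_
      simp only [Matrix.conjTranspose_apply, Matrix.kroneckerMap_apply, Matrix.map_apply,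
        star_mul', star_star]
      ring
    have h2 : ∑ y, P (y, v) (y, v') = ∑ b' : x × t, ∑ b : x × t,
        (if b.1 = b'.1 then 1 else 0) * (star (mat τ g v b.2) * P b b' * mat τ g v' b'.2) := by
      simp only [h1]
      rw [Finset.sum_comm]
      refine Finset.sum_congr rfl fun b' _ => ?_
      rw [Finset.sum_comm]
      refine Finset.sum_congr rfl fun b _ => ?_
      rw [← Finset.sum_mul, mat_apply_mul_star]
    rw [h2]
    rw [sum_sum_ite_fst]
    simp only [Matrix.mul_apply, Matrix.of_apply, star_sum, Finset.sum_mul, Finset.mul_sum,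
      Matrix.conjTranspose_apply, star_mul', star_star]
  obtain ⟨c, hc⟩ := eq_smul_one_of_commutes hτ (T := R) (fun g => by
    conv_rhs => rw [← hR g, Matrix.mul_assoc, conjTranspose_mat_mul, Matrix.mul_one])
  have hval : ∀ u u', ∑ y, P (y, u) (y, u') = if u = u' then star c else 0 := by
    intro u u'
    have := congrArg star (congrFun (congrFun hc u) u')
    simp only [R, Matrix.of_apply, star_star, Matrix.smul_apply, Matrix.one_apply, smul_eq_mul,
      mul_ite, mul_one, mul_zero, apply_ite star, star_zero] at this
    exact this
  have htr : P.trace = Fintype.card t * star c := by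
    rw [Matrix.trace, Fintype.sum_prod_type, Finset.sum_comm]
    simp only [Matrix.diag_apply, hval, if_true, Finset.sum_const, Finset.card_univ, nsmul_eq_mul]
  have hne : (Fintype.card t : ℂ) ≠ 0 := by
    have := nonempty_of_irreducible hτ
    exact_mod_cast Fintype.card_ne_zero
  rw [hval, htr, mul_div_cancel_left₀ _ hne]

variable [TopologicalSpace G] [IsTopologicalGroup G] [CompactSpace G] [MeasurableSpace G]
  [BorelSpace G] (ν : Measure G) [ν.IsHaarMeasure] [IsProbabilityMeasure ν]

/-- The estimate of one diagonal term. Orthogonality turns the integral into an average of the form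
over pairs of columns r, s of the embedding `J` of σ in W ⊗ conj τ. Column r carries the final
output and the first τ index, column s the final input and the second τ index. The columns r are
extended to a full orthonormal basis by positivity, after which the output is traced out. The
columns s add up to J J†, whose partial trace over `x` is a multiple of the identity. The factors
dim σ cancel, so the bound no longer sees σ. -/
lemma integral_component_le {x t n : Type*} [Fintype x] [DecidableEq x] [Fintype t] [DecidableEq t]
    [Fintype n] [DecidableEq n] (W : G →* Matrix.unitaryGroup x ℂ)
    {τ : G →* Matrix.unitaryGroup t ℂ} (hτ : (rep τ).IsIrreducible)
    {σ : G →* Matrix.unitaryGroup n ℂ} (hσ : ContMat σ) (hσi : (rep σ).IsIrreducible)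
    {J : Matrix (x × t) n ℂ} (hJ : J.conjTranspose * J = 1)
    (hWJ : ∀ g, (mat W g ⊗ₖ (mat τ g).map star) * J = J * mat σ g)
    {L : Matrix ((x × x) × (t × t)) ((x × x) × (t × t)) ℂ} (hL : L.PosSemidef)
    {S : Matrix (t × t) (t × t) ℂ} (hS : TraceOut L S)
    (c : (x × x) × (t × t) → n → n → ℂ)
    (hc : ∀ k r s, c k r s = J (k.1.1, k.2.1) r * star (J (k.1.2, k.2.2) s)) :
    ∫ g, (star (coeffVec σ c g) ⬝ᵥ L.mulVec (coeffVec σ c g)).re ∂ν ≤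
      S.trace.re / Fintype.card t := by
  have hre : ∫ g, (star (coeffVec σ c g) ⬝ᵥ L.mulVec (coeffVec σ c g)).re ∂ν =
      (∫ g, star (coeffVec σ c g) ⬝ᵥ L.mulVec (coeffVec σ c g) ∂ν).re :=
    integral_re (integrable_of_continuous ν (continuous_form L (hσ.coeffVec c) (hσ.coeffVec c)))
  rw [hre, integral_coeffVec_form_self ν hσ hσi]
  -- K s inserts the conjugate of column s on (input, second τ index) and leaves (output, first τ
  -- index) free. Thus Q s is the form of `L` with its input half fixed.
  let K : n → Matrix ((x × x) × (t × t)) (x × t) ℂ := fun s => Matrix.of fun k a =>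
    if (k.1.1, k.2.1) = a then star (J (k.1.2, k.2.2) s) else 0
  let Q : n → Matrix (x × t) (x × t) ℂ := fun s => (K s).conjTranspose * L * K s
  have hQ : ∀ s, (Q s).PosSemidef := fun s => hL.conjTranspose_mul_mul_same _
  have hcol : ∀ r s, (fun k => c k r s) = (K s).mulVec (J.col r) := by
    intro r s
    ext k
    simp only [K, Matrix.mulVec, dotProduct, Matrix.of_apply, ite_mul, zero_mul, Finset.sum_ite_eq,
      Finset.mem_univ, if_true, hc, Matrix.col_apply]
    ring
  have h1 : ∀ s, ∑ r, (star (fun k => c k r s) ⬝ᵥ L.mulVec fun k => c k r s) =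
      (J.conjTranspose * Q s * J).trace := by
    intro s
    rw [Matrix.trace]
    refine Finset.sum_congr rfl fun r _ => ?_
    have h4 : (J.conjTranspose * Q s * J) r r = star (J.col r) ⬝ᵥ (Q s).mulVec (J.col r) := by
      rw [Matrix.mul_assoc, Matrix.mul_apply]; rfl
    rw [Matrix.diag_apply, h4, hcol, Matrix.star_mulVec, ← Matrix.dotProduct_mulVec,
      Matrix.mulVec_mulVec, Matrix.mulVec_mulVec]
  have h2 : ∑ s, (Q s).trace = Fintype.card n * (S.trace / Fintype.card t) := by
    -- The projector J J† commutes with W ⊗ conj τ and has trace dim σ, so its partial trace is dim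
    -- σ / dim τ times the identity.
    have hP : ∀ u u', ∑ s, ∑ y, J (y, u) s * star (J (y, u') s) =
        if u = u' then (Fintype.card n : ℂ) / Fintype.card t else 0 := by
      intro u u'
      have h3 := partialTrace_eq W hτ (P := J * J.conjTranspose) (fun g => by
        rw [← Matrix.mul_assoc, hWJ, Matrix.mul_assoc, ← Matrix.conjTranspose_mul, hWJ,
          Matrix.conjTranspose_mul, Matrix.mul_assoc, ← Matrix.mul_assoc (mat σ g),
          mat_mul_conjTranspose, Matrix.one_mul]) u u'
      rw [Matrix.trace_mul_comm, hJ, Matrix.trace_one] at h3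
      rw [← h3, Finset.sum_comm]
      exact Finset.sum_congr rfl fun y _ => by
        rw [Matrix.mul_apply]; rfl
    have h3 : ∀ s, (Q s).trace = ∑ a : t, ∑ u' : t, ∑ u : t,
        (∑ y, J (y, u) s * star (J (y, u') s)) * S (a, u) (a, u') := by
      intro s
      have h4 : ∀ a : x × t, Q s a a = ∑ b' : x × t, ∑ b : x × t, J b s * star (J b' s) *
          L ((a.1, b.1), (a.2, b.2)) ((a.1, b'.1), (a.2, b'.2)) := by
        intro a
        have h5 : ∀ f : (x × x) × (t × t) → ℂ, ∑ k, f k * K s k a =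
            ∑ b : x × t, f ((a.1, b.1), (a.2, b.2)) * star (J b s) := by
          intro f
          simp only [K, Matrix.of_apply, Fintype.sum_prod_type, Prod.ext_iff, mul_ite, mul_zero,
            ite_and]
          rw [Finset.sum_eq_single a.1]
          · refine Finset.sum_congr rfl fun y _ => ?_
            rw [Finset.sum_eq_single a.2]
            · simp
            · intro b _ hb; simp [hb]
            · simp
          · intro b _ hb; simp [hb]
          · simp
        have h6 : ∀ k, ((K s).conjTranspose * L) a k = star (∑ k', star (L k' k) * K s k' a) := by
          intro k
          rw [Matrix.mul_apply, star_sum]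
          refine Finset.sum_congr rfl fun k' _ => ?_
          rw [star_mul', star_star, mul_comm]; rfl
        change ((K s).conjTranspose * L * K s) a a = _
        rw [Matrix.mul_apply, h5]
        refine Finset.sum_congr rfl fun b' _ => ?_
        rw [h6, h5, star_sum, Finset.sum_mul]
        refine Finset.sum_congr rfl fun b _ => ?_
        rw [star_mul', star_star, star_star]; ring
      rw [Matrix.trace, Fintype.sum_prod_type, Finset.sum_comm]
      refine Finset.sum_congr rfl fun a _ => ?_
      have h7 : ∑ x₁, (Q s).diag (x₁, a) = ∑ b' : x × t, ∑ b : x × t,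
          (if b.1 = b'.1 then 1 else 0) * (J b s * star (J b' s) * S (a, b.2) (a, b'.2)) := by
        simp only [Matrix.diag_apply, h4]
        rw [Finset.sum_comm]
        refine Finset.sum_congr rfl fun b' _ => ?_
        rw [Finset.sum_comm]
        refine Finset.sum_congr rfl fun b _ => ?_
        rw [← Finset.mul_sum, hS]
        split_ifs <;> simp
      rw [h7, sum_sum_ite_fst]
      simp only [Finset.sum_mul]
    simp only [h3]
    rw [Finset.sum_comm]
    have h8 : ∀ a : t, ∑ s, ∑ u', ∑ u, (∑ y, J (y, u) s * star (J (y, u') s)) * S (a, u) (a, u') =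
        ∑ u, (Fintype.card n : ℂ) / Fintype.card t * S (a, u) (a, u) := by
      intro a
      rw [Finset.sum_comm]
      refine Finset.sum_congr rfl fun u' _ => ?_
      rw [Finset.sum_comm, Finset.sum_eq_single u']
      · rw [← Finset.sum_mul, hP, if_pos rfl]
      · intro u _ hu
        rw [← Finset.sum_mul, hP, if_neg hu, zero_mul]
      · simp
    simp only [h8, ← Finset.mul_sum]
    rw [Matrix.trace, Fintype.sum_prod_type]
    simp only [Matrix.diag_apply]
    ring
  rw [Finset.sum_comm]
  simp only [h1]
  have hpos : (0 : ℝ) < Fintype.card n := by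
    have := nonempty_of_irreducible hσi
    exact_mod_cast Fintype.card_pos
  calc ((Fintype.card n : ℂ)⁻¹ * ∑ s, (J.conjTranspose * Q s * J).trace).re
      = (Fintype.card n : ℝ)⁻¹ * ∑ s, (J.conjTranspose * Q s * J).trace.re := by
        rw [← Complex.re_sum, ← Complex.re_ofReal_mul]; simp
    _ ≤ (Fintype.card n : ℝ)⁻¹ * ∑ s, (Q s).trace.re := by
        -- The only loss in the estimate: the trace of Q s compressed to the range of `J` is
        -- replaced by its full trace.
        refine mul_le_mul_of_nonneg_left (Finset.sum_le_sum fun s _ => ?_) (by positivity)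
        exact trace_conjTranspose_mul_mul_re_le (hQ s) hJ
    _ = S.trace.re / Fintype.card t := by
        rw [← Complex.re_sum, h2, ← Complex.ofReal_natCast, Complex.re_ofReal_mul,
          ← Complex.ofReal_natCast, Complex.div_ofReal_re]
        field_simp

end Diagonal

/-! ### The bound on the fidelity of a learning comb -/

section Core

variable {G : Type*} [Group G]

/-- The representation `W ⊗ conj τ`. -/
def tensorConj {x t : Type*} [Fintype x] [DecidableEq x] [Fintype t] [DecidableEq t]
    (W : G →* Matrix.unitaryGroup x ℂ) (τ : G →* Matrix.unitaryGroup t ℂ) :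
    G →* Matrix.unitaryGroup (x × t) ℂ :=
  MonoidHom.mk' (fun g => ⟨mat W g ⊗ₖ (mat τ g).map star, by
    rw [Matrix.mem_unitaryGroup_iff, Matrix.star_eq_conjTranspose, Matrix.conjTranspose_kronecker,
      ← Matrix.mul_kronecker_mul, mat_mul_conjTranspose]
    have : (mat τ g).map star * ((mat τ g).map star).conjTranspose = 1 := by
      have h := congrArg (fun A => A.map (starRingEnd ℂ)) (mat_mul_conjTranspose τ g)
      simp only [Matrix.map_mul] at h
      rw [Matrix.map_one _ (map_zero _) (map_one _)] at h
      exact h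
    rw [this, Matrix.one_kronecker_one]⟩) fun g h => by
      refine Subtype.ext ?_
      change mat W (g * h) ⊗ₖ (mat τ (g * h)).map star =
        (mat W g ⊗ₖ (mat τ g).map star) * (mat W h ⊗ₖ (mat τ h).map star)
      rw [← Matrix.mul_kronecker_mul, mat_mul, mat_mul]
      congr 1
      exact Matrix.map_mul (f := starRingEnd ℂ)

lemma mat_tensorConj {x t : Type*} [Fintype x] [DecidableEq x] [Fintype t] [DecidableEq t]
    (W : G →* Matrix.unitaryGroup x ℂ) (τ : G →* Matrix.unitaryGroup t ℂ) (g : G) :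
    mat (tensorConj W τ) g = mat W g ⊗ₖ (mat τ g).map star := rfl

lemma ContMat.tensorConj [TopologicalSpace G] {x t : Type*} [Fintype x] [DecidableEq x] [Fintype t]
    [DecidableEq t] {W : G →* Matrix.unitaryGroup x ℂ} {τ : G →* Matrix.unitaryGroup t ℂ}
    (hW : ContMat W) (hτ : ContMat τ) : ContMat (QLearn.tensorConj W τ) :=
  fun i j => hW.mul_star hτ i.1 j.1 i.2 j.2

lemma trace_tensorConj {x t : Type*} [Fintype x] [DecidableEq x] [Fintype t] [DecidableEq t]
    (W : G →* Matrix.unitaryGroup x ℂ) (τ : G →* Matrix.unitaryGroup t ℂ) (g : G) :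
    (mat (tensorConj W τ) g).trace = (mat W g).trace * star (mat τ g).trace := by
  rw [mat_tensorConj, Matrix.trace_kronecker]
  simp [Matrix.trace]

/-- Extension of an operator by the identity on `u`. -/
def oneTensor (u : Type*) [DecidableEq u] {κ l : Type*} (B : Matrix κ l ℂ) :
    Matrix (u × κ) (u × l) ℂ :=
  Matrix.of fun k v => if k.1 = v.1 then B k.2 v.2 else 0

lemma conjTranspose_oneTensor_mul_mul {u κ l : Type*} [Fintype u] [DecidableEq u] [Fintype κ]
    (B : Matrix κ l ℂ) (L : Matrix (u × κ) (u × κ) ℂ) (a a' : u × l) :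
    ((oneTensor u B).conjTranspose * L * oneTensor u B) a a' =
      ∑ w, ∑ w', star (B w a.2) * L (a.1, w) (a'.1, w') * B w' a'.2 := by
  rw [Matrix.mul_apply, Fintype.sum_prod_type, Finset.sum_eq_single a'.1]
  · rw [Finset.sum_comm]
    refine Finset.sum_congr rfl fun w' _ => ?_
    rw [Matrix.mul_apply, Fintype.sum_prod_type, Finset.sum_eq_single a.1]
    · simp [oneTensor, Finset.sum_mul]
    · intro b _ hb; simp [oneTensor, hb]
    · simp
  · intro b _ hb; simp [oneTensor, hb]
  · simp

/-- The compression acts on the example systems only, so it commutes with the trace over the final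
output. It restricts a comb to the sector of one U_j. -/
lemma TraceOut.compress {x κ l : Type*} [Fintype x] [DecidableEq x] [Fintype κ]
    {L : Matrix ((x × x) × κ) ((x × x) × κ) ℂ} {S : Matrix κ κ ℂ} (h : TraceOut L S)
    (B : Matrix κ l ℂ) :
    TraceOut ((oneTensor (x × x) B).conjTranspose * L * oneTensor (x × x) B)
      (B.conjTranspose * S * B) := by
  intro y v y' v'
  simp only [conjTranspose_oneTensor_mul_mul]
  have h1 : (B.conjTranspose * S * B) v v' = ∑ w, ∑ w', star (B w v) * S w w' * B w' v' := by
    rw [Matrix.mul_apply, Finset.sum_comm]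
    refine Finset.sum_congr rfl fun w' _ => ?_
    rw [Matrix.mul_apply, Finset.sum_mul]
    rfl
  rw [h1, Finset.sum_comm]
  simp_rw [Finset.sum_comm (s := Finset.univ (α := x))]
  simp only [← Finset.mul_sum, ← Finset.sum_mul, h y _ y' _]
  split_ifs <;> simp

/-- Inserting the rank-one Choi operator of the examples leaves a quadratic form of `L` at a product
vector; the transposition in the link product becomes the conjugate on |V⟩⟩. -/
lemma star_dotProduct_plug {x o i : Type*} [Fintype x] [Fintype o] [Fintype i]
    (L : Matrix (x × (o × i)) (x × (o × i)) ℂ) (V : Matrix o i ℂ) (f : x → ℂ) :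
    star f ⬝ᵥ (plug L V).mulVec f =
      star (fun k : x × (o × i) => f k.1 * star (dket V k.2)) ⬝ᵥ
        L.mulVec (fun k : x × (o × i) => f k.1 * star (dket V k.2)) := by
  simp only [dotProduct, Matrix.mulVec, plug, Matrix.of_apply, Pi.star_apply, star_mul', star_star,
    Fintype.sum_prod_type (α₁ := x), Finset.mul_sum, Finset.sum_mul]
  refine Finset.sum_congr rfl fun u _ => ?_
  rw [Finset.sum_comm]
  refine Finset.sum_congr rfl fun w _ => Finset.sum_congr rfl fun u' _ =>
    Finset.sum_congr rfl fun w' _ => ?_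
  ring

variable {d N : ℕ} {U : G →* Matrix.unitaryGroup (Fin d) ℂ} (D : Irr U N)

/-- The conjugates of the coefficients of `U^{⊗ N}`, as a matrix. -/
def Irr.coefMat [MeasurableSpace G] (ν : Measure G) (j : Fin D.num) :
    Matrix (Pow d N × Pow d N) (Fin (D.dim j) × Fin (D.dim j)) ℂ :=
  Matrix.of fun w v => star (D.coef ν j w v.1 v.2)

/-- The weight that the comb of a storing board assigns to the `j`-th irreducible
representation. -/
def Irr.weight [MeasurableSpace G] (ν : Measure G)
    (S : Matrix (Pow d N × Pow d N) (Pow d N × Pow d N) ℂ) (j : Fin D.num) : ℝ :=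
  ((D.coefMat ν j).conjTranspose * S * D.coefMat ν j).trace.re / D.dim j

lemma TraceOut.trace_re_nonneg {x κ : Type*} [Fintype x] [DecidableEq x] [Nonempty x] [Fintype κ]
    {L : Matrix ((x × x) × κ) ((x × x) × κ) ℂ} {S : Matrix κ κ ℂ} (h : TraceOut L S)
    (hL : L.PosSemidef) : 0 ≤ S.trace.re := by
  obtain ⟨y⟩ := ‹Nonempty x›
  rw [Matrix.trace, Complex.re_sum]
  refine Finset.sum_nonneg fun w _ => ?_
  have h1 := h y w y w
  rw [if_pos rfl] at h1
  rw [Matrix.diag_apply, ← h1, Complex.re_sum]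
  exact Finset.sum_nonneg fun x _ => (Complex.nonneg_iff.mp hL.diag_nonneg).1

lemma Irr.weight_nonneg [MeasurableSpace G] (ν : Measure G) {x : Type*} [Fintype x] [DecidableEq x]
    [Nonempty x] {L : Matrix ((x × x) × (Pow d N × Pow d N)) ((x × x) × (Pow d N × Pow d N)) ℂ}
    {S : Matrix (Pow d N × Pow d N) (Pow d N × Pow d N) ℂ} (h : TraceOut L S)
    (hL : L.PosSemidef) (j : Fin D.num) : 0 ≤ D.weight ν S j :=
  div_nonneg ((h.compress (D.coefMat ν j)).trace_re_nonneg (hL.conjTranspose_mul_mul_same _))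
    (Nat.cast_nonneg _)

variable [TopologicalSpace G] [IsTopologicalGroup G] [CompactSpace G] [MeasurableSpace G]
  [BorelSpace G] (ν : Measure G) [ν.IsHaarMeasure] [IsProbabilityMeasure ν]

/-- The central inequality. Keeping `W` arbitrary lets the same proof serve all final systems
jointly and a single one of them. The bound depends on the comb only through the weights of its
storing part. -/
theorem Irr.integral_chFid_le (hU : ContMat U) {x : Type*} [Fintype x] [DecidableEq x]
    [Nonempty x] {W : G →* Matrix.unitaryGroup x ℂ} (hW : ContMat W)
    {L : Matrix ((x × x) × (Pow d N × Pow d N)) ((x × x) × (Pow d N × Pow d N)) ℂ}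
    (hL : L.PosSemidef) {S : Matrix (Pow d N × Pow d N) (Pow d N × Pow d N) ℂ}
    (hS : TraceOut L S) :
    ∫ g, chFid (plug L (tpow d N (mat U g))) (mat W g) ∂ν ≤
      ∫ g, (‖(mat W g).trace‖ / Fintype.card x) ^ 2 *
        ‖∑ j, (√(D.weight ν S j) : ℂ) * (mat (D.irr j) g).trace‖ ^ 2 ∂ν := by
  choose ι hι f hf using fun j => exists_irredPieces (tensorConj W (D.irr j))
  -- c₀ gives the part of |W_g⟩⟩ ⊗ conj |(U_j)_g⟩⟩ lying in the piece μ of W ⊗ conj U_j. The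
  -- operators F j carry it to the example systems, and c is the result.
  let c₀ : ∀ i : (Σ j, ι j), (x × x) × (Fin (D.dim i.1) × Fin (D.dim i.1)) →
      Fin (f i.1 i.2).dim → Fin (f i.1 i.2).dim → ℂ := fun i k r s =>
    (f i.1 i.2).emb (k.1.1, k.2.1) r * star ((f i.1 i.2).emb (k.1.2, k.2.2) s)
  let F : ∀ j, Matrix ((x × x) × (Pow d N × Pow d N))
      ((x × x) × (Fin (D.dim j) × Fin (D.dim j))) ℂ := fun j => oneTensor (x × x) (D.coefMat ν j)
  let c : ∀ i : (Σ j, ι j), (x × x) × (Pow d N × Pow d N) →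
      Fin (f i.1 i.2).dim → Fin (f i.1 i.2).dim → ℂ := fun i k r s =>
    (F i.1).mulVec (fun l => c₀ i l r s) k
  have hcF : ∀ i g, coeffVec (f i.1 i.2).irr (c i) g =
      (F i.1).mulVec (coeffVec (f i.1 i.2).irr (c₀ i) g) := by
    intro i g
    rw [coeffVec_eq_sum, coeffVec_eq_sum]
    simp only [Matrix.mulVec_sum, Matrix.mulVec_smul]
    rfl
  have hσ : ∀ i : (Σ j, ι j), ContMat (f i.1 i.2).irr := fun i =>
    (f i.1 i.2).contMat (hW.tensorConj (D.contMat hU i.1))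
  have hpos : ∀ j, 0 ≤ D.weight ν S j := D.weight_nonneg ν hS hL
  have hdket : ∀ j g, ∑ μ, coeffVec (f j μ).irr (c₀ ⟨j, μ⟩) g =
      fun k : (x × x) × (Fin (D.dim j) × Fin (D.dim j)) => mat W g k.1.1 k.1.2 * star (mat (D.irr j) g k.2.1 k.2.2) := by
    intro j g
    ext k
    have h1 := congrFun (congrFun (mat_eq_sum_pieces (hf j) g) (k.1.1, k.2.1)) (k.1.2, k.2.2)
    refine Eq.trans ?_ h1.symm
    rw [Matrix.sum_apply, Finset.sum_apply]
    refine Finset.sum_congr rfl fun μ _ => ?_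
    rw [Matrix.mul_apply, coeffVec, Finset.sum_comm]
    refine Finset.sum_congr rfl fun s _ => ?_
    rw [Matrix.mul_apply, Finset.sum_mul]
    refine Finset.sum_congr rfl fun r _ => ?_
    simp only [c₀, Matrix.conjTranspose_apply]
    ring
  have hxi : ∀ g, (fun k : (x × x) × (Pow d N × Pow d N) =>
      dket (mat W g) k.1 * star (dket (tpow d N (mat U g)) k.2)) =
      ∑ i : (Σ j, ι j), coeffVec (f i.1 i.2).irr (c i) g := by
    intro g
    simp only [hcF]
    rw [Fintype.sum_sigma]
    have h1 : ∀ j, ∑ μ, (F j).mulVec (coeffVec (f j μ).irr (c₀ ⟨j, μ⟩) g) =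
        (F j).mulVec fun k : (x × x) × (Fin (D.dim j) × Fin (D.dim j)) =>
          mat W g k.1.1 k.1.2 * star (mat (D.irr j) g k.2.1 k.2.2) := fun j => by
      rw [← hdket, Matrix.mulVec_sum]
    refine Eq.trans ?_ (Finset.sum_congr rfl fun j _ => (h1 j).symm)
    ext k
    rw [Finset.sum_apply, dket, dket, D.tpow_eq_sum ν hU, star_sum, Finset.mul_sum]
    refine Finset.sum_congr rfl fun j _ => ?_
    rw [Matrix.mulVec, dotProduct, Fintype.sum_prod_type, Finset.sum_eq_single k.1]
    · rw [Fintype.sum_prod_type, star_sum, Finset.mul_sum]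
      refine Finset.sum_congr rfl fun t _ => ?_
      rw [star_sum, Finset.mul_sum]
      refine Finset.sum_congr rfl fun t' _ => ?_
      simp only [F, oneTensor, Irr.coefMat, Matrix.of_apply, if_true, star_mul']
      ring
    · intro b _ hb
      refine Finset.sum_eq_zero fun v _ => ?_
      simp only [F, oneTensor, Matrix.of_apply, if_neg hb.symm, zero_mul]
    · simp
  -- All pieces of W ⊗ conj U_j receive the same constant √w_j, because the diagonal estimate does
  -- not depend on the piece. This is what lets the characters recombine into χ_W times conj χ_j.
  have hmain := integral_sum_form_le ν (σ := fun i : (Σ j, ι j) => (f i.1 i.2).irr) hσ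
    (fun i => (f i.1 i.2).irreducible) hL c (fun i => √(D.weight ν S i.1))
    (fun i => Real.sqrt_nonneg _) (fun i => by
      rw [Real.sq_sqrt (hpos _)]
      simp only [hcF]
      have h1 : ∀ a : (x × x) × (Fin (D.dim i.1) × Fin (D.dim i.1)) → ℂ,
          star ((F i.1).mulVec a) ⬝ᵥ L.mulVec ((F i.1).mulVec a) =
            star a ⬝ᵥ ((F i.1).conjTranspose * L * F i.1).mulVec a := by
        intro a
        rw [Matrix.star_mulVec, ← Matrix.dotProduct_mulVec, Matrix.mulVec_mulVec,
          Matrix.mulVec_mulVec, Matrix.mul_assoc]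
      simp only [h1]
      have h2 := integral_component_le ν W (D.irreducible i.1) (hσ i) (f i.1 i.2).irreducible
        (f i.1 i.2).isometry (f i.1 i.2).intertwines (hL.conjTranspose_mul_mul_same (F i.1))
        (hS.compress (D.coefMat ν i.1)) (c₀ i) (fun k r s => rfl)
      rw [Fintype.card_fin] at h2
      exact h2)
  have htr : ∀ g, ∑ i : (Σ j, ι j), ((√(D.weight ν S i.1) : ℝ) : ℂ) *
      (mat (f i.1 i.2).irr g).trace =
      (mat W g).trace * star (∑ j, (√(D.weight ν S j) : ℂ) * (mat (D.irr j) g).trace) := by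
    intro g
    rw [Fintype.sum_sigma, star_sum, Finset.mul_sum]
    refine Finset.sum_congr rfl fun j _ => ?_
    have h1 : ∑ μ, (mat (f j μ).irr g).trace = (mat W g).trace * star (mat (D.irr j) g).trace := by
      rw [← trace_tensorConj, mat_eq_sum_pieces (hf j) g, Matrix.trace_sum]
      refine Finset.sum_congr rfl fun μ _ => ?_
      rw [Matrix.trace_mul_comm, ← Matrix.mul_assoc, (f j μ).isometry, Matrix.one_mul]
    dsimp only
    rw [← Finset.mul_sum, h1, star_mul', RCLike.star_def, Complex.conj_ofReal]
    ring
  have hl : ∀ g, chFid (plug L (tpow d N (mat U g))) (mat W g) =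
      (star (∑ i : (Σ j, ι j), coeffVec (f i.1 i.2).irr (c i) g) ⬝ᵥ
        L.mulVec (∑ i : (Σ j, ι j), coeffVec (f i.1 i.2).irr (c i) g)).re /
        (Fintype.card x : ℝ) ^ 2 := by
    intro g
    rw [chFid, star_dotProduct_plug, hxi]
  have hr : ∀ g, (‖(mat W g).trace‖ / Fintype.card x) ^ 2 *
        ‖∑ j, (√(D.weight ν S j) : ℂ) * (mat (D.irr j) g).trace‖ ^ 2 =
      ‖∑ i : (Σ j, ι j), ((√(D.weight ν S i.1) : ℝ) : ℂ) * (mat (f i.1 i.2).irr g).trace‖ ^ 2 /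
        (Fintype.card x : ℝ) ^ 2 := by
    intro g
    rw [htr, norm_mul, norm_star]
    ring
  simp only [hl, hr, integral_div]
  exact div_le_div_of_nonneg_right hmain (by positivity)

/-- The weights add up to the mean normalization of the comb. -/
lemma Irr.sum_weight (hU : ContMat U) (S : Matrix (Pow d N × Pow d N) (Pow d N × Pow d N) ℂ) :
    ∑ j, D.weight ν S j = ∫ g, (star (dket (tpow d N (mat U g))) ⬝ᵥ
      S.transpose.mulVec (dket (tpow d N (mat U g)))).re ∂ν := by
  let c : ∀ j : Fin D.num, Pow d N × Pow d N → Fin (D.dim j) → Fin (D.dim j) → ℂ := fun j w t t' =>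
    D.coef ν j w t t'
  have h1 : ∀ g, dket (tpow d N (mat U g)) = ∑ j, coeffVec (D.irr j) (c j) g := by
    intro g
    ext w
    rw [Finset.sum_apply]
    exact D.tpow_eq_sum ν hU w g
  have hcc : ∀ j k, Continuous fun g => star (coeffVec (D.irr j) (c j) g) ⬝ᵥ
      S.transpose.mulVec (coeffVec (D.irr k) (c k) g) := fun j k =>
    continuous_form _ ((D.contMat hU j).coeffVec _) ((D.contMat hU k).coeffVec _)
  have h2 : ∫ g, (star (dket (tpow d N (mat U g))) ⬝ᵥ
      S.transpose.mulVec (dket (tpow d N (mat U g)))).re ∂ν =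
      (∑ j, ∑ k, ∫ g, star (coeffVec (D.irr j) (c j) g) ⬝ᵥ
        S.transpose.mulVec (coeffVec (D.irr k) (c k) g) ∂ν).re := by
    have h3 : ∀ g, star (dket (tpow d N (mat U g))) ⬝ᵥ
        S.transpose.mulVec (dket (tpow d N (mat U g))) =
        ∑ j, ∑ k, star (coeffVec (D.irr j) (c j) g) ⬝ᵥ
          S.transpose.mulVec (coeffVec (D.irr k) (c k) g) := by
      intro g
      rw [h1]
      simp only [star_sum, sum_dotProduct, Matrix.mulVec_sum, dotProduct_sum]
      exact Finset.sum_comm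
    simp only [h3]
    have h4 : Continuous fun g => ∑ j, ∑ k, star (coeffVec (D.irr j) (c j) g) ⬝ᵥ
          S.transpose.mulVec (coeffVec (D.irr k) (c k) g) :=
      continuous_finsetSum _ fun j _ => continuous_finsetSum _ fun k _ => hcc j k
    have h5 := integral_re (integrable_of_continuous ν h4)
    refine Eq.trans h5 (congrArg _ ?_)
    rw [integral_sum_of_continuous ν fun j => continuous_finsetSum _ fun k _ => hcc j k]
    exact Finset.sum_congr rfl fun j _ => integral_sum_of_continuous ν fun k => hcc j k
  rw [h2, Complex.re_sum]
  refine Finset.sum_congr rfl fun j _ => ?_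
  -- Distinct U_j are inequivalent, so only diagonal terms survive, and the j-th one is the weight
  -- of j. The transpose of S compensates the conjugation in `Irr.coefMat`.
  rw [Finset.sum_eq_single j]
  · rw [integral_coeffVec_form_self ν (D.contMat hU j) (D.irreducible j), Fintype.card_fin,
      Irr.weight, div_eq_inv_mul, ← Complex.ofReal_natCast, ← Complex.ofReal_inv,
      Complex.re_ofReal_mul]
    congr 2
    rw [Matrix.trace, Fintype.sum_prod_type]
    refine Finset.sum_congr rfl fun t _ => Finset.sum_congr rfl fun t' _ => ?_
    rw [Matrix.diag_apply, Matrix.mul_apply]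
    simp only [Matrix.mul_apply, dotProduct, Matrix.mulVec, Matrix.transpose_apply, Finset.mul_sum,
      Finset.sum_mul]
    refine Finset.sum_congr rfl fun w _ => Finset.sum_congr rfl fun w' _ => ?_
    simp only [Irr.coefMat, Matrix.conjTranspose_apply, Matrix.of_apply, star_star, Pi.star_apply,
      c]
    ring
  · intro k _ hk
    exact integral_coeffVec_form_of_not_equiv ν (D.contMat hU j) (D.contMat hU k)
      (D.irreducible j) (D.irreducible k) (D.not_equiv hk.symm) _ _ _
  · simp

end Core

/-! ### Storing combs -/

section Combs

variable {d : ℕ}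

lemma sum_pow_succ {n : ℕ} (f : Pow d (n + 1) → ℂ) :
    ∑ o, f o = ∑ o : Pow d n, ∑ a : Fin d, f (Fin.snoc (α := fun _ => Fin d) o a) := by
  rw [← (Fin.snocEquiv (fun _ => Fin d)).sum_comp, Fintype.sum_prod_type, Finset.sum_comm]
  rfl

lemma tpow_snoc {n : ℕ} (A : Matrix (Fin d) (Fin d) ℂ) (o i : Pow d n) (a b : Fin d) :
    tpow d (n + 1) A (Fin.snoc (α := fun _ => Fin d) o a) (Fin.snoc (α := fun _ => Fin d) i b) =
      tpow d n A o i * A a b := by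
  simp [tpow, Fin.prod_univ_castSucc]

lemma sum_comm_six {α β : Type*} [Fintype α] [Fintype β] (F : α → α → β → α → β → α → ℂ) :
    ∑ a, ∑ a', ∑ i, ∑ b, ∑ i', ∑ b', F a a' i b i' b' =
      ∑ i, ∑ i', ∑ b, ∑ b', ∑ a, ∑ a', F a a' i b i' b' := by
  simp only [← Fintype.sum_prod_type']
  exact Fintype.sum_equiv
    ⟨fun x => (x.2.2.1, x.2.2.2.2.1, x.2.2.2.1, x.2.2.2.2.2, x.1, x.2.1),
      fun y => (y.2.2.2.2.1, y.2.2.2.2.2, y.1, y.2.2.1, y.2.1, y.2.2.2.1),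
      fun _ => rfl, fun _ => rfl⟩ _ _ fun _ => rfl

/-- The normalization of a storing comb on unitary examples. -/
lemma IsStoringComb.sum_eq_one {A : Matrix (Fin d) (Fin d) ℂ} (hA : A.conjTranspose * A = 1) :
    ∀ {n : ℕ} {S : Matrix (Pow d n × Pow d n) (Pow d n × Pow d n) ℂ}, IsStoringComb d n S →
      ∑ o, ∑ o', ∑ i, ∑ i', S (o, i) (o', i') * (tpow d n A o i * star (tpow d n A o' i')) = 1 := by
  intro n
  induction n with
  | zero =>
    intro S hS
    simp only [IsStoringComb] at hS
    subst hS
    simp [tpow]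
  | succ n ih =>
    rintro S ⟨B, -, hB, hS⟩
    -- The identity of the comb on its last output identifies a with a'; unitarity of the last
    -- example then identifies b with b'. What remains is the trace over the last input, a comb with
    -- one slot fewer.
    have hA' : ∀ b b', ∑ a, A a b * star (A a b') = if b = b' then 1 else 0 := by
      intro b b'
      have := congrFun (congrFun hA b') b
      rw [Matrix.mul_apply, Matrix.one_apply] at this
      simp only [Matrix.conjTranspose_apply] at this
      simp only [mul_comm (A _ b), this, eq_comm]
    rw [← ih hS, sum_pow_succ]
    refine Finset.sum_congr rfl fun o _ => ?_
    simp only [sum_pow_succ]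
    rw [Finset.sum_comm]
    refine Finset.sum_congr rfl fun o' _ => ?_
    have h1 : ∀ a a' i i' b b', S (Fin.snoc (α := fun _ => Fin d) o a,
        Fin.snoc (α := fun _ => Fin d) i b) (Fin.snoc (α := fun _ => Fin d) o' a',
        Fin.snoc (α := fun _ => Fin d) i' b') =
        if a = a' then B (o, Fin.snoc (α := fun _ => Fin d) i b)
          (o', Fin.snoc (α := fun _ => Fin d) i' b') else 0 := by
      intro a a' i i' b b'
      rw [hB]
      simp
    simp only [h1, tpow_snoc, ite_mul, zero_mul]
    calc _ = ∑ i : Pow d n, ∑ i' : Pow d n, ∑ b, ∑ b', ∑ a, ∑ a',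
          (if a = a' then B (o, Fin.snoc (α := fun _ => Fin d) i b)
            (o', Fin.snoc (α := fun _ => Fin d) i' b') *
            (tpow d n A o i * A a b * star (tpow d n A o' i' * A a' b')) else 0) := by
          exact sum_comm_six fun a a' i b i' b' =>
            (if a = a' then B (o, Fin.snoc (α := fun _ => Fin d) i b)
              (o', Fin.snoc (α := fun _ => Fin d) i' b') *
              (tpow d n A o i * A a b * star (tpow d n A o' i' * A a' b')) else 0)
      _ = ∑ i : Pow d n, ∑ i' : Pow d n, ∑ b, ∑ b',
          (B (o, Fin.snoc (α := fun _ => Fin d) i b)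
            (o', Fin.snoc (α := fun _ => Fin d) i' b') *
            (tpow d n A o i * star (tpow d n A o' i'))) * ∑ a, A a b * star (A a b') := by
          refine Finset.sum_congr rfl fun i _ => Finset.sum_congr rfl fun i' _ =>
            Finset.sum_congr rfl fun b _ => Finset.sum_congr rfl fun b' _ => ?_
          rw [Finset.mul_sum]
          refine Finset.sum_congr rfl fun a _ => ?_
          rw [Finset.sum_ite_eq, if_pos (Finset.mem_univ _), star_mul']
          ring
      _ = _ := by
          refine Finset.sum_congr rfl fun i _ => Finset.sum_congr rfl fun i' _ => ?_
          simp only [hA', mul_ite, mul_one, mul_zero, Finset.sum_ite_eq, Finset.mem_univ, if_true,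
            Matrix.of_apply, Finset.sum_mul]

/-- The combs of boards that use the examples in parallel. Peeling off the last slot leaves the
identity on the earlier outputs tensor the state, and tracing the last input leaves a comb of the
same form for the reduced state. -/
lemma isStoringComb_of_state : ∀ {n : ℕ} {ρ : Matrix (Pow d n) (Pow d n) ℂ}, IsState ρ →
    IsStoringComb d n (Matrix.of fun w w' => if w.1 = w'.1 then ρ w.2 w'.2 else 0) := by
  intro n
  induction n with
  | zero =>
    intro ρ hρ
    simp only [IsStoringComb]
    ext w w'
    have h1 := hρ.2
    have h2 : ∀ a b : Pow d 0, ρ a b = 1 := by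
      intro a b
      rw [← h1, Matrix.trace, Fintype.sum_eq_single b (fun c hc => absurd (Subsingleton.elim _ _) hc),
        Matrix.diag_apply, Subsingleton.elim a b]
    rw [Matrix.of_apply, if_pos (Subsingleton.elim _ _), h2, Subsingleton.elim w w',
      Matrix.one_apply_eq]
  | succ n ih =>
    intro ρ hρ
    refine ⟨(1 : Matrix (Pow d n) (Pow d n) ℂ) ⊗ₖ ρ, Matrix.PosSemidef.one.kronecker hρ.1, ?_, ?_⟩
    · intro o i o' i'
      have h1 : o = o' ↔ o (Fin.last n) = o' (Fin.last n) ∧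
          (fun k : Fin n => o k.castSucc) = fun k => o' k.castSucc := by
        refine ⟨fun h => by subst h; exact ⟨rfl, rfl⟩, fun h => ?_⟩
        funext k
        refine Fin.lastCases h.1 (fun k => congrFun h.2 k) k
      simp only [Matrix.of_apply, Matrix.kroneckerMap_apply, Matrix.one_apply, h1, ite_mul, one_mul,
        zero_mul, ite_and]
    · have h2 : IsState (Matrix.of fun i i' : Pow d n => ∑ a : Fin d,
          ρ (Fin.snoc (α := fun _ => Fin d) i a) (Fin.snoc (α := fun _ => Fin d) i' a)) := by
        refine ⟨?_, ?_⟩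
        · have h3 : (Matrix.of fun i i' : Pow d n => ∑ a : Fin d,
              ρ (Fin.snoc (α := fun _ => Fin d) i a) (Fin.snoc (α := fun _ => Fin d) i' a)) =
              ∑ a : Fin d, ρ.submatrix (fun i : Pow d n => Fin.snoc (α := fun _ => Fin d) i a)
                (fun i => Fin.snoc (α := fun _ => Fin d) i a) := by
            ext i i'
            rw [Matrix.sum_apply]; rfl
          rw [h3]
          exact Matrix.posSemidef_sum _ fun a _ => hρ.1.submatrix _
        · rw [← hρ.2, Matrix.trace, Matrix.trace, sum_pow_succ]
          rfl
      convert ih h2 using 1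
      ext w w'
      simp only [Matrix.of_apply, Matrix.kroneckerMap_apply, Matrix.one_apply, ite_mul, one_mul,
        zero_mul, Finset.sum_ite_irrel, Finset.sum_const_zero]

lemma sum_parallelBoard {N : ℕ} {r : Type*} [Fintype r] (φ : Pow d N × r → ℂ)
    (w w' : Pow d N × Pow d N) :
    ∑ a, parallelBoard φ (a, w) (a, w') =
      if w.1 = w'.1 then ∑ s, φ (w.2, s) * star (φ (w'.2, s)) else 0 := by
  simp only [parallelBoard, Matrix.of_apply, Fintype.sum_prod_type, ite_mul, zero_mul,
    apply_ite star, star_zero, mul_ite, mul_zero]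
  rw [Finset.sum_eq_single w.1]
  · simp only [if_true, Finset.sum_ite_irrel, Finset.sum_const_zero]
  · intro b _ hb
    simp [hb]
  · simp

lemma isStoringBoard_parallelBoard {N : ℕ} {r : Type*} [Fintype r] {φ : Pow d N × r → ℂ}
    (hφ : star φ ⬝ᵥ φ = 1) : IsStoringBoard (parallelBoard φ) := by
  refine ⟨Matrix.posSemidef_vecMulVec_self_star _, ?_⟩
  have h1 : IsState (Matrix.of fun i i' : Pow d N => ∑ s, φ (i, s) * star (φ (i', s))) := by
    refine ⟨?_, ?_⟩
    · have h2 : (Matrix.of fun i i' : Pow d N => ∑ s, φ (i, s) * star (φ (i', s))) =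
          (Matrix.of fun i s => φ (i, s)) * (Matrix.of fun i s => φ (i, s)).conjTranspose := by
        ext i i'
        rw [Matrix.mul_apply]; rfl
      rw [h2]
      exact Matrix.posSemidef_self_mul_conjTranspose _
    · rw [← hφ, Matrix.trace, dotProduct, Fintype.sum_prod_type]
      exact Finset.sum_congr rfl fun i _ => Finset.sum_congr rfl fun s _ => mul_comm _ _
  convert isStoringComb_of_state h1 using 1
  ext w w'
  simp only [Matrix.of_apply, sum_parallelBoard]

end Combs

/-! ### The stored states and the POVM -/

lemma star_dket_dotProduct {m n : Type*} [Fintype m] [Fintype n] (A B : Matrix m n ℂ) :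
    star (dket A) ⬝ᵥ dket B = (A.conjTranspose * B).trace := by
  rw [dotProduct, Fintype.sum_prod_type, Matrix.trace, Finset.sum_comm]
  rfl

lemma applyFst_dket {o i r : Type*} [Fintype i] (V : Matrix o i ℂ) (B : Matrix i r ℂ) :
    applyFst V (dket B) = dket (V * B) := rfl

lemma kronecker_mulVec_dket {m n : Type*} [Fintype m] [Fintype n] (A : Matrix m m ℂ)
    (B : Matrix n n ℂ) (X : Matrix m n ℂ) :
    (A ⊗ₖ B).mulVec (dket X) = dket (A * X * B.transpose) := by
  ext w
  simp only [Matrix.mulVec, dotProduct, dket, Matrix.kroneckerMap_apply, Matrix.mul_apply,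
    Matrix.transpose_apply, Fintype.sum_prod_type, Finset.sum_mul]
  rw [Finset.sum_comm]
  exact Finset.sum_congr rfl fun _ _ => Finset.sum_congr rfl fun _ _ => by ring

section States

variable {G : Type*} [Group G] {d N : ℕ} {U : G →* Matrix.unitaryGroup (Fin d) ℂ} (D : Irr U N)

/-- W_j† W_k intertwines inequivalent irreducibles, so it vanishes by Schur's lemma. The vectors
lifted from different j are therefore orthogonal. -/
lemma Irr.emb_orthogonal {j k : Fin D.num} (h : j ≠ k) :
    (D.emb j).conjTranspose * D.emb k = 0 := by
  by_contra h0
  refine D.not_equiv h.symm (equiv_of_intertwines (D.irreducible k) (D.irreducible j) h0 fun g => ?_)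
  have h1 := congrArg Matrix.conjTranspose (D.intertwines j g⁻¹)
  have h2 : (tpow d N (mat U g⁻¹)).conjTranspose = tpow d N (mat U g) := by
    rw [← mat_tpowRep, mat_inv, Matrix.conjTranspose_conjTranspose, mat_tpowRep]
  rw [Matrix.conjTranspose_mul, Matrix.conjTranspose_mul, h2, mat_inv,
    Matrix.conjTranspose_conjTranspose] at h1
  rw [← Matrix.mul_assoc, ← h1, Matrix.mul_assoc, D.intertwines, Matrix.mul_assoc]

lemma Irr.star_lift_dotProduct_self (j : Fin D.num) (X Y : Matrix (Fin (D.dim j)) (Fin (D.dim j)) ℂ) :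
    star (D.lift j X) ⬝ᵥ D.lift j Y = (X.conjTranspose * Y).trace := by
  rw [Irr.lift, Irr.lift, star_dket_dotProduct]
  simp only [Matrix.conjTranspose_mul, Matrix.conjTranspose_conjTranspose, Matrix.mul_assoc]
  rw [← Matrix.mul_assoc (D.emb j).conjTranspose, D.isometry, Matrix.one_mul,
    Matrix.trace_mul_comm]
  simp only [Matrix.mul_assoc]
  rw [D.isometry, Matrix.mul_one]

lemma Irr.star_lift_dotProduct_of_ne {j k : Fin D.num} (h : j ≠ k)
    (X : Matrix (Fin (D.dim j)) (Fin (D.dim j)) ℂ) (Y : Matrix (Fin (D.dim k)) (Fin (D.dim k)) ℂ) :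
    star (D.lift j X) ⬝ᵥ D.lift k Y = 0 := by
  rw [Irr.lift, Irr.lift, star_dket_dotProduct]
  simp only [Matrix.conjTranspose_mul, Matrix.conjTranspose_conjTranspose, Matrix.mul_assoc]
  rw [← Matrix.mul_assoc (D.emb j).conjTranspose, D.emb_orthogonal h, Matrix.zero_mul,
    Matrix.mul_zero, Matrix.mul_zero, Matrix.trace_zero]

lemma Irr.star_sum_lift_dotProduct (a b : Fin D.num → ℝ)
    (X Y : ∀ j, Matrix (Fin (D.dim j)) (Fin (D.dim j)) ℂ) :
    star (∑ j, (a j : ℂ) • D.lift j (X j)) ⬝ᵥ (∑ j, (b j : ℂ) • D.lift j (Y j)) =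
      ∑ j, ((a j * b j : ℝ) : ℂ) * ((X j).conjTranspose * Y j).trace := by
  simp only [star_sum, sum_dotProduct, dotProduct_sum, star_smul, smul_dotProduct, dotProduct_smul,
    smul_eq_mul, RCLike.star_def, Complex.conj_ofReal]
  refine Finset.sum_congr rfl fun j _ => ?_
  rw [Finset.sum_eq_single j]
  · rw [D.star_lift_dotProduct_self]
    push_cast; ring
  · intro k _ hk
    rw [D.star_lift_dotProduct_of_ne hk, mul_zero]
  · simp

lemma Irr.stored_eq (p : Fin D.num → ℝ) (g : G) :
    D.stored p g = ∑ j, (√(p j / D.dim j) : ℂ) • D.lift j (mat (D.irr j) g) := by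
  ext w
  simp only [Irr.stored, Irr.inputState, applyFst, Finset.sum_apply, Pi.smul_apply, smul_eq_mul,
    Finset.mul_sum]
  rw [Finset.sum_comm]
  refine Finset.sum_congr rfl fun j _ => ?_
  have h1 : D.lift j (mat (D.irr j) g) = applyFst (tpow d N (mat U g)) (D.lift j 1) := by
    rw [Irr.lift, Irr.lift, applyFst_dket, Matrix.mul_one, ← Matrix.mul_assoc, D.intertwines]
  rw [h1, applyFst, Finset.mul_sum]
  exact Finset.sum_congr rfl fun k _ => by ring

lemma Irr.star_inputState_dotProduct {p : Fin D.num → ℝ} (hp : p ∈ stdSimplex ℝ (Fin D.num)) :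
    star (D.inputState p) ⬝ᵥ D.inputState p = 1 := by
  rw [Irr.inputState, D.star_sum_lift_dotProduct, ← Complex.ofReal_one, ← hp.2, Complex.ofReal_sum]
  refine Finset.sum_congr rfl fun j _ => ?_
  have := D.dim_pos j
  rw [Real.mul_self_sqrt (div_nonneg (hp.1 j) (Nat.cast_nonneg _)), Matrix.mul_one,
    Matrix.conjTranspose_one, Matrix.trace_one, Fintype.card_fin]
  push_cast
  field_simp

lemma sqrt_div_mul_sqrt (p : ℝ) {n : ℕ} (hn : 0 < n) : √(p / n) * √n = √p := by
  have : (n : ℝ) ≠ 0 := by exact_mod_cast hn.ne'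
  rw [← Real.sqrt_mul' _ (Nat.cast_nonneg n), div_mul_cancel₀ _ this]

/-- The factors √d_j in η cancel the 1/√d_j in φ. The overlap is then a combination of characters at
g⁻¹h, which matches the vector in the general bound. -/
lemma Irr.star_stored_dotProduct_eta (p : Fin D.num → ℝ) (g h : G) :
    star (D.stored p g) ⬝ᵥ D.eta h = ∑ j, (√(p j) : ℂ) * (mat (D.irr j) (g⁻¹ * h)).trace := by
  rw [D.stored_eq, Irr.eta, D.star_sum_lift_dotProduct]
  refine Finset.sum_congr rfl fun j _ => ?_
  rw [sqrt_div_mul_sqrt _ (D.dim_pos j), mat_mul, mat_inv]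

lemma star_dotProduct_vecMulVec {n : Type*} [Fintype n] (v w : n → ℂ) :
    star v ⬝ᵥ (Matrix.vecMulVec w (star w)).mulVec v = (‖star v ⬝ᵥ w‖ ^ 2 : ℝ) := by
  have h1 : star w ⬝ᵥ v = star (star v ⬝ᵥ w) := Matrix.star_dotProduct w v
  rw [Matrix.vecMulVec_mulVec, dotProduct_smul, h1]
  simp only [MulOpposite.smul_eq_mul_unop, MulOpposite.unop_op]
  rw [RCLike.star_def, Complex.mul_conj, Complex.normSq_eq_norm_sq]

lemma Irr.stored_etaOp (p : Fin D.num → ℝ) (g h : G) :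
    (star (D.stored p g) ⬝ᵥ (D.etaOp h).mulVec (D.stored p g)).re =
      ‖∑ j, (√(p j) : ℂ) * (mat (D.irr j) (g⁻¹ * h)).trace‖ ^ 2 := by
  rw [Irr.etaOp, star_dotProduct_vecMulVec, D.star_stored_dotProduct_eta, Complex.ofReal_re]

lemma goal_eq (M : ℕ) (g h : G) :
    goal U M g h = (‖(mat U (g⁻¹ * h)).trace‖ / d) ^ (2 * M) := by
  rw [goal, mat_mul, mat_inv]

lemma Irr.proj_mul_proj : D.proj * D.proj = D.proj := by
  have h1 : ∀ j, D.emb j * (D.emb j).conjTranspose * (D.emb j * (D.emb j).conjTranspose) =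
      D.emb j * (D.emb j).conjTranspose := by
    intro j
    rw [Matrix.mul_assoc, ← Matrix.mul_assoc _ (D.emb j), D.isometry, Matrix.one_mul]
  rw [Irr.proj, Matrix.sum_mul]
  refine Finset.sum_congr rfl fun j _ => ?_
  rw [Matrix.mul_sum, Finset.sum_eq_single j]
  · rw [← Matrix.mul_kronecker_mul, ← Matrix.transpose_mul, h1]
  · intro k _ hk
    have h2 : D.emb j * (D.emb j).conjTranspose * (D.emb k * (D.emb k).conjTranspose) = 0 := by
      rw [Matrix.mul_assoc, ← Matrix.mul_assoc _ (D.emb k), D.emb_orthogonal hk.symm,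
        Matrix.zero_mul, Matrix.mul_zero]
    rw [← Matrix.mul_kronecker_mul, h2, Matrix.zero_kronecker]
  · simp

lemma Irr.conjTranspose_proj : D.proj.conjTranspose = D.proj := by
  rw [Irr.proj, Matrix.conjTranspose_sum]
  refine Finset.sum_congr rfl fun j _ => ?_
  rw [Matrix.conjTranspose_kronecker, Matrix.conjTranspose_mul, Matrix.conjTranspose_conjTranspose]
  congr 1
  ext a b
  simp [Matrix.mul_apply, mul_comm]

lemma Irr.posSemidef_one_sub_proj : (1 - D.proj).PosSemidef := by
  have h1 : 1 - D.proj = (1 - D.proj).conjTranspose * (1 - D.proj) := by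
    rw [Matrix.conjTranspose_sub, Matrix.conjTranspose_one, D.conjTranspose_proj, sub_mul, one_mul,
      mul_sub, mul_one, D.proj_mul_proj, sub_self, sub_zero]
  rw [h1]
  exact Matrix.posSemidef_conjTranspose_mul_self _

lemma Irr.proj_mulVec_lift (j : Fin D.num) (X : Matrix (Fin (D.dim j)) (Fin (D.dim j)) ℂ) :
    D.proj.mulVec (D.lift j X) = D.lift j X := by
  rw [Irr.proj, Matrix.sum_mulVec, Finset.sum_eq_single j]
  · rw [Irr.lift, kronecker_mulVec_dket, Matrix.transpose_transpose]
    congr 1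
    simp only [Matrix.mul_assoc]
    rw [← Matrix.mul_assoc _ (D.emb j) (X * _), D.isometry, Matrix.one_mul,
      ← Matrix.mul_assoc _ (D.emb j) ((D.emb j).conjTranspose), D.isometry, Matrix.one_mul]
  · intro k _ hk
    rw [Irr.lift, kronecker_mulVec_dket, Matrix.transpose_transpose]
    simp only [Matrix.mul_assoc]
    rw [← Matrix.mul_assoc _ (D.emb j) (X * _), D.emb_orthogonal hk, Matrix.zero_mul,
      Matrix.mul_zero]
    rfl
  · simp

lemma Irr.proj_mulVec_stored (p : Fin D.num → ℝ) (g : G) :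
    D.proj.mulVec (D.stored p g) = D.stored p g := by
  rw [D.stored_eq, Matrix.mulVec_sum]
  exact Finset.sum_congr rfl fun j _ => by rw [Matrix.mulVec_smul, D.proj_mulVec_lift]

lemma Irr.lift_apply (j : Fin D.num) (X : Matrix (Fin (D.dim j)) (Fin (D.dim j)) ℂ)
    (w : Pow d N × Pow d N) :
    D.lift j X w = ∑ t, ∑ t', (D.emb j w.1 t * star (D.emb j w.2 t')) * X t t' := by
  rw [Irr.lift, dket, Matrix.mul_apply, Finset.sum_comm]
  refine Finset.sum_congr rfl fun t' _ => ?_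
  rw [Matrix.mul_apply, Finset.sum_mul]
  exact Finset.sum_congr rfl fun t _ => by rw [Matrix.conjTranspose_apply]; ring

lemma Irr.sum_lift_apply (a : Fin D.num → ℂ) (g : G) (w : Pow d N × Pow d N) :
    (∑ j, a j • D.lift j (mat (D.irr j) g)) w =
      ∑ j, ∑ t, ∑ t', (a j * (D.emb j w.1 t * star (D.emb j w.2 t'))) * mat (D.irr j) g t t' := by
  simp only [Finset.sum_apply, Pi.smul_apply, smul_eq_mul, D.lift_apply, Finset.mul_sum, mul_assoc]

/-! ### Averages over the group: the resolution of the identity, the mean goal function, the weights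
-/

variable [TopologicalSpace G]

lemma Irr.continuous_eta (hU : ContMat U) : Continuous D.eta := by
  refine continuous_pi fun w => ?_
  have : (fun g => D.eta g w) = fun g => ∑ j, ∑ t, ∑ t',
      ((√(D.dim j) : ℂ) * (D.emb j w.1 t * star (D.emb j w.2 t'))) * mat (D.irr j) g t t' := by
    funext g
    rw [Irr.eta, D.sum_lift_apply]
  rw [this]
  exact continuous_finsetSum _ fun j _ => continuous_finsetSum _ fun t _ =>
    continuous_finsetSum _ fun t' _ => continuous_const.mul (D.contMat hU j t t')

lemma Irr.continuous_etaOp (hU : ContMat U) (a b : Pow d N × Pow d N) :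
    Continuous fun h => D.etaOp h a b :=
  ((continuous_apply a).comp (D.continuous_eta hU)).mul
    ((continuous_apply b).comp (D.continuous_eta hU)).star

variable [IsTopologicalGroup G] [CompactSpace G] [MeasurableSpace G]
  [BorelSpace G] (ν : Measure G) [ν.IsHaarMeasure]

lemma Irr.integrable_povm (hU : ContMat U) (a b : Pow d N × Pow d N) :
    Integrable (fun h => D.povm h a b) ν :=
  integrable_of_continuous ν ((D.continuous_etaOp hU a b).add continuous_const)

variable [IsProbabilityMeasure ν]

/-- The normalization √d_j is chosen so that d_j cancels the factor 1/d_j of Schur orthogonality;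
cross terms between different j vanish. -/
lemma Irr.integral_etaOp (hU : ContMat U) (a b : Pow d N × Pow d N) :
    ∫ h, D.etaOp h a b ∂ν = D.proj a b := by
  let c : ∀ j, Fin (D.dim j) → Fin (D.dim j) → Pow d N × Pow d N → ℂ := fun j t t' w =>
    (√(D.dim j) : ℂ) * (D.emb j w.1 t * star (D.emb j w.2 t'))
  have h1 : ∀ h w, D.eta h w = ∑ j, ∑ t, ∑ t', c j t t' w * mat (D.irr j) h t t' := fun h w => by
    rw [Irr.eta, D.sum_lift_apply]
  have h2 : ∀ h, D.etaOp h a b = ∑ k, ∑ s, ∑ s', star (c k s s' b) *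
      ((∑ j, ∑ t, ∑ t', c j t t' a * mat (D.irr j) h t t') * star (mat (D.irr k) h s s')) := by
    intro h
    rw [Irr.etaOp, Matrix.vecMulVec_apply, Pi.star_apply, ← h1 h a, h1 h b]
    simp only [star_sum, star_mul', Finset.mul_sum]
    refine Finset.sum_congr rfl fun _ _ => Finset.sum_congr rfl fun _ _ =>
      Finset.sum_congr rfl fun _ _ => ?_
    ring
  have hc : ∀ k s s', Continuous fun h => star (c k s s' b) *
      ((∑ j, ∑ t, ∑ t', c j t t' a * mat (D.irr j) h t t') * star (mat (D.irr k) h s s')) := by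
    intro k s s'
    refine continuous_const.mul (Continuous.mul ?_ (D.contMat hU k s s').star)
    exact continuous_finsetSum _ fun j _ => continuous_finsetSum _ fun t _ =>
      continuous_finsetSum _ fun t' _ => continuous_const.mul (D.contMat hU j t t')
  simp only [h2]
  rw [integral_sum_of_continuous ν fun k => continuous_finsetSum _ fun s _ =>
    continuous_finsetSum _ fun s' _ => hc k s s', Irr.proj, Matrix.sum_apply]
  refine Finset.sum_congr rfl fun k _ => ?_
  rw [integral_sum_of_continuous ν fun s => continuous_finsetSum _ fun s' _ => hc k s s',
    Matrix.kroneckerMap_apply, Matrix.transpose_apply, Matrix.mul_apply, Matrix.mul_apply,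
    Finset.sum_mul_sum]
  refine Finset.sum_congr rfl fun s _ => ?_
  rw [integral_sum_of_continuous ν fun s' => hc k s s']
  refine Finset.sum_congr rfl fun s' _ => ?_
  rw [integral_const_mul, D.integral_sum_mul_star ν hU fun j t t' => c j t t' a]
  have h3 : ((√(D.dim k) : ℝ) : ℂ) * ((√(D.dim k) : ℝ) : ℂ) = D.dim k := by
    rw [← Complex.ofReal_mul, Real.mul_self_sqrt (Nat.cast_nonneg _), Complex.ofReal_natCast]
  have h4 : (D.dim k : ℂ) ≠ 0 := by exact_mod_cast (D.dim_pos k).ne'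
  simp only [c, star_mul', RCLike.star_def, Complex.conj_ofReal, Complex.conj_conj,
    Matrix.conjTranspose_apply]
  calc _ = (((√(D.dim k) : ℝ) : ℂ) * ((√(D.dim k) : ℝ) : ℂ)) * (D.dim k : ℂ)⁻¹ *
        (D.emb k a.1 s * (starRingEnd ℂ) (D.emb k b.1 s) *
          (D.emb k b.2 s' * (starRingEnd ℂ) (D.emb k a.2 s'))) := by ring
    _ = _ := by rw [h3, mul_inv_cancel₀ h4, one_mul]

theorem Irr.isPOVM (hU : ContMat U) : IsPOVM ν D.povm := by
  refine ⟨fun h => (Matrix.posSemidef_vecMulVec_self_star _).add D.posSemidef_one_sub_proj,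
    D.integrable_povm ν hU, fun a b => ?_⟩
  have h1 : ∫ h, D.povm h a b ∂ν = ∫ h, (D.etaOp h a b + (1 - D.proj) a b) ∂ν := rfl
  rw [h1, integral_add (integrable_of_continuous ν (D.continuous_etaOp hU a b))
    (integrable_const _), D.integral_etaOp ν hU, integral_const, probReal_univ, one_smul,
    Matrix.sub_apply]
  ring

/-- The mean of the goal function in terms of the characters. -/
lemma Irr.meanGoal_eq (M : ℕ) (p : Fin D.num → ℝ) :
    D.meanGoal ν M p = ∫ h, (‖(mat U h).trace‖ / d) ^ (2 * M) *
      ‖∑ j, (√(p j) : ℂ) * (mat (D.irr j) h).trace‖ ^ 2 ∂ν := by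
  rw [Irr.meanGoal]
  simp only [D.stored_etaOp, goal_eq]
  -- The integrand depends on g⁻¹h alone, so left invariance makes the inner integral independent of
  -- g.
  have h1 : ∀ g, ∫ h, (‖(mat U (g⁻¹ * h)).trace‖ / d) ^ (2 * M) *
      ‖∑ j, (√(p j) : ℂ) * (mat (D.irr j) (g⁻¹ * h)).trace‖ ^ 2 ∂ν =
      ∫ h, (‖(mat U h).trace‖ / d) ^ (2 * M) *
        ‖∑ j, (√(p j) : ℂ) * (mat (D.irr j) h).trace‖ ^ 2 ∂ν := fun g =>
    integral_mul_left_eq_self (fun h => (‖(mat U h).trace‖ / d) ^ (2 * M) *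
      ‖∑ j, (√(p j) : ℂ) * (mat (D.irr j) h).trace‖ ^ 2) g⁻¹
  simp only [h1, integral_const, probReal_univ, one_smul]

/-- The mean is a finite combination of the products √p_j √p_k with coefficients independent of p.
Continuity on the compact simplex then yields a maximizer. -/
lemma Irr.continuous_meanGoal (hU : ContMat U) (M : ℕ) : Continuous (D.meanGoal ν M) := by
  let F : Fin D.num → Fin D.num → G → ℝ := fun j k h => (‖(mat U h).trace‖ / d) ^ (2 * M) *
    ((mat (D.irr j) h).trace * star (mat (D.irr k) h).trace).re
  have hF : ∀ j k, Continuous (F j k) := fun j k =>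
    ((hU.trace.norm.div_const _).pow _).mul (Complex.continuous_re.comp
      ((D.contMat hU j).trace.mul (D.contMat hU k).trace.star))
  have h1 : ∀ p, D.meanGoal ν M p = ∑ j, ∑ k, √(p j) * √(p k) * ∫ h, F j k h ∂ν := by
    intro p
    rw [D.meanGoal_eq]
    have h2 : ∀ h, (‖(mat U h).trace‖ / d) ^ (2 * M) *
        ‖∑ j, (√(p j) : ℂ) * (mat (D.irr j) h).trace‖ ^ 2 =
        ∑ j, ∑ k, √(p j) * √(p k) * F j k h := by
      intro h
      rw [← Complex.normSq_eq_norm_sq, ← Complex.ofReal_re (Complex.normSq _), ← Complex.mul_conj,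
        map_sum, Finset.sum_mul_sum, Complex.re_sum, Finset.mul_sum]
      refine Finset.sum_congr rfl fun j _ => ?_
      rw [Complex.re_sum, Finset.mul_sum]
      refine Finset.sum_congr rfl fun k _ => ?_
      rw [map_mul, Complex.conj_ofReal, mul_mul_mul_comm, ← Complex.ofReal_mul,
        Complex.re_ofReal_mul]
      simp only [F, RCLike.star_def]
      ring
    have hc : ∀ j k, Continuous fun h => √(p j) * √(p k) * F j k h := fun j k =>
      continuous_const.mul (hF j k)
    simp only [h2]
    rw [integral_sum_of_continuous ν fun j => continuous_finsetSum _ fun k _ => hc j k]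
    refine Finset.sum_congr rfl fun j _ => ?_
    rw [integral_sum_of_continuous ν fun k => hc j k]
    exact Finset.sum_congr rfl fun k _ => integral_const_mul _ _
  rw [funext h1]
  fun_prop

lemma Irr.exists_isMaxOn (hd : 0 < d) (hU : ContMat U) (M : ℕ) :
    ∃ p ∈ stdSimplex ℝ (Fin D.num), IsMaxOn (D.meanGoal ν M) (stdSimplex ℝ (Fin D.num)) p := by
  refine (isCompact_stdSimplex ℝ _).exists_isMaxOn ?_ (D.continuous_meanGoal ν hU M).continuousOn
  exact ⟨_, single_mem_stdSimplex ℝ ⟨0, D.num_pos hd⟩⟩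

/-- The weights of the comb of a storing board form a probability distribution. -/
lemma Irr.weight_mem_stdSimplex (hU : ContMat U) {x : Type*} [Fintype x] [DecidableEq x]
    [Nonempty x] {L : Matrix ((x × x) × (Pow d N × Pow d N)) ((x × x) × (Pow d N × Pow d N)) ℂ}
    {S : Matrix (Pow d N × Pow d N) (Pow d N × Pow d N) ℂ} (h : TraceOut L S)
    (hL : L.PosSemidef) (hS : IsStoringComb d N S) :
    D.weight ν S ∈ stdSimplex ℝ (Fin D.num) := by
  refine ⟨D.weight_nonneg ν h hL, ?_⟩
  rw [D.sum_weight ν hU]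
  -- A storing comb is normalized on each unitary example separately, so the total weight is the
  -- integral of the constant 1.
  have h1 : ∀ g, star (dket (tpow d N (mat U g))) ⬝ᵥ
      S.transpose.mulVec (dket (tpow d N (mat U g))) = 1 := by
    intro g
    rw [← hS.sum_eq_one (conjTranspose_mat_mul U g)]
    simp only [dotProduct, Matrix.mulVec, Matrix.transpose_apply, Finset.mul_sum, dket,
      Fintype.sum_prod_type, Pi.star_apply]
    calc _ = ∑ o', ∑ o, ∑ i', ∑ i, S (o, i) (o', i') *
          (tpow d N (mat U g) o i * star (tpow d N (mat U g) o' i')) := by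
          refine Finset.sum_congr rfl fun o' _ => ?_
          rw [Finset.sum_comm]
          refine Finset.sum_congr rfl fun o _ => Finset.sum_congr rfl fun i' _ =>
            Finset.sum_congr rfl fun i _ => ?_
          ring
      _ = _ := by
          rw [Finset.sum_comm]
          exact Finset.sum_congr rfl fun o _ => Finset.sum_congr rfl fun o' _ => Finset.sum_comm
  simp [h1]

/-- Contracting the coefficients of U^{⊗N} with φ gives the j-th Fourier coefficients of the stored
state, which are those of √(p_j/d_j) W_j U_j W_j†. Their squared norms add up to d_j² · p_j/d_j, and
the weight divides this by d_j. -/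
lemma Irr.weight_parallelBoard (hU : ContMat U) {p : Fin D.num → ℝ}
    (hp : p ∈ stdSimplex ℝ (Fin D.num)) (j : Fin D.num) :
    D.weight ν (Matrix.of fun w w' => ∑ a, parallelBoard (D.inputState p) (a, w) (a, w')) j =
      p j := by
  have hd : (D.dim j : ℂ) ≠ 0 := by exact_mod_cast (D.dim_pos j).ne'
  have h1 : ∀ t t' o r, ∑ i, D.coef ν j (o, i) t t' * D.inputState p (i, r) =
      √(p j / D.dim j) * (D.emb j o t * star (D.emb j r t')) := by
    intro t t' o r
    have h2 : ∀ g, (∑ i, tpow d N (mat U g) o i * D.inputState p (i, r)) =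
        ∑ k, ∑ s, ∑ s', ((√(p k / D.dim k) : ℂ) * (D.emb k o s * star (D.emb k r s'))) *
          mat (D.irr k) g s s' := by
      intro g
      rw [← D.sum_lift_apply _ g (o, r), ← D.stored_eq]
      rfl
    have h3 := D.integral_sum_mul_star ν hU
      (fun k s s' => (√(p k / D.dim k) : ℂ) * (D.emb k o s * star (D.emb k r s'))) j t t'
    simp only [← h2, Finset.sum_mul] at h3
    have hc : ∀ i, Continuous fun g =>
        tpow d N (mat U g) o i * D.inputState p (i, r) * star (mat (D.irr j) g t t') := fun i =>
      ((hU.tpowRep N o i).mul continuous_const).mul (D.contMat hU j t t').star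
    rw [integral_sum_of_continuous ν hc] at h3
    rw [eq_mul_inv_iff_mul_eq₀ hd] at h3
    rw [← h3, Finset.sum_mul]
    refine Finset.sum_congr rfl fun i _ => ?_
    have h4 : ∀ g, tpow d N (mat U g) o i * D.inputState p (i, r) * star (mat (D.irr j) g t t') =
        D.inputState p (i, r) * (tpow d N (mat U g) o i * star (mat (D.irr j) g t t')) :=
      fun g => by ring
    simp only [h4]
    rw [integral_const_mul, Irr.coef]
    ring
  have h5 : ((D.coefMat ν j).conjTranspose *
      (Matrix.of fun w w' => ∑ a, parallelBoard (D.inputState p) (a, w) (a, w')) *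
      D.coefMat ν j).trace = (p j * D.dim j : ℝ) := by
    have h6 : ∀ v, ((D.coefMat ν j).conjTranspose *
        (Matrix.of fun w w' => ∑ a, parallelBoard (D.inputState p) (a, w) (a, w')) *
        D.coefMat ν j) v v = ∑ o, ∑ r,
          (∑ i, D.coef ν j (o, i) v.1 v.2 * D.inputState p (i, r)) *
          star (∑ i, D.coef ν j (o, i) v.1 v.2 * D.inputState p (i, r)) := by
      intro v
      simp only [sum_parallelBoard]
      rw [Matrix.mul_apply, Fintype.sum_prod_type]
      refine Finset.sum_congr rfl fun o _ => ?_
      have h7 : ∀ i', ((D.coefMat ν j).conjTranspose * (Matrix.of fun w w' : Pow d N × Pow d N =>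
          if w.1 = w'.1 then ∑ s, D.inputState p (w.2, s) * star (D.inputState p (w'.2, s))
          else 0)) v (o, i') = ∑ i, D.coef ν j (o, i) v.1 v.2 *
            ∑ s, D.inputState p (i, s) * star (D.inputState p (i', s)) := by
        intro i'
        rw [Matrix.mul_apply, Fintype.sum_prod_type, Finset.sum_eq_single o]
        · simp [Irr.coefMat]
        · intro b _ hb
          simp [hb]
        · simp
      simp only [h7, star_sum, Finset.mul_sum, Finset.sum_mul]
      conv_rhs => rw [Finset.sum_comm]
      refine Finset.sum_congr rfl fun i _ => ?_
      conv_rhs => rw [Finset.sum_comm]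
      refine Finset.sum_congr rfl fun i' _ => Finset.sum_congr rfl fun r _ => ?_
      simp only [Irr.coefMat, Matrix.of_apply, star_mul']
      ring
    have h8 : ∀ t, ∑ o, D.emb j o t * star (D.emb j o t) = 1 := by
      intro t
      have := congrFun (congrFun (D.isometry j) t) t
      rw [Matrix.mul_apply, Matrix.one_apply_eq] at this
      rw [← this]
      exact Finset.sum_congr rfl fun _ _ => mul_comm _ _
    have h9 : ((√(p j / D.dim j) : ℝ) : ℂ) * ((√(p j / D.dim j) : ℝ) : ℂ) = p j / D.dim j := by
      rw [← Complex.ofReal_mul, Real.mul_self_sqrt (div_nonneg (hp.1 j) (Nat.cast_nonneg _))]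
      push_cast; rfl
    have h10 : ∀ t t', ∑ o, ∑ r, ((√(p j / D.dim j) : ℝ) : ℂ) *
        (D.emb j o t * star (D.emb j r t')) * star (((√(p j / D.dim j) : ℝ) : ℂ) *
          (D.emb j o t * star (D.emb j r t'))) = p j / D.dim j := by
      intro t t'
      calc _ = (((√(p j / D.dim j) : ℝ) : ℂ) * ((√(p j / D.dim j) : ℝ) : ℂ)) *
            ((∑ o, D.emb j o t * star (D.emb j o t)) *
              ∑ r, D.emb j r t' * star (D.emb j r t')) := by
            rw [Finset.sum_mul_sum, Finset.mul_sum]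
            refine Finset.sum_congr rfl fun o _ => ?_
            rw [Finset.mul_sum]
            refine Finset.sum_congr rfl fun r _ => ?_
            simp only [star_mul', RCLike.star_def, Complex.conj_ofReal, Complex.conj_conj]
            ring
        _ = _ := by rw [h8, h8, h9]; ring
    rw [Matrix.trace]
    simp only [Matrix.diag_apply, h6, h1, h10]
    rw [Finset.sum_const, Finset.card_univ, Fintype.card_prod, Fintype.card_fin, nsmul_eq_mul]
    push_cast
    field_simp
  rw [Irr.weight, h5, Complex.ofReal_re]
  have : (D.dim j : ℝ) ≠ 0 := by exact_mod_cast (D.dim_pos j).ne'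
  field_simp

end States

/-! ### Positivity of integrals and of link products -/

section Positivity

lemma posSemidef_integral {X κ : Type*} [Fintype κ] [MeasurableSpace X] {μ : Measure X}
    {A : X → Matrix κ κ ℂ} (hA : ∀ h, (A h).PosSemidef)
    (hint : ∀ a b, Integrable (fun h => A h a b) μ) :
    (Matrix.of fun a b => ∫ h, A h a b ∂μ).PosSemidef := by
  refine Matrix.PosSemidef.of_dotProduct_mulVec_nonneg ?_ fun v => ?_
  · ext a b
    rw [Matrix.conjTranspose_apply, Matrix.of_apply, Matrix.of_apply, RCLike.star_def,
      ← integral_conj]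
    refine integral_congr_ae (Filter.Eventually.of_forall fun h => ?_)
    exact congrFun (congrFun (hA h).1 a) b
  · have h1 : star v ⬝ᵥ (Matrix.of fun a b => ∫ h, A h a b ∂μ).mulVec v =
        ∫ h, star v ⬝ᵥ (A h).mulVec v ∂μ := by
      simp only [dotProduct, Matrix.mulVec, Matrix.of_apply]
      rw [integral_finsetSum _ fun a _ => (integrable_finsetSum _ fun b _ =>
        (hint a b).mul_const _).const_mul _]
      refine Finset.sum_congr rfl fun a _ => ?_
      rw [integral_const_mul, integral_finsetSum _ fun b _ => (hint a b).mul_const _]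
      congr 1
      exact Finset.sum_congr rfl fun b _ => (integral_mul_const _ _).symm
    have h2 : ∀ h, star v ⬝ᵥ (A h).mulVec v = ((star v ⬝ᵥ (A h).mulVec v).re : ℂ) := fun h =>
      Complex.eq_re_of_ofReal_le (r := 0) (by simpa using (hA h).dotProduct_mulVec_nonneg v)
    rw [h1, integral_congr_ae (Filter.Eventually.of_forall h2), integral_complex_ofReal]
    exact Complex.zero_le_real.mpr (integral_nonneg fun h =>
      (Complex.nonneg_iff.mp ((hA h).dotProduct_mulVec_nonneg v)).1)

/-- The double sum is the compression by the unnormalized vector ∑_a |a⟩. Applied to R ⊗ S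
restricted to equal memory indices, it gives positivity of link products. -/
lemma posSemidef_sum_sum {m κ : Type*} [Fintype m] [Fintype κ] [DecidableEq κ]
    {A : Matrix (m × κ) (m × κ) ℂ} (hA : A.PosSemidef) :
    (Matrix.of fun v v' => ∑ a, ∑ a', A (a, v) (a', v')).PosSemidef := by
  let B : Matrix (m × κ) κ ℂ := Matrix.of fun k v => if k.2 = v then 1 else 0
  have h1 : (Matrix.of fun v v' => ∑ a, ∑ a', A (a, v) (a', v')) = B.conjTranspose * A * B := by
    ext v v'
    rw [Matrix.of_apply, Matrix.mul_apply, Fintype.sum_prod_type, Finset.sum_comm]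
    refine Finset.sum_congr rfl fun a' _ => ?_
    rw [Finset.sum_eq_single v']
    · rw [Matrix.mul_apply, Fintype.sum_prod_type, Finset.sum_mul]
      refine Finset.sum_congr rfl fun a _ => ?_
      rw [Finset.sum_eq_single v]
      · simp [B]
      · intro b _ hb; simp [B, hb]
      · simp
    · intro b _ hb; simp [B, hb]
    · simp
  rw [h1]
  exact hA.conjTranspose_mul_mul_same B

lemma posSemidef_link {x w m : Type*} [Fintype x] [DecidableEq x] [Fintype w] [DecidableEq w]
    [Fintype m] {R : Matrix (x × m) (x × m) ℂ} {S : Matrix (m × w) (m × w) ℂ}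
    (hR : R.PosSemidef) (hS : S.PosSemidef) : (link R S).PosSemidef := by
  have h := posSemidef_sum_sum ((hR.kronecker hS).submatrix
    fun k : m × (x × w) => ((k.2.1, k.1), (k.1, k.2.2)))
  simp only [Matrix.submatrix_apply, Matrix.kronecker_apply] at h
  exact h

/-- Tracing the final output of the retrieving channel leaves the identity on the memory, which
closes the memory of the board into a partial trace. -/
lemma TraceOut.link {x w m : Type*} [Fintype x] [DecidableEq x] [Fintype m] [DecidableEq m]
    {R : Matrix ((x × x) × m) ((x × x) × m) ℂ} (hR : TraceOut R 1)
    (S : Matrix (m × w) (m × w) ℂ) :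
    TraceOut (QLearn.link R S) (Matrix.of fun v v' => ∑ a, S (a, v) (a, v')) := by
  intro y v y' v'
  simp only [QLearn.link, Matrix.of_apply]
  rw [Finset.sum_comm]
  simp_rw [Finset.sum_comm (s := Finset.univ (α := x)), ← Finset.sum_mul, hR y _ y' _]
  split_ifs with h
  · simp [Matrix.one_apply]
  · simp

lemma isRetrieving_iff {d M : ℕ} {m : Type*} [Fintype m] [DecidableEq m]
    {R : Matrix ((Pow d M × Pow d M) × m) ((Pow d M × Pow d M) × m) ℂ} :
    IsRetrieving R ↔ R.PosSemidef ∧ TraceOut R 1 := by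
  simp only [IsRetrieving, TraceOut, Matrix.one_apply, ite_and]

lemma isLearningComb_link {d N M : ℕ} {m : Type*} [Fintype m] [DecidableEq m]
    {R : Matrix ((Pow d M × Pow d M) × m) ((Pow d M × Pow d M) × m) ℂ}
    {S : Matrix (m × (Pow d N × Pow d N)) (m × (Pow d N × Pow d N)) ℂ}
    (hR : IsRetrieving R) (hS : IsStoringBoard S) : IsLearningComb (link R S) := by
  rw [isRetrieving_iff] at hR
  exact ⟨posSemidef_link hR.1 hS.1, _, hS.2, hR.2.link S⟩

lemma plug_link {x o i m : Type*} [Fintype o] [Fintype i] [Fintype m]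
    (R : Matrix (x × m) (x × m) ℂ) (S : Matrix (m × (o × i)) (m × (o × i)) ℂ) (V : Matrix o i ℂ)
    (u u' : x) :
    plug (link R S) V u u' = ∑ a, ∑ a', R (u, a) (u', a') * plug S V a a' := by
  simp only [plug, link, Matrix.of_apply, Finset.sum_mul, Finset.mul_sum]
  calc _ = ∑ w, ∑ a, ∑ w', ∑ a', R (u, a) (u', a') * S (a, w) (a', w') *
        (dket V w * star (dket V w')) := Finset.sum_congr rfl fun w _ => Finset.sum_comm
    _ = ∑ a, ∑ w, ∑ a', ∑ w', R (u, a) (u', a') * S (a, w) (a', w') *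
        (dket V w * star (dket V w')) := by
        rw [Finset.sum_comm]
        exact Finset.sum_congr rfl fun a _ => Finset.sum_congr rfl fun w _ => Finset.sum_comm
    _ = _ := by
        refine Finset.sum_congr rfl fun a _ => ?_
        rw [Finset.sum_comm]
        refine Finset.sum_congr rfl fun a' _ => Finset.sum_congr rfl fun w _ =>
          Finset.sum_congr rfl fun w' _ => by ring

end Positivity

/-! ### Measure-and-rotate channels -/

section Rotate

variable {G : Type*} [Group G] [MeasurableSpace G]

/-- The channel that measures `P dμ` on the memory and, on outcome `h`, applies `W_h`. -/
def rotateOp {x m : Type*} (W : G → Matrix x x ℂ) (μ : Measure G) (P : G → Matrix m m ℂ) :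
    Matrix ((x × x) × m) ((x × x) × m) ℂ :=
  Matrix.of fun u u' => ∫ h, dket (W h) u.1 * star (dket (W h) u'.1) * P h u'.2 u.2 ∂μ

lemma measureRotate_eq {d : ℕ} {m : Type*} (U : G →* Matrix.unitaryGroup (Fin d) ℂ) (M : ℕ)
    (μ : Measure G) (P : G → Matrix m m ℂ) :
    measureRotate U M μ P = rotateOp (fun h => mat (tpowRep U M) h) μ P := rfl

variable [TopologicalSpace G] [CompactSpace G] [BorelSpace G]

/-- The density is only integrable; the matrix elements of `W` are bounded, being continuous on a
compact group. -/
lemma integrable_rotate {x m : Type*} [Fintype x] [DecidableEq x] [Fintype m] [DecidableEq m]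
    {W : G →* Matrix.unitaryGroup x ℂ} (hW : ContMat W) {μ : Measure G} {P : G → Matrix m m ℂ}
    (hP : ∀ a b, Integrable (fun h => P h a b) μ) (u u' : x × x) (a a' : m) :
    Integrable (fun h => dket (mat W h) u * star (dket (mat W h) u') * P h a' a) μ := by
  have hc : Continuous fun h => dket (mat W h) u * star (dket (mat W h) u') :=
    hW.mul_star hW _ _ _ _
  obtain ⟨C, hC⟩ := isCompact_univ.exists_bound_of_continuousOn hc.continuousOn
  exact (hP a' a).bdd_mul hc.aestronglyMeasurable
    (Filter.Eventually.of_forall fun h => hC h (Set.mem_univ h))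

lemma posSemidef_rotateOp {x m : Type*} [Fintype x] [DecidableEq x] [Fintype m] [DecidableEq m]
    {W : G →* Matrix.unitaryGroup x ℂ} (hW : ContMat W) {μ : Measure G} {P : G → Matrix m m ℂ}
    (hP : IsPOVM μ P) : (rotateOp (fun h => mat W h) μ P).PosSemidef := by
  refine posSemidef_integral (A := fun h => Matrix.vecMulVec (dket (mat W h))
    (star (dket (mat W h))) ⊗ₖ (P h).transpose) (fun h => ?_)
    (fun u u' => integrable_rotate hW hP.2.1 u.1 u'.1 u.2 u'.2)
  exact (Matrix.posSemidef_vecMulVec_self_star _).kronecker (hP.1 h).transpose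

lemma traceOut_rotateOp {x m : Type*} [Fintype x] [DecidableEq x] [Fintype m] [DecidableEq m]
    {W : G →* Matrix.unitaryGroup x ℂ} (hW : ContMat W) {μ : Measure G} {P : G → Matrix m m ℂ}
    (hP : IsPOVM μ P) : TraceOut (rotateOp (fun h => mat W h) μ P) 1 := by
  intro y a y' a'
  simp only [rotateOp, Matrix.of_apply]
  rw [← integral_finsetSum _ fun x₁ _ => integrable_rotate hW hP.2.1 (x₁, y) (x₁, y') a a']
  simp only [← Finset.sum_mul, dket, mat_apply_mul_star]
  split_ifs
  · simp only [one_mul]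
    rw [hP.2.2, Matrix.one_apply, Matrix.one_apply]
    simp only [eq_comm]
  · simp

/-- The channel fidelity of a measure-and-rotate strategy. -/
lemma chFid_rotate {x m o i : Type*} [Fintype x] [DecidableEq x] [Fintype m] [DecidableEq m]
    [Fintype o] [Fintype i] {W : G →* Matrix.unitaryGroup x ℂ} (hW : ContMat W) {μ : Measure G}
    {P : G → Matrix m m ℂ} (hP : ∀ a b, Integrable (fun h => P h a b) μ)
    (S : Matrix (m × (o × i)) (m × (o × i)) ℂ) (V : Matrix o i ℂ) (g : G) :
    chFid (plug (link (rotateOp (fun h => mat W h) μ P) S) V) (mat W g) =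
      ∫ h, (‖(mat W (g⁻¹ * h)).trace‖ / Fintype.card x) ^ 2 * (P h * plug S V).trace.re ∂μ := by
  set ρ := plug S V with hρ
  set f := dket (mat W g) with hf
  have hint := fun u u' a a' => (integrable_rotate hW hP u u' a a').mul_const
    (star (f u) * f u' * ρ a a')
  -- Given outcome h, the overlap of |W_g⟩⟩ with |W_h⟩⟩ is the character at g⁻¹h, and the outcome
  -- has density Tr(P_h ρ).
  have h1 : ∀ h, ((‖(mat W (g⁻¹ * h)).trace‖ ^ 2 : ℝ) : ℂ) * (P h * ρ).trace =
      ∑ u, ∑ u', ∑ a, ∑ a', dket (mat W h) u * star (dket (mat W h) u') * P h a' a *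
        (star (f u) * f u' * ρ a a') := by
    intro h
    have h2 : (mat W (g⁻¹ * h)).trace = ∑ u, star (f u) * dket (mat W h) u := by
      rw [mat_mul, mat_inv, ← star_dket_dotProduct]; rfl
    rw [← Complex.normSq_eq_norm_sq, ← Complex.mul_conj, ← RCLike.star_def, h2, star_sum,
      Finset.sum_mul_sum, Finset.sum_mul]
    refine Finset.sum_congr rfl fun u _ => ?_
    rw [Finset.sum_mul]
    refine Finset.sum_congr rfl fun u' _ => ?_
    rw [Matrix.trace, Finset.sum_comm, Finset.mul_sum]
    refine Finset.sum_congr rfl fun a' _ => ?_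
    rw [Matrix.diag_apply, Matrix.mul_apply, Finset.mul_sum]
    refine Finset.sum_congr rfl fun a _ => ?_
    rw [star_mul', star_star]
    ring
  have h3 : star f ⬝ᵥ (plug (link (rotateOp (fun h => mat W h) μ P) S) V).mulVec f =
      ∫ h, ((‖(mat W (g⁻¹ * h)).trace‖ ^ 2 : ℝ) : ℂ) * (P h * ρ).trace ∂μ := by
    simp only [h1]
    rw [integral_finsetSum _ fun u _ => integrable_finsetSum _ fun u' _ =>
      integrable_finsetSum _ fun a _ => integrable_finsetSum _ fun a' _ => hint u u' a a']
    simp only [dotProduct, Matrix.mulVec, Finset.mul_sum]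
    refine Finset.sum_congr rfl fun u _ => ?_
    rw [integral_finsetSum _ fun u' _ => integrable_finsetSum _ fun a _ =>
      integrable_finsetSum _ fun a' _ => hint u u' a a']
    refine Finset.sum_congr rfl fun u' _ => ?_
    rw [integral_finsetSum _ fun a _ => integrable_finsetSum _ fun a' _ => hint u u' a a',
      plug_link, Finset.sum_mul, Finset.mul_sum]
    refine Finset.sum_congr rfl fun a _ => ?_
    rw [integral_finsetSum _ fun a' _ => hint u u' a a', Finset.sum_mul, Finset.mul_sum]
    refine Finset.sum_congr rfl fun a' _ => ?_
    rw [integral_mul_const, Pi.star_apply, ← hρ]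
    simp only [rotateOp, Matrix.of_apply]
    ring
  have hI : Integrable (fun h => ((‖(mat W (g⁻¹ * h)).trace‖ ^ 2 : ℝ) : ℂ) * (P h * ρ).trace) μ := by
    simp only [h1]
    exact integrable_finsetSum _ fun u _ => integrable_finsetSum _ fun u' _ =>
      integrable_finsetSum _ fun a _ => integrable_finsetSum _ fun a' _ => hint u u' a a'
  have h4 := integral_re hI
  rw [chFid, h3]
  refine (congrArg (· / (Fintype.card x : ℝ) ^ 2) h4.symm).trans ?_
  rw [← integral_div]
  refine integral_congr_ae (Filter.Eventually.of_forall fun h => ?_)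
  simp only [RCLike.re_to_complex]
  rw [Complex.re_ofReal_mul]
  ring

lemma trace_tpow {d : ℕ} (M : ℕ) (A : Matrix (Fin d) (Fin d) ℂ) :
    (tpow d M A).trace = A.trace ^ M := by
  rw [Matrix.trace, Matrix.trace, ← Fin.prod_const, Finset.prod_univ_sum, Fintype.piFinset_univ]
  rfl

lemma norm_trace_tpow_div {d : ℕ} (M : ℕ) (A : Matrix (Fin d) (Fin d) ℂ) :
    (‖(tpow d M A).trace‖ / Fintype.card (Pow d M)) ^ 2 = (‖A.trace‖ / d) ^ (2 * M) := by
  rw [trace_tpow, norm_pow, Fintype.card_pi_const, Fintype.card_fin]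
  push_cast
  rw [← div_pow, ← pow_mul, mul_comm]

/-- A measure-and-rotate strategy achieves the value of the estimation strategy. -/
lemma globalFid_measureRotate {d N : ℕ} {m : Type*} [Fintype m] [DecidableEq m] (ν : Measure G)
    {U : G →* Matrix.unitaryGroup (Fin d) ℂ} (hU : ContMat U) (M : ℕ)
    (S : Matrix (m × (Pow d N × Pow d N)) (m × (Pow d N × Pow d N)) ℂ) {μ : Measure G}
    {P : G → Matrix m m ℂ} (hP : ∀ a b, Integrable (fun h => P h a b) μ) :
    globalFid ν U (link (measureRotate U M μ P) S) = estValue ν U M S μ P := by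
  rw [globalFid, estValue]
  refine integral_congr_ae (Filter.Eventually.of_forall fun g => ?_)
  dsimp only
  rw [measureRotate_eq, outChoi]
  refine (chFid_rotate (hU.tpowRep M) hP S (tpow d N (mat U g)) g).trans ?_
  simp only [mat_tpowRep, norm_trace_tpow_div, goal_eq]

lemma isRetrieving_measureRotate {d : ℕ} {m : Type*} [Fintype m] [DecidableEq m]
    {U : G →* Matrix.unitaryGroup (Fin d) ℂ} (hU : ContMat U) (M : ℕ) {μ : Measure G}
    {P : G → Matrix m m ℂ} (hP : IsPOVM μ P) : IsRetrieving (measureRotate U M μ P) :=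
  isRetrieving_iff.mpr ⟨posSemidef_rotateOp (hU.tpowRep M) hP, traceOut_rotateOp (hU.tpowRep M) hP⟩

end Rotate

/-! ### Local channels -/

section Local

variable {d m : ℕ}

/-- The comb of the `i`-th local channel when the other inputs are in the state `T`. -/
def localComb {κ : Type*} (L : Matrix ((Pow d (m + 1) × Pow d (m + 1)) × κ)
    ((Pow d (m + 1) × Pow d (m + 1)) × κ) ℂ) (i : Fin (m + 1)) (T : Matrix (Pow d m) (Pow d m) ℂ) :
    Matrix ((Fin d × Fin d) × κ) ((Fin d × Fin d) × κ) ℂ :=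
  Matrix.of fun u u' => ∑ y : Pow d m, ∑ s : Pow d m, ∑ s' : Pow d m,
    L ((i.insertNth (α := fun _ => Fin d) u.1.1 y, i.insertNth (α := fun _ => Fin d) u.1.2 s), u.2)
      ((i.insertNth (α := fun _ => Fin d) u'.1.1 y, i.insertNth (α := fun _ => Fin d) u'.1.2 s'),
        u'.2) * T s s'

/-- Restricting to one copy commutes with inserting the examples. The single-copy fidelity is thus
the fidelity of a comb with one output copy, to which the central inequality applies with W = U. -/
lemma localChoi_plug {o j : Type*} [Fintype o] [Fintype j]
    (L : Matrix ((Pow d (m + 1) × Pow d (m + 1)) × (o × j))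
      ((Pow d (m + 1) × Pow d (m + 1)) × (o × j)) ℂ) (i : Fin (m + 1))
    (T : Matrix (Pow d m) (Pow d m) ℂ) (V : Matrix o j ℂ) :
    localChoi (plug L V) i T = plug (localComb L i T) V := by
  ext u u'
  simp only [localChoi, plug, localComb, Matrix.of_apply]
  simp only [← Fintype.sum_prod_type', Finset.sum_mul]
  refine Fintype.sum_equiv ⟨fun k => (k.2.2.2.1, k.2.2.2.2, k.1, k.2.1, k.2.2.1),
    fun k => (k.2.2.1, k.2.2.2.1, k.2.2.2.2, k.1, k.2.1), fun _ => rfl, fun _ => rfl⟩ _ _ fun k => ?_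
  dsimp only [Equiv.coe_fn_mk]
  ring

lemma posSemidef_localComb {κ : Type*} [Fintype κ] [DecidableEq κ]
    {L : Matrix ((Pow d (m + 1) × Pow d (m + 1)) × κ) ((Pow d (m + 1) × Pow d (m + 1)) × κ) ℂ}
    (hL : L.PosSemidef) (i : Fin (m + 1)) {T : Matrix (Pow d m) (Pow d m) ℂ}
    (hT : T.PosSemidef) : (localComb L i T).PosSemidef := by
  have h1 : localComb L i T = ∑ y : Pow d m, Matrix.of fun u u' => ∑ s, ∑ s',
      ((L ⊗ₖ T).submatrix (fun k : Pow d m × ((Fin d × Fin d) × κ) =>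
        (((i.insertNth (α := fun _ => Fin d) k.2.1.1 y,
          i.insertNth (α := fun _ => Fin d) k.2.1.2 k.1), k.2.2), k.1))
        (fun k : Pow d m × ((Fin d × Fin d) × κ) =>
        (((i.insertNth (α := fun _ => Fin d) k.2.1.1 y,
          i.insertNth (α := fun _ => Fin d) k.2.1.2 k.1), k.2.2), k.1))) (s, u) (s', u') := by
    ext u u'
    rw [Matrix.sum_apply]
    rfl
  rw [h1]
  exact Matrix.posSemidef_sum _ fun y _ => posSemidef_sum_sum ((hL.kronecker hT).submatrix _)

lemma sum_insertNth (i : Fin (m + 1)) (f : Pow d (m + 1) → ℂ) :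
    ∑ a : Fin d, ∑ y : Pow d m, f (i.insertNth (α := fun _ => Fin d) a y) = ∑ z, f z := by
  rw [← (Fin.insertNthEquiv (fun _ => Fin d) i).sum_comp, Fintype.sum_prod_type]
  rfl

/-- The output kept and the outputs discarded together exhaust the final outputs, and the fixed
input state has unit trace. The storing part, hence the weights, are unchanged. -/
lemma TraceOut.localComb {κ : Type*}
    {L : Matrix ((Pow d (m + 1) × Pow d (m + 1)) × κ) ((Pow d (m + 1) × Pow d (m + 1)) × κ) ℂ}
    {S : Matrix κ κ ℂ} (hL : TraceOut L S) (i : Fin (m + 1)) {T : Matrix (Pow d m) (Pow d m) ℂ}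
    (hT : T.trace = 1) : TraceOut (QLearn.localComb L i T) S := by
  intro y w y' w'
  simp only [QLearn.localComb, Matrix.of_apply]
  calc _ = ∑ s, ∑ s', (∑ z, L ((z, i.insertNth (α := fun _ => Fin d) y s), w)
        ((z, i.insertNth (α := fun _ => Fin d) y' s'), w')) * T s s' := by
        simp only [← sum_insertNth i, Finset.sum_mul]
        simp only [← Fintype.sum_prod_type']
        exact Fintype.sum_equiv ⟨fun k => (k.2.2.1, k.2.2.2, k.1, k.2.1),
          fun k => (k.2.2.1, k.2.2.2, k.1, k.2.1), fun _ => rfl, fun _ => rfl⟩ _ _ fun _ => rfl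
    _ = ∑ s, ∑ s', (if y = y' ∧ s = s' then S w w' * T s s' else 0) := by
        refine Finset.sum_congr rfl fun s _ => Finset.sum_congr rfl fun s' _ => ?_
        rw [hL]
        simp only [Fin.insertNth_inj, ite_mul, zero_mul]
    _ = _ := by
        split_ifs with h
        · simp only [h, true_and, Finset.sum_ite_eq, Finset.mem_univ, if_true, ← Finset.mul_sum]
          rw [show ∑ s, T s s = T.trace from rfl, hT, mul_one]
        · simp [h]

lemma localComb_link {w κ : Type*} [Fintype κ]
    (R : Matrix ((Pow d (m + 1) × Pow d (m + 1)) × κ) ((Pow d (m + 1) × Pow d (m + 1)) × κ) ℂ)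
    (S : Matrix (κ × w) (κ × w) ℂ) (i : Fin (m + 1)) (T : Matrix (Pow d m) (Pow d m) ℂ) :
    localComb (link R S) i T = link (localComb R i T) S := by
  ext u u'
  simp only [link, localComb, Matrix.of_apply]
  simp only [← Fintype.sum_prod_type', Finset.sum_mul]
  refine Fintype.sum_equiv ⟨fun k => (k.2.2.2.1, k.2.2.2.2, k.1, k.2.1, k.2.2.1),
    fun k => (k.2.2.1, k.2.2.2.1, k.2.2.2.2, k.1, k.2.1), fun _ => rfl, fun _ => rfl⟩ _ _ fun k => ?_
  dsimp only [Equiv.coe_fn_mk]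
  ring

lemma tpow_insertNth (A : Matrix (Fin d) (Fin d) ℂ) (i : Fin (m + 1)) (a b : Fin d)
    (y s : Pow d m) :
    tpow d (m + 1) A (i.insertNth (α := fun _ => Fin d) a y)
      (i.insertNth (α := fun _ => Fin d) b s) = A a b * tpow d m A y s := by
  simp [tpow, Fin.prod_univ_succAbove _ i]

variable {G : Type*} [Group G] [MeasurableSpace G] [TopologicalSpace G] [CompactSpace G]
  [BorelSpace G]

/-- On outcome h the other copies undergo a unitary and are discarded, which contributes only the
trace of their state. The rotation of the i-th copy does not see them, hence the independence from
M, i and Σ. -/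
lemma localComb_measureRotate {κ : Type*} [Fintype κ] [DecidableEq κ]
    {U : G →* Matrix.unitaryGroup (Fin d) ℂ} (hU : ContMat U) {μ : Measure G}
    {P : G → Matrix κ κ ℂ} (hP : ∀ a b, Integrable (fun h => P h a b) μ) (i : Fin (m + 1))
    {T : Matrix (Pow d m) (Pow d m) ℂ} (hT : T.trace = 1) :
    localComb (measureRotate U (m + 1) μ P) i T = rotateOp (fun h => mat U h) μ P := by
  ext u u'
  simp only [localComb, measureRotate_eq, rotateOp, Matrix.of_apply]
  have hint := fun z z' => integrable_rotate (hU.tpowRep (m + 1)) hP z z' u.2 u'.2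
  simp only [← integral_mul_const]
  rw [← Fintype.sum_prod_type', ← Fintype.sum_prod_type',
    ← integral_finsetSum _ fun k _ => (hint _ _).mul_const _]
  refine integral_congr_ae (Filter.Eventually.of_forall fun h => ?_)
  dsimp only [dket]
  simp only [mat_tpowRep, tpow_insertNth]
  rw [Fintype.sum_prod_type, Fintype.sum_prod_type]
  -- The trace of V T V† for the unitary V = U_h^{⊗m}.
  have h1 : ∑ y, ∑ s, ∑ s', tpow d m (mat U h) y s * star (tpow d m (mat U h) y s') * T s s' =
      1 := by
    rw [Finset.sum_comm]
    simp_rw [Finset.sum_comm (s := Finset.univ (α := Pow d m)) (f := fun y s' =>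
      tpow d m (mat U h) y _ * star (tpow d m (mat U h) y s') * T _ s'), ← Finset.sum_mul]
    have h2 := mat_apply_mul_star (tpowRep U m) h
    simp only [mat_tpowRep] at h2
    simp only [h2, ite_mul, one_mul, zero_mul, Finset.sum_ite_eq, Finset.mem_univ, if_true]
    exact hT
  calc _ = (mat U h u.1.1 u.1.2 * star (mat U h u'.1.1 u'.1.2) * P h u'.2 u.2) *
        ∑ y, ∑ s, ∑ s', tpow d m (mat U h) y s * star (tpow d m (mat U h) y s') * T s s' := by
        simp only [Finset.mul_sum]
        refine Finset.sum_congr rfl fun y _ => Finset.sum_congr rfl fun s _ =>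
          Finset.sum_congr rfl fun s' _ => ?_
        rw [star_mul']
        ring
    _ = _ := by rw [h1, mul_one]

end Local

/-! ### Optimality -/

section Optimality

/-- The completing term 1 - Π annihilates the stored states, so only P_Û contributes. -/
lemma Irr.estValue_parallelBoard {G : Type*} [Group G] [MeasurableSpace G] (ν : Measure G) {d : ℕ}
    {U : G →* Matrix.unitaryGroup (Fin d) ℂ} {N : ℕ} (D : Irr U N) (M : ℕ) (p : Fin D.num → ℝ) :
    estValue ν U M (parallelBoard (D.inputState p)) ν D.povm = D.meanGoal ν M p := by
  rw [estValue, Irr.meanGoal]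
  have h1 : ∀ g h, (D.povm h * plug (parallelBoard (D.inputState p)) (tpow d N (mat U g))).trace =
      star (D.stored p g) ⬝ᵥ (D.etaOp h).mulVec (D.stored p g) := by
    intro g h
    rw [plug_parallelBoard, Matrix.mul_vecMulVec, Matrix.trace_vecMulVec, dotProduct_comm]
    change star (D.stored p g) ⬝ᵥ (D.povm h).mulVec (D.stored p g) = _
    rw [Irr.povm, Matrix.add_mulVec, Matrix.sub_mulVec, Matrix.one_mulVec, D.proj_mulVec_stored,
      sub_self, add_zero]
  simp only [h1]

variable {G : Type*} [Group G] [TopologicalSpace G] [IsTopologicalGroup G]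
  [CompactSpace G] [MeasurableSpace G] [BorelSpace G]
  (ν : Measure G) [ν.IsHaarMeasure] [IsProbabilityMeasure ν]
  {d : ℕ} {U : G →* Matrix.unitaryGroup (Fin d) ℂ} {N : ℕ} (D : Irr U N)

lemma Irr.globalFid_le (hd : 0 < d) (hU : ContMat U) (M : ℕ)
    {L : Matrix (CombIdx d N M) (CombIdx d N M) ℂ} (hL : L.PosSemidef)
    {S : Matrix (Pow d N × Pow d N) (Pow d N × Pow d N) ℂ} (hS : TraceOut L S) :
    globalFid ν U L ≤ D.meanGoal ν M (D.weight ν S) := by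
  have : Nonempty (Fin d) := ⟨⟨0, hd⟩⟩
  refine (D.integral_chFid_le ν hU (hU.tpowRep M) hL hS).trans_eq ?_
  simp only [mat_tpowRep, norm_trace_tpow_div]
  rw [D.meanGoal_eq]

lemma Irr.singleFid_le (hd : 0 < d) (hU : ContMat U) {m : ℕ} (i : Fin (m + 1))
    {T : Matrix (Pow d m) (Pow d m) ℂ} (hT : IsState T)
    {L : Matrix (CombIdx d N (m + 1)) (CombIdx d N (m + 1)) ℂ} (hL : L.PosSemidef)
    {S : Matrix (Pow d N × Pow d N) (Pow d N × Pow d N) ℂ} (hS : TraceOut L S) :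
    singleFid ν U i T L ≤ D.meanGoal ν 1 (D.weight ν S) := by
  have : Nonempty (Fin d) := ⟨⟨0, hd⟩⟩
  have h1 := D.integral_chFid_le ν hU hU (posSemidef_localComb hL i hT.1) (hS.localComb i hT.2)
  rw [Fintype.card_fin] at h1
  rw [D.meanGoal_eq]
  simp only [singleFid, outChoi, localChoi_plug]
  exact h1

lemma Irr.singleFid_strategy (hU : ContMat U) {m : ℕ} (i : Fin (m + 1))
    {T : Matrix (Pow d m) (Pow d m) ℂ} (hT : IsState T) (p : Fin D.num → ℝ) :
    singleFid ν U i T (D.strategy ν (m + 1) p) = D.meanGoal ν 1 p := by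
  rw [← D.estValue_parallelBoard ν 1 p, singleFid, estValue, Irr.strategy]
  refine integral_congr_ae (Filter.Eventually.of_forall fun g => ?_)
  have hP := D.integrable_povm ν hU
  dsimp only
  rw [outChoi, localChoi_plug, localComb_link, localComb_measureRotate hU hP i hT.2,
    chFid_rotate hU hP]
  simp only [goal_eq, Fintype.card_fin, mul_one]

end Optimality

end

end QLearn

/-! ### The main theorem -/

open QLearn in
theorem mainTheorem4 {G : Type*} [Group G] [TopologicalSpace G] [IsTopologicalGroup G]
    [CompactSpace G] [T2Space G] [MeasurableSpace G] [BorelSpace G]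
    (ν : Measure G) [ν.IsHaarMeasure] [IsProbabilityMeasure ν]
    {d : ℕ} (hd : 0 < d) (U : G →* Matrix.unitaryGroup (Fin d) ℂ) (hU : Continuous U) (N : ℕ) :
    Nonempty (Irr U N) ∧ ∀ D : Irr U N,
      -- the strategies are legitimate: `P_Û` is a POVM, parallel storage is a storing board,
      -- measure-and-rotate is a retrieving channel, the whole is a learning comb
      (IsPOVM ν D.povm ∧
        ∀ p ∈ stdSimplex ℝ (Fin D.num), IsStoringBoard (parallelBoard (D.inputState p)) ∧
          ∀ M : ℕ, IsRetrieving (measureRotate U M ν D.povm) ∧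
            IsLearningComb (D.strategy ν M p)) ∧
      -- global fidelity
      (∀ M : ℕ, 1 ≤ M →
        -- for each input state of the optimal form, measure-and-rotate is the best retrieving,
        -- and its global fidelity is the mean of the goal function
        (∀ p ∈ stdSimplex ℝ (Fin D.num),
          globalFid ν U (D.strategy ν M p) = D.meanGoal ν M p ∧
          estValue ν U M (parallelBoard (D.inputState p)) ν D.povm = D.meanGoal ν M p ∧
          ∀ R : Matrix ((Pow d M × Pow d M) × (Pow d N × Pow d N))
              ((Pow d M × Pow d M) × (Pow d N × Pow d N)) ℂ, IsRetrieving R →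
            globalFid ν U (link R (parallelBoard (D.inputState p))) ≤ D.meanGoal ν M p) ∧
        -- optimal coefficients exist
        (∃ p ∈ stdSimplex ℝ (Fin D.num),
          IsMaxOn (D.meanGoal ν M) (stdSimplex ℝ (Fin D.num)) p) ∧
        -- and they are optimal among all learning strategies and all estimation strategies
        (∀ p ∈ stdSimplex ℝ (Fin D.num),
          IsMaxOn (D.meanGoal ν M) (stdSimplex ℝ (Fin D.num)) p →
          (∀ L : Matrix (CombIdx d N M) (CombIdx d N M) ℂ, IsLearningComb L →
            globalFid ν U L ≤ D.meanGoal ν M p) ∧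
          (∀ (m : Type) [Fintype m] [DecidableEq m]
            (S : Matrix (m × (Pow d N × Pow d N)) (m × (Pow d N × Pow d N)) ℂ)
            (μ : Measure G) [IsFiniteMeasure μ] (P : G → Matrix m m ℂ),
            IsStoringBoard S → IsPOVM μ P → estValue ν U M S μ P ≤ D.meanGoal ν M p))) ∧
      -- single-copy fidelity, with `M = m + 1` copies
      (∀ p ∈ stdSimplex ℝ (Fin D.num), ∀ (m : ℕ) (i : Fin (m + 1))
          (T : Matrix (Pow d m) (Pow d m) ℂ), IsState T →
        -- the same value for every number of copies
        singleFid ν U i T (D.strategy ν (m + 1) p) = D.meanGoal ν 1 p ∧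
        -- best retrieving for the given input state
        (∀ R : Matrix ((Pow d (m + 1) × Pow d (m + 1)) × (Pow d N × Pow d N))
            ((Pow d (m + 1) × Pow d (m + 1)) × (Pow d N × Pow d N)) ℂ, IsRetrieving R →
          singleFid ν U i T (link R (parallelBoard (D.inputState p))) ≤ D.meanGoal ν 1 p) ∧
        -- with the coefficients that are optimal for one copy, best among all learning strategies
        (IsMaxOn (D.meanGoal ν 1) (stdSimplex ℝ (Fin D.num)) p →
          ∀ L : Matrix (CombIdx d N (m + 1)) (CombIdx d N (m + 1)) ℂ, IsLearningComb L →
            singleFid ν U i T L ≤ D.meanGoal ν 1 p)) := by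
  have hU' := contMat_of_continuous hU
  have hF : Nonempty (Fin d) := ⟨⟨0, hd⟩⟩
  refine ⟨nonempty_irr U N, fun D => ?_⟩
  have hP := D.isPOVM ν hU'
  have hB : ∀ p ∈ stdSimplex ℝ (Fin D.num), IsStoringBoard (parallelBoard (D.inputState p)) :=
    fun p hp => isStoringBoard_parallelBoard (D.star_inputState_dotProduct hp)
  have hR := fun M => isRetrieving_measureRotate hU' M hP
  -- With the storage fixed, the general bound lands on p itself. The retrieving optimality thus
  -- needs no maximality of p.
  have hw : ∀ p ∈ stdSimplex ℝ (Fin D.num), D.weight ν (Matrix.of fun w w' =>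
      ∑ a, parallelBoard (D.inputState p) (a, w) (a, w')) = p :=
    fun p hp => funext (D.weight_parallelBoard ν hU' hp)
  have hlearn : ∀ (M : ℕ) (p : Fin D.num → ℝ),
      IsMaxOn (D.meanGoal ν M) (stdSimplex ℝ (Fin D.num)) p →
      ∀ L : Matrix (CombIdx d N M) (CombIdx d N M) ℂ, IsLearningComb L →
        globalFid ν U L ≤ D.meanGoal ν M p := by
    rintro M p hmax L ⟨hL, S, hS, hLS⟩
    exact (D.globalFid_le ν hd hU' M hL hLS).trans
      (hmax (D.weight_mem_stdSimplex ν hU' (S := S) hLS hL hS))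
  refine ⟨⟨hP, fun p hp => ⟨hB p hp, fun M => ⟨hR M, isLearningComb_link (hR M) (hB p hp)⟩⟩⟩,
    fun M _ => ⟨fun p hp => ⟨?_, D.estValue_parallelBoard ν M p, fun R hRet => ?_⟩,
      D.exists_isMaxOn ν hd hU' M, fun p _ hmax => ⟨hlearn M p hmax, ?_⟩⟩,
    fun p hp m i T hT => ⟨D.singleFid_strategy ν hU' i hT p, fun R hRet => ?_, ?_⟩⟩
  · rw [← D.estValue_parallelBoard ν M p]
    exact globalFid_measureRotate ν hU' M _ hP.2.1
  · rw [isRetrieving_iff] at hRet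
    have h := D.globalFid_le ν hd hU' M (posSemidef_link hRet.1 (hB p hp).1) (hRet.2.link _)
    rwa [hw p hp] at h
  · intro κ _ _ S μ _ P hS hPO
    -- Rotating according to the outcome turns any estimation strategy into a learning comb of the
    -- same value, so the bound on learning covers estimation, whatever the reference measure μ.
    rw [← globalFid_measureRotate ν hU' M S hPO.2.1]
    exact hlearn M p hmax _ (isLearningComb_link (isRetrieving_measureRotate hU' M hPO) hS)
  · rw [isRetrieving_iff] at hRet
    have h := D.singleFid_le ν hd hU' i hT (posSemidef_link hRet.1 (hB p hp).1) (hRet.2.link _)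
    rwa [hw p hp] at h
  · rintro hmax L ⟨hL, S, hS, hLS⟩
    exact (D.singleFid_le ν hd hU' i hT hL hLS).trans
      (hmax (D.weight_mem_stdSimplex ν hU' (S := S) hLS hL hS))
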